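/- Let $d\ge1$, $\mathbb{R}^d_+=(0,\infty)^d$, $\alpha\in[-1/2,\infty)^d$, $|\alpha|=\alpha_1+\dots+\alpha_d$, $\varepsilon\in\{0,1\}^d$, and $dw_\alpha^+(x)=\prod_{j=1}^d x_j^{2\alpha_j+1}\,dx$ on $\mathbb{R}^d_+$. Norms $\|\cdot\|_2$ and inner products are those of $L^2(\mathbb{R}^d_+,dw_\alpha^+)$ (complex-valued functions). For $m\in\mathbb{N}^d$ let $h_m^\alpha(x)=\prod_{i=1}^d h_{m_i}^{\alpha_i}(x_i)$, $x\in\mathbb{R}^d$, be the generalized Hermite functions, where, with $L_n^a$ the Laguerre polynomials, $$h_{2n}^{a}(u)=(-1)^n\Big(\tfrac{n!}{\Gamma(n+a+1)}\Big)^{1/2}e^{-u^2/2}L_n^{a}(u^2),\qquad h_{2n+1}^{a}(u)=(-1)^n\Big(\tfrac{n!}{\Gamma(n+a+2)}\Big)^{1/2}e^{-u^2/2}\,u\,L_n^{a+1}(u^2).$$ Put $\lambda_n=2n+2|\alpha|+2d$, $\mathcal{N}_\varepsilon=\{m\in\mathbb{N}^d: m_i\equiv\varepsilon_i \ (\mathrm{mod}\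 2),\ i=1,\dots,d\}$ and $$T_tf(x)=T_t^{\alpha,\varepsilon,+}f(x)=\sum_{n=0}^\infty e^{-t\lambda_n}\sum_{|m|=n,\;m\in\mathcal{N}_\varepsilon}\langle f,h_m^\alpha\rangle\,h_m^\alpha(x),\qquad t>0,\ x\in\mathbb{R}^d.$$ Let $\sigma_j$ be the reflection changing the sign of the $j$th coordinate, $\mathfrak{D}_jF(x)=\partial_{x_j}F(x)+(\alpha_j+\tfrac12)\frac{F(x)-F(\sigma_jx)}{x_j}$, $\delta_j=\mathfrak{D}_j+x_j$, $\delta_j^*=-\mathfrak{D}_j+x_j$. Let $V_r(x)=w_\alpha^+\big(\{z\in\mathbb{R}^d_+:|z_j-x_j|<r,\ j=1,\dots,d\}\big)$, $A=\{(z,t)\in\mathbb{R}^d\times(0,\infty):|z|<\sqrt t\}$ and $A(x)=(x,0)+A$. For $x\in\mathbb{R}^d_+$ and $j=1,\dots,d$ define $$g_V(f)(x)=\|\partial_tT_tf(x)\|_{L^2(t\,dt)},\quad g_H^j(f)(x)=\|\delta_jT_tf(x)\|_{L^2(dt)},\quad g_{H,*}^j(f)(x)=\|\delta_j^*T_tf(x)\|_{L^2(dt)},$$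 $$S_V(f)(x)=\Big(\int_{A(x)}t\,|\partial_tT_tf(z)|^2\chi_{\{z\in\mathbb{R}^d_+\}}\frac{dw_\alpha^+(z)\,dt}{V_{\sqrt t}(x)}\Big)^{1/2},\quad S_H^j(f)(x)=\Big(\int_{A(x)}|\delta_jT_tf(z)|^2\chi_{\{z\in\mathbb{R}^d_+\}}\frac{dw_\alpha^+(z)\,dt}{V_{\sqrt t}(x)}\Big)^{1/2},$$ and $S_{H,*}^j(f)(x)$ like $S_H^j(f)(x)$ with $\delta_j^*$ in place of $\delta_j$. For every $f\in L^2(\mathbb{R}^d_+,dw_\alpha^+)$ the series defining $T_tf$ converges for all $t>0$ and $x\in\mathbb{R}^d$, and $T_tf(x)$ is differentiable in $t>0$ and in $x\in\mathbb{R}^d_+$, so that these square functions are well defined. Moreover, the following hold. 1. Each of $g_V,\ g_H^j,\ g_{H,*}^j,\ S_V,\ S_H^j,\ S_{H,*}^j$ is bounded on $L^2(\mathbb{R}^d_+,dw_\alpha^+)$. Consequently, each of them, viewed as a vector-valued operator, is a bounded linear operator from $L^2(\mathbb{R}^d_+,dw_\alpha^+)$ to the Bochner–Lebesgue space $L^2_{\mathbb{B}}(\mathbb{R}^d_+,dw_\alpha^+)$.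 More precisely, this concerns the operators sending $f$ to the following functions of $x$: $\{\partial_tT_tf(x)\}_{t>0}$ with $\mathbb{B}=L^2((0,\infty),t\,dt)$; $\{\delta_jT_tf(x)\}_{t>0}$ and $\{\delta_j^*T_tf(x)\}_{t>0}$ with $\mathbb{B}=L^2((0,\infty),dt)$; $\{\partial_tT_tf(x+z)\sqrt{\varphi(x,z,t)}\,\chi_{\{x+z\in\mathbb{R}^d_+\}}\}_{(z,t)\in A}$ with $\mathbb{B}=L^2(A,t\,dt\,dz)$; and the same expression with $\delta_j$ or $\delta_j^*$ in place of $\partial_t$, with $\mathbb{B}=L^2(A,dt\,dz)$. Here $\varphi(x,z,t)=V_{\sqrt t}(x)^{-1}\prod_{i=1}^d(x_i+z_i)^{2\alpha_i+1}$. 2. For all $f\in L^2(\mathbb{R}^d_+,dw_\alpha^+)$, $$\|g_V(f)\|_2=2^{-d-1}\|f\|_2,\qquad \|S_V(f)\|_2\simeq\|f\|_2,$$ $$\Big\|\Big(\sum_{j=1}^d g_H^j(f)^2\Big)^{1/2}\Big\|_2\lesssim\|f\|_2,\qquad \Big\|\Big(\sum_{j=1}^d S_H^j(f)^2\Big)^{1/2}\Big\|_2\lesssim\|f\|_2,$$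 $$\Big\|\Big(\sum_{j=1}^d g_{H,*}^j(f)^2\Big)^{1/2}\Big\|_2\simeq\|f\|_2,\qquad \Big\|\Big(\sum_{j=1}^d S_{H,*}^j(f)^2\Big)^{1/2}\Big\|_2\simeq\|f\|_2.$$ 3. If $\varepsilon\neq(0,\dots,0)$, then both relations $\lesssim$ in 2 can be replaced by $\simeq$ (for all $f\in L^2(\mathbb{R}^d_+,dw_\alpha^+)$). If $\varepsilon=(0,\dots,0)$, the same is true for all $f\in L^2(\mathbb{R}^d_+,dw_\alpha^+)$ with $\langle f,h^\alpha_{(0,\dots,0)}\rangle=0$. Here $X\lesssim Y$ means $X\le CY$ with a finite constant $C$ independent of $f$, and $X\simeq Y$ means $X\lesssim Y$ and $Y\lesssim X$. -/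

import Mathlib

open MeasureTheory
open scoped ENNReal NNReal

noncomputable section

namespace LaguerreSquare

/-- The generalized Laguerre polynomial of degree `n` and order `a > -1`, evaluated at `x`:
`L_n^a(x) = ∑_{k=0}^n (-1)^k Γ(n+a+1) / (Γ(k+a+1) (n-k)! k!) x^k`. -/
def laguerre (n : ℕ) (a x : ℝ) : ℝ :=
  ∑ k ∈ Finset.range (n + 1),
    (-1) ^ k * Real.Gamma (n + a + 1) /
      (Real.Gamma (k + a + 1) * (n - k).factorial * k.factorial) * x ^ k

/-- The normalizing constants of the one-dimensional generalized Hermite functions,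
`d_{2n,a} = (-1)^n (n! / Γ(n+a+1))^{1/2}`, `d_{2n+1,a} = (-1)^n (n! / Γ(n+a+2))^{1/2}`. -/
def hermiteConst (a : ℝ) (k : ℕ) : ℝ :=
  (-1) ^ (k / 2) *
    Real.sqrt ((k / 2).factorial / Real.Gamma ((k / 2 : ℕ) + (a + (k % 2 : ℕ)) + 1))

/-- The one-dimensional generalized Hermite functions
`h_{2n}^a(x) = d_{2n,a} e^{-x²/2} L_n^a(x²)`,
`h_{2n+1}^a(x) = d_{2n+1,a} e^{-x²/2} x L_n^{a+1}(x²)`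
(below `k / 2` is the integer quotient `n` and `k % 2` is the remainder, `0` or `1`). -/
def hermiteOne (a : ℝ) (k : ℕ) (x : ℝ) : ℝ :=
  hermiteConst a k * Real.exp (-x ^ 2 / 2) * x ^ (k % 2) *
    laguerre (k / 2) (a + (k % 2 : ℕ)) (x ^ 2)

variable {d : ℕ}

/-- The generalized Hermite functions on `ℝ^d`, tensor products of the one-dimensional ones. -/
def hermite (α : Fin d → ℝ) (m : Fin d → ℕ) (x : EuclideanSpace ℝ (Fin d)) : ℝ :=
  ∏ i, hermiteOne (α i) (m i) (x i)

/-- The open orthant `ℝ^d_+ = (0,∞)^d`. -/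
def orthant (d : ℕ) : Set (EuclideanSpace ℝ (Fin d)) := {x | ∀ i, 0 < x i}

/-- The measure `dw_α^+ = ∏ x_j^{2α_j+1} dx` on `ℝ^d_+` (as a measure on `ℝ^d` carried by
the orthant). -/
def wPlus (α : Fin d → ℝ) : Measure (EuclideanSpace ℝ (Fin d)) :=
  (volume.restrict (orthant d)).withDensity
    (fun x => ENNReal.ofReal (∏ j, (x j) ^ (2 * α j + 1)))

/-- The one-dimensional measure `dw_a^+ = x^{2a+1} dx` on `(0,∞)`. -/
def wPlusOne (a : ℝ) : Measure ℝ :=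
  (volume.restrict (Set.Ioi 0)).withDensity (fun x => ENNReal.ofReal (x ^ (2 * a + 1)))

/-- `V_r^{a,+}(x) = w_a^+((x-r, x+r) ∩ (0,∞))` in dimension one. -/
def volOne (a r x : ℝ) : ℝ := (wPlusOne a).real (Set.Ioo (x - r) (x + r))

/-- `V_r^{α,+}(x)`, the `w_α^+`-measure of the cube centred at `x` with side lengths `2r`. -/
def vol (α : Fin d → ℝ) (r : ℝ) (x : EuclideanSpace ℝ (Fin d)) : ℝ :=
  ∏ j, volOne (α j) r (x j)

/-- The function `φ_α(x,z,t) = ∏_j (x_j+z_j)^{2α_j+1} / V_{√t}^{α_j,+}(x_j)`. -/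
def phi (α : Fin d → ℝ) (x z : EuclideanSpace ℝ (Fin d)) (t : ℝ) : ℝ :=
  ∏ j, (x j + z j) ^ (2 * α j + 1) / volOne (α j) (Real.sqrt t) (x j)

/-- `⟨f, h_m^α⟩` in `L²(ℝ^d_+, dw_α^+)` (`h_m^α` is real valued). -/
def coeff (α : Fin d → ℝ) (f : EuclideanSpace ℝ (Fin d) → ℂ) (m : Fin d → ℕ) : ℂ :=
  ∫ x, f x * (hermite α m x : ℂ) ∂(wPlus α)

/-- The eigenvalues `λ_n^α = 2n + 2|α| + 2d`, with `|α| = α_1 + ... + α_d`. -/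
def eigen (α : Fin d → ℝ) (n : ℕ) : ℝ := 2 * n + 2 * ∑ i, α i + 2 * d

/-- The multi-indices `m ∈ N_ε` with `|m| = n`: `m_i` is even if `ε_i = 0` and odd if
`ε_i = 1`. -/
def level (ε : Fin d → ZMod 2) (n : ℕ) : Finset (Fin d → ℕ) :=
  (Finset.univ.piAntidiag n).filter (fun m => ∀ i, (m i : ZMod 2) = ε i)

/-- The `n`-th term `e^{-tλ_n} ∑_{|m|=n, m ∈ N_ε} ⟨f, h_m⟩ h_m(x)` of `T_t^{α,ε,+} f(x)`. -/
def semigroupTerm (α : Fin d → ℝ) (ε : Fin d → ZMod 2) (f : EuclideanSpace ℝ (Fin d) → ℂ)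
    (t : ℝ) (x : EuclideanSpace ℝ (Fin d)) (n : ℕ) : ℂ :=
  (Real.exp (-t * eigen α n) : ℂ) * ∑ m ∈ level ε n, coeff α f m * (hermite α m x : ℂ)

/-- `T_t^{α,ε,+} f(x)`. The series makes sense at every `x ∈ ℝ^d`, and defines the
`ε`-symmetric extension to `ℝ^d` of the function on `ℝ^d_+`. -/
def semigroup (α : Fin d → ℝ) (ε : Fin d → ZMod 2) (f : EuclideanSpace ℝ (Fin d) → ℂ)
    (t : ℝ) (x : EuclideanSpace ℝ (Fin d)) : ℂ :=
  ∑' n, semigroupTerm α ε f t x n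

/-- The reflection `σ_j`, changing the sign of the `j`-th coordinate. -/
def reflect (j : Fin d) (x : EuclideanSpace ℝ (Fin d)) : EuclideanSpace ℝ (Fin d) :=
  WithLp.toLp 2 (Function.update (fun i => x i) j (-(x j)))

/-- The Dunkl operator
`T_j^α F(x) = ∂_{x_j} F(x) + (α_j + 1/2) (F(x) - F(σ_j x)) / x_j`. -/
def dunkl (α : Fin d → ℝ) (j : Fin d) (F : EuclideanSpace ℝ (Fin d) → ℂ)
    (x : EuclideanSpace ℝ (Fin d)) : ℂ :=
  lineDeriv ℝ F x (EuclideanSpace.single j 1) +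
    ((α j + 1 / 2 : ℝ) : ℂ) * ((F x - F (reflect j x)) / (x j : ℂ))

/-- `δ_j = T_j^α + x_j`. -/
def delta (α : Fin d → ℝ) (j : Fin d) (F : EuclideanSpace ℝ (Fin d) → ℂ)
    (x : EuclideanSpace ℝ (Fin d)) : ℂ :=
  dunkl α j F x + (x j : ℂ) * F x

/-- `δ_j^* = -T_j^α + x_j`. -/
def deltaStar (α : Fin d → ℝ) (j : Fin d) (F : EuclideanSpace ℝ (Fin d) → ℂ)
    (x : EuclideanSpace ℝ (Fin d)) : ℂ :=
  -dunkl α j F x + (x j : ℂ) * F x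

/-- `∂_t T_t^{α,ε,+} f(x)`. -/
def vertical (α : Fin d → ℝ) (ε : Fin d → ZMod 2) (f : EuclideanSpace ℝ (Fin d) → ℂ)
    (t : ℝ) (x : EuclideanSpace ℝ (Fin d)) : ℂ :=
  deriv (fun s => semigroup α ε f s x) t

/-- `δ_j T_t^{α,ε,+} f(x)`. -/
def horizontal (α : Fin d → ℝ) (ε : Fin d → ZMod 2) (j : Fin d)
    (f : EuclideanSpace ℝ (Fin d) → ℂ) (t : ℝ) (x : EuclideanSpace ℝ (Fin d)) : ℂ :=
  delta α j (semigroup α ε f t) x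

/-- `δ_j^* T_t^{α,ε,+} f(x)`. -/
def horizontalStar (α : Fin d → ℝ) (ε : Fin d → ZMod 2) (j : Fin d)
    (f : EuclideanSpace ℝ (Fin d) → ℂ) (t : ℝ) (x : EuclideanSpace ℝ (Fin d)) : ℂ :=
  deltaStar α j (semigroup α ε f t) x

/-- The measure `dt` on `(0,∞)`. -/
def measDt : Measure ℝ := volume.restrict (Set.Ioi 0)

/-- The measure `t dt` on `(0,∞)`. -/
def measTdt : Measure ℝ := (volume.restrict (Set.Ioi 0)).withDensity ENNReal.ofReal

/-- The parabolic cone `A = {(z,t) : t > 0, |z| < √t}`. -/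
def cone (d : ℕ) : Set (EuclideanSpace ℝ (Fin d) × ℝ) :=
  {p | 0 < p.2 ∧ ‖p.1‖ < Real.sqrt p.2}

/-- The cone `A(x) = (x,0) + A`. -/
def coneAt (x : EuclideanSpace ℝ (Fin d)) : Set (EuclideanSpace ℝ (Fin d) × ℝ) :=
  (fun p => (x, (0 : ℝ)) + p) '' cone d

/-- The measure `dz dt` on `A`. -/
def measConeDt (d : ℕ) : Measure (EuclideanSpace ℝ (Fin d) × ℝ) :=
  volume.restrict (cone d)

/-- The measure `t dz dt` on `A`. -/
def measConeTdt (d : ℕ) : Measure (EuclideanSpace ℝ (Fin d) × ℝ) :=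
  (volume.restrict (cone d)).withDensity (fun p => ENNReal.ofReal p.2)

/-! Square functions take values in `[0,∞]`, so that they are defined for every `f`. -/

/-- `g_V^{ε,+}(f)(x) = ‖∂_t T_t^{α,ε,+} f(x)‖_{L²(t dt)}`. -/
def gV (α : Fin d → ℝ) (ε : Fin d → ZMod 2) (f : EuclideanSpace ℝ (Fin d) → ℂ)
    (x : EuclideanSpace ℝ (Fin d)) : ℝ≥0∞ :=
  eLpNorm (fun t => vertical α ε f t x) 2 measTdt

/-- `g_H^{j,ε,+}(f)(x) = ‖δ_j T_t^{α,ε,+} f(x)‖_{L²(dt)}`. -/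
def gH (α : Fin d → ℝ) (ε : Fin d → ZMod 2) (j : Fin d)
    (f : EuclideanSpace ℝ (Fin d) → ℂ) (x : EuclideanSpace ℝ (Fin d)) : ℝ≥0∞ :=
  eLpNorm (fun t => horizontal α ε j f t x) 2 measDt

/-- `g_{H,*}^{j,ε,+}(f)(x) = ‖δ_j^* T_t^{α,ε,+} f(x)‖_{L²(dt)}`. -/
def gHStar (α : Fin d → ℝ) (ε : Fin d → ZMod 2) (j : Fin d)
    (f : EuclideanSpace ℝ (Fin d) → ℂ) (x : EuclideanSpace ℝ (Fin d)) : ℝ≥0∞ :=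
  eLpNorm (fun t => horizontalStar α ε j f t x) 2 measDt

/-- `S_V^{ε,+}(f)(x)`, the square root of
`∫_{A(x)} t |∂_t T_t^{α,ε,+} f(z)|² χ_{z ∈ ℝ^d_+} dw_α^+(z) / V_{√t}^{α,+}(x) dt`;
the measure `w_α^+` is carried by the orthant. -/
def SV (α : Fin d → ℝ) (ε : Fin d → ZMod 2) (f : EuclideanSpace ℝ (Fin d) → ℂ)
    (x : EuclideanSpace ℝ (Fin d)) : ℝ≥0∞ :=
  (∫⁻ p in coneAt x, ENNReal.ofReal p.2 * ‖vertical α ε f p.2 p.1‖ₑ ^ 2 /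
    ENNReal.ofReal (vol α (Real.sqrt p.2) x) ∂((wPlus α).prod volume)) ^ (1 / 2 : ℝ)

/-- `S_H^{j,ε,+}(f)(x)`, the square root of
`∫_{A(x)} |δ_j T_t^{α,ε,+} f(z)|² χ_{z ∈ ℝ^d_+} dw_α^+(z) / V_{√t}^{α,+}(x) dt`. -/
def SH (α : Fin d → ℝ) (ε : Fin d → ZMod 2) (j : Fin d)
    (f : EuclideanSpace ℝ (Fin d) → ℂ) (x : EuclideanSpace ℝ (Fin d)) : ℝ≥0∞ :=
  (∫⁻ p in coneAt x, ‖horizontal α ε j f p.2 p.1‖ₑ ^ 2 /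
    ENNReal.ofReal (vol α (Real.sqrt p.2) x) ∂((wPlus α).prod volume)) ^ (1 / 2 : ℝ)

/-- `S_{H,*}^{j,ε,+}(f)(x)`, the square root of
`∫_{A(x)} |δ_j^* T_t^{α,ε,+} f(z)|² χ_{z ∈ ℝ^d_+} dw_α^+(z) / V_{√t}^{α,+}(x) dt`. -/
def SHStar (α : Fin d → ℝ) (ε : Fin d → ZMod 2) (j : Fin d)
    (f : EuclideanSpace ℝ (Fin d) → ℂ) (x : EuclideanSpace ℝ (Fin d)) : ℝ≥0∞ :=
  (∫⁻ p in coneAt x, ‖horizontalStar α ε j f p.2 p.1‖ₑ ^ 2 /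
    ENNReal.ofReal (vol α (Real.sqrt p.2) x) ∂((wPlus α).prod volume)) ^ (1 / 2 : ℝ)

/-- For a family `u t x`, the `B`-valued function whose norm is the corresponding area integral:
`(z,t) ↦ u_t(x+z) √φ_α(x,z,t) χ_{x+z ∈ ℝ^d_+}`. -/
def onCone (α : Fin d → ℝ) (u : ℝ → EuclideanSpace ℝ (Fin d) → ℂ)
    (x : EuclideanSpace ℝ (Fin d)) (p : EuclideanSpace ℝ (Fin d) × ℝ) : ℂ :=
  (orthant d).indicator
    (fun y => u p.2 y * (Real.sqrt (phi α x p.1 p.2) : ℂ)) (x + p.1)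

/-- The pointwise `ℓ²`-norm of `d` functions with values in `[0,∞]`. -/
def ell2 (S : Fin d → EuclideanSpace ℝ (Fin d) → ℝ≥0∞) (x : EuclideanSpace ℝ (Fin d)) :
    ℝ≥0∞ :=
  (∑ j, S j x ^ 2) ^ (1 / 2 : ℝ)

/-- `‖S f‖ ≤ C ‖f‖` in `L²(ℝ^d_+, dw_α^+)` for all `f ∈ L²` with a constant independent of `f`
(and `S f` is measurable). -/
def BoundedL2 (α : Fin d → ℝ)
    (S : (EuclideanSpace ℝ (Fin d) → ℂ) → EuclideanSpace ℝ (Fin d) → ℝ≥0∞) : Prop :=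
  ∃ C : ℝ≥0, ∀ f, MemLp f 2 (wPlus α) →
    AEMeasurable (S f) (wPlus α) ∧
      eLpNorm (S f) 2 (wPlus α) ≤ C * eLpNorm f 2 (wPlus α)

/-- `c ‖f‖ ≤ ‖S f‖ ≤ C ‖f‖` in `L²(ℝ^d_+, dw_α^+)` for all `f ∈ L²` satisfying `P`, with
constants `c > 0` and `C` independent of `f`. -/
def ComparableL2 (α : Fin d → ℝ) (P : (EuclideanSpace ℝ (Fin d) → ℂ) → Prop)
    (S : (EuclideanSpace ℝ (Fin d) → ℂ) → EuclideanSpace ℝ (Fin d) → ℝ≥0∞) : Prop :=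
  ∃ c C : ℝ≥0, 0 < c ∧ ∀ f, MemLp f 2 (wPlus α) → P f →
    c * eLpNorm f 2 (wPlus α) ≤ eLpNorm (S f) 2 (wPlus α) ∧
      eLpNorm (S f) 2 (wPlus α) ≤ C * eLpNorm f 2 (wPlus α)

/-- The assignment sending `f` and `x` to the function `U f x` on `(Y, ν)` defines a bounded
linear operator from `L²(ℝ^d_+, dw_α^+)` to the Bochner-Lebesgue space
`L²_B(ℝ^d_+, dw_α^+)` with `B = L²(Y, ν)`. -/
def BoundedVectorL2 {Y : Type} [MeasurableSpace Y] (α : Fin d → ℝ) (ν : Measure Y)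
    (U : (EuclideanSpace ℝ (Fin d) → ℂ) → EuclideanSpace ℝ (Fin d) → Y → ℂ) : Prop :=
  ∃ 𝒯 : Lp ℂ 2 (wPlus α) →L[ℂ] Lp (Lp ℂ 2 ν) 2 (wPlus α),
    ∀ f : Lp ℂ 2 (wPlus α), ∀ᵐ x ∂(wPlus α), ((𝒯 f) x : Y → ℂ) =ᵐ[ν] U f x

end LaguerreSquare

end

open LaguerreSquare

open LaguerreSquare
namespace LaguerreSquare

variable {d : ℕ}

/-! Everything is diagonal in the functions h_m with m in a fixed parity class. On the whole space
all h_m are orthonormal; on the orthant only those of equal parities remain orthogonal, each with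
squared norm 2^{-d}, and one parity class is already complete (`integral_hermite_mul`,
`ae_eq_zero_of_integral_mul_hermite_eq_zero`). Hence the sum of |⟨f, h_m⟩|² over the class is
2^{-d}‖f‖² (`tsum_parityCoeff`).

The operators δ_j and δ_j^* are ladder operators: δ_j h_m = c_{m_j} h_{m-e_j} and δ_j^* h_m =
c_{m_j+1} h_{m+e_j}, where c is `ladder` and 2k ≤ c_k² ≤ 2k + 4a + 2. Both relations follow from the
three-term recurrence `two_mul_mul_hermiteOne` and the derivative formula `hasDerivAt_hermiteOne`,
which rest on contiguous relations for Laguerre polynomials. So each of ∂_t T_t f, δ_j T_t f, δ_j^*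
T_t f is a series ∑ b_m e^{-tλ} h_{τ(m)} whose index map τ is injective, with values in one parity
class, on the support of b. Orthogonality survives, and the squared norm in x at time t is 2^{-d} ∑
|b_m|² e^{-2tλ} (`lintegral_expansion`).

Integrating in time (`energy_eq_tsum`) leaves a numerical multiplier of |⟨f, h_m⟩|². It is λ²/(2λ)²
= 1/4 in the vertical case, whence the exact constant 2^{-d-1}. In the horizontal cases it is
c²/(2λ), bounded above, and after summation over j also bounded below, except that ∑_j c_{m_j}²
vanishes at m = 0. This is why the ground state has to be excluded for δ_j when ε = 0.

For the conical functions, Tonelli moves the integration in x onto the factor χ(|x-z| <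
√t)/V_{√t}(x). By doubling of the measure its integral lies between two positive constants
(`exists_average_bounds`), so conical and radial square functions have comparable norms
(`exists_areaSq_bounds`). The vector-valued operators have these square functions as pointwise
norms; what remains is measurability and linearity (`boundedVectorL2_of_bound`).

Pointwise convergence and termwise differentiation only need that h_m grows, locally uniformly in x,
slower than any exponential in |m|, since e^{-tλ} decays geometrically in |m|. -/

/-! ### Contiguous relations for Laguerre polynomials. -/

lemma gammaArg_pos {a : ℝ} (ha : -1 < a) (k : ℕ) : 0 < (k : ℝ) + a + 1 := by
  have : (0 : ℝ) ≤ k := k.cast_nonneg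
  linarith

lemma gamma_shift {a : ℝ} (ha : -1 < a) (k : ℕ) :
    Real.Gamma (k + (a + 1) + 1) = (k + a + 1) * Real.Gamma (k + a + 1) := by
  rw [← Real.Gamma_add_one (gammaArg_pos ha k).ne']; ring_nf

lemma gamma_succ {a : ℝ} (ha : -1 < a) (k : ℕ) :
    Real.Gamma ((k + 1 : ℕ) + a + 1) = (k + a + 1) * Real.Gamma (k + a + 1) := by
  rw [← Real.Gamma_add_one (gammaArg_pos ha k).ne']; push_cast; ring_nf

lemma gammaShift_ne_zero {a : ℝ} (ha : -1 < a) (k : ℕ) : Real.Gamma (k + a + 1) ≠ 0 :=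
  (Real.Gamma_pos_of_pos (gammaArg_pos ha k)).ne'

/-- The coefficients of the Laguerre polynomials. -/
noncomputable def laguerreCoeff (n : ℕ) (a : ℝ) (k : ℕ) : ℝ :=
  (-1) ^ k * Real.Gamma (n + a + 1) / (Real.Gamma (k + a + 1) * (n - k).factorial * k.factorial)

lemma laguerre_eq (n : ℕ) (a x : ℝ) :
    laguerre n a x = ∑ k ∈ Finset.range (n + 1), laguerreCoeff n a k * x ^ k := rfl

lemma laguerreCoeff_self {a : ℝ} (ha : -1 < a) (n : ℕ) :
    laguerreCoeff n a n = (-1) ^ n / n.factorial := by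
  have := gammaShift_ne_zero ha n
  have h3 : (n.factorial : ℝ) ≠ 0 := by positivity
  simp only [laguerreCoeff, Nat.sub_self, Nat.factorial_zero, Nat.cast_one, mul_one]
  field_simp

/-- Writing n = k + l removes the truncated subtraction, so that coefficient identities reduce to
the recursions for factorials and Γ. -/
lemma laguerreCoeff_of_eq_add (a : ℝ) {n k l : ℕ} (h : n = k + l) :
    laguerreCoeff n a k = (-1) ^ k * Real.Gamma (n + a + 1) /
      (Real.Gamma (k + a + 1) * l.factorial * k.factorial) := by
  rw [laguerreCoeff, h, Nat.add_sub_cancel_left]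

/-- Checked coefficient by coefficient. The top term is split off: the second summand has lower
degree, and the leading coefficient does not depend on the order. -/
lemma laguerre_add_laguerre {a : ℝ} (ha : -1 < a) (n : ℕ) (x : ℝ) :
    laguerre (n + 1) a x + laguerre n (a + 1) x = laguerre (n + 1) (a + 1) x := by
  have ha' : -1 < a + 1 := by linarith
  simp only [laguerre_eq]
  rw [Finset.sum_range_succ _ (n + 1), Finset.sum_range_succ _ (n + 1), add_right_comm,
    ← Finset.sum_add_distrib, laguerreCoeff_self ha, laguerreCoeff_self ha']
  congr 1
  refine Finset.sum_congr rfl fun k hk => ?_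
  obtain ⟨l, rfl⟩ := Nat.exists_eq_add_of_le (Finset.mem_range_succ_iff.mp hk)
  rw [laguerreCoeff_of_eq_add a (add_assoc k l 1), laguerreCoeff_of_eq_add _ (add_assoc k l 1),
    laguerreCoeff_of_eq_add _ rfl, gamma_succ ha, gamma_succ ha', gamma_shift ha, gamma_shift ha,
    Nat.factorial_succ]
  have h1 := gammaShift_ne_zero ha k
  have h2 := (gammaArg_pos ha k).ne'
  have h3 : (k.factorial : ℝ) ≠ 0 := by positivity
  have h4 : (l.factorial : ℝ) ≠ 0 := by positivity
  push_cast
  field_simp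
  ring

/-- Again a comparison of coefficients, after aligning x · x^k with x^{k+1}: `h0` is the
cancellation of the constant terms, `h1` the middle range, `h2` the leading term. -/
lemma mul_laguerre {a : ℝ} (ha : -1 < a) (n : ℕ) (x : ℝ) :
    x * laguerre n (a + 1) x =
      (n + a + 1) * laguerre n a x - (n + 1) * laguerre (n + 1) a x := by
  have ha' : -1 < a + 1 := by linarith
  rw [laguerre_eq n (a + 1), Finset.sum_range_succ _ n, laguerre_eq n a,
    Finset.sum_range_succ' _ n, laguerre_eq (n + 1), Finset.sum_range_succ' _ (n + 1),
    Finset.sum_range_succ _ n, laguerreCoeff_self ha', laguerreCoeff_self ha]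
  have h0 : ((n : ℝ) + a + 1) * laguerreCoeff n a 0 = (n + 1) * laguerreCoeff (n + 1) a 0 := by
    simp only [laguerreCoeff, gamma_succ ha, Nat.sub_zero, Nat.factorial_succ]
    have h1 := gammaShift_ne_zero ha 0
    have h4 : (n.factorial : ℝ) ≠ 0 := by positivity
    push_cast at h1 ⊢
    field_simp
  have h1 : x * ∑ k ∈ Finset.range n, laguerreCoeff n (a + 1) k * x ^ k =
      (n + a + 1) * ∑ k ∈ Finset.range n, laguerreCoeff n a (k + 1) * x ^ (k + 1) -
      (n + 1) * ∑ k ∈ Finset.range n, laguerreCoeff (n + 1) a (k + 1) * x ^ (k + 1) := by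
    rw [Finset.mul_sum, Finset.mul_sum, Finset.mul_sum, ← Finset.sum_sub_distrib]
    refine Finset.sum_congr rfl fun k hk => ?_
    obtain ⟨l, rfl⟩ := Nat.exists_eq_add_of_lt (Finset.mem_range.mp hk)
    have e1 : k + l + 1 = k + (l + 1) := by ring
    have e2 : k + l + 1 = (k + 1) + l := by ring
    have e3 : k + l + 1 + 1 = (k + 1) + (l + 1) := by ring
    rw [laguerreCoeff_of_eq_add _ e1, laguerreCoeff_of_eq_add _ e2, laguerreCoeff_of_eq_add _ e3, gamma_succ ha (k + l + 1), gamma_shift ha, gamma_shift ha,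
      gamma_succ ha k, Nat.factorial_succ, Nat.factorial_succ]
    have h1 := gammaShift_ne_zero ha k
    have h2 := (gammaArg_pos ha k).ne'
    have h3 : (k.factorial : ℝ) ≠ 0 := by positivity
    have h4 : (l.factorial : ℝ) ≠ 0 := by positivity
    push_cast
    field_simp
    ring
  have h2 : x * ((-1) ^ n / n.factorial * x ^ n) =
      -((n + 1) * ((-1) ^ (n + 1) / (n + 1).factorial * x ^ (n + 1))) := by
    rw [Nat.factorial_succ]
    have h4 : (n.factorial : ℝ) ≠ 0 := by positivity
    push_cast
    field_simp
    ring
  rw [mul_add, h1, h2]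
  linear_combination (-1 : ℝ) * h0

lemma hasDerivAt_laguerre_zero (a x : ℝ) : HasDerivAt (laguerre 0 a) 0 x := by
  have : laguerre 0 a = fun _ => laguerre 0 a 0 := by
    funext y; simp [laguerre]
  rw [this]; exact hasDerivAt_const _ _

lemma hasDerivAt_laguerre_succ {a : ℝ} (ha : -1 < a) (n : ℕ) (x : ℝ) :
    HasDerivAt (laguerre (n + 1) a) (-laguerre n (a + 1) x) x := by
  have h : HasDerivAt (laguerre (n + 1) a)
      (∑ k ∈ Finset.range (n + 1 + 1), laguerreCoeff (n + 1) a k * (k * x ^ (k - 1))) x :=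
    HasDerivAt.fun_sum fun k _ => (hasDerivAt_pow k x).const_mul _
  convert h using 1
  rw [Finset.sum_range_succ', laguerre_eq, ← Finset.sum_neg_distrib]
  simp only [Nat.cast_zero, zero_mul, mul_zero, add_zero, Nat.add_sub_cancel]
  refine Finset.sum_congr rfl fun k hk => ?_
  obtain ⟨l, rfl⟩ := Nat.exists_eq_add_of_le (Finset.mem_range_succ_iff.mp hk)
  have ha' : -1 < a + 1 := by linarith
  have e3 : k + l + 1 = (k + 1) + l := by ring
  rw [laguerreCoeff_of_eq_add _ e3, laguerreCoeff_of_eq_add _ rfl, gamma_succ ha, gamma_shift ha, gamma_shift ha,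
    gamma_succ ha k, Nat.factorial_succ]
  have h1 := gammaShift_ne_zero ha k
  have h2 := (gammaArg_pos ha k).ne'
  have h3 : (k.factorial : ℝ) ≠ 0 := by positivity
  have h4 : (l.factorial : ℝ) ≠ 0 := by positivity
  push_cast
  field_simp
  ring

/-- This says (x^{a+1} L_n^{a+1})' = (n+a+1) x^a L_n^a, the form needed for the odd Hermite
functions. The derivative is existentially quantified because its formula differs for n = 0. -/
lemma add_one_mul_laguerre_deriv {a : ℝ} (ha : -1 < a) (n : ℕ) (x : ℝ) :
    ∃ D, HasDerivAt (laguerre n (a + 1)) D x ∧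
      (a + 1) * laguerre n (a + 1) x + x * D = (n + a + 1) * laguerre n a x := by
  have ha' : -1 < a + 1 := by linarith
  rcases n with _ | n
  · refine ⟨0, hasDerivAt_laguerre_zero _ _, ?_⟩
    have h1 := gammaShift_ne_zero ha 0
    have h2 := gammaShift_ne_zero ha' 0
    simp only [laguerre, zero_add, Finset.range_one, Finset.sum_singleton, pow_zero, one_mul,
      Nat.factorial_zero, Nat.sub_zero, Nat.cast_one, mul_one, mul_zero, add_zero] at h1 h2 ⊢
    rw [div_self h1, div_self h2]
    push_cast
    ring
  · refine ⟨_, hasDerivAt_laguerre_succ ha' n x, ?_⟩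
    have e1 := mul_laguerre ha' n x
    have e2 := laguerre_add_laguerre ha n x
    rw [mul_neg, e1]
    push_cast
    linear_combination (-(n + a + 2 : ℝ)) * e2

/-! ### One-dimensional generalized Hermite functions and ladder relations. -/

/-- The coefficients of the ladder relations `δ h_k = c_k h_{k-1}`, `δ^* h_k = c_{k+1} h_{k+1}`. -/
noncomputable def ladder (a : ℝ) (k : ℕ) : ℝ := Real.sqrt (2 * k + (k % 2 : ℕ) * (4 * a + 2))

lemma ladder_zero (a : ℝ) : ladder a 0 = 0 := by simp [ladder]

lemma ladder_nonneg (a : ℝ) (k : ℕ) : 0 ≤ ladder a k := Real.sqrt_nonneg _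

lemma ladder_sq {a : ℝ} (ha : -1 / 2 ≤ a) (k : ℕ) :
    ladder a k ^ 2 = 2 * k + (k % 2 : ℕ) * (4 * a + 2) := by
  rw [ladder, Real.sq_sqrt]
  have : 0 ≤ 4 * a + 2 := by linarith
  positivity

lemma two_mul_le_ladder_sq {a : ℝ} (ha : -1 / 2 ≤ a) (k : ℕ) : 2 * (k : ℝ) ≤ ladder a k ^ 2 := by
  rw [ladder_sq ha]
  have : 0 ≤ 4 * a + 2 := by linarith
  have := mul_nonneg (Nat.cast_nonneg (α := ℝ) (k % 2)) this
  linarith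

lemma ladder_sq_le {a : ℝ} (ha : -1 / 2 ≤ a) (k : ℕ) :
    ladder a k ^ 2 ≤ 2 * k + (4 * a + 2) := by
  rw [ladder_sq ha]
  have h : 0 ≤ 4 * a + 2 := by linarith
  have h2 : ((k % 2 : ℕ) : ℝ) ≤ 1 := by
    exact_mod_cast Nat.lt_succ_iff.mp (Nat.mod_lt k two_pos)
  have := mul_le_mul_of_nonneg_right h2 h
  linarith

lemma ladder_succ_pos {a : ℝ} (ha : -1 / 2 ≤ a) (k : ℕ) : 0 < ladder a (k + 1) := by
  have := two_mul_le_ladder_sq ha (k + 1)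
  push_cast at this
  have hk : (0 : ℝ) ≤ k := k.cast_nonneg
  refine lt_of_le_of_ne (ladder_nonneg _ _) fun h => ?_
  rw [← h] at this
  norm_num at this
  linarith

lemma ladder_odd (a : ℝ) (n : ℕ) : ladder a (2 * n + 1) = 2 * Real.sqrt (n + a + 1) := by
  have : (2 * n + 1) % 2 = 1 := by omega
  rw [ladder, this]
  push_cast
  rw [show (2 * (2 * (n : ℝ) + 1) + 1 * (4 * a + 2)) = 2 ^ 2 * (n + a + 1) by ring,
    Real.sqrt_mul (by norm_num), Real.sqrt_sq (by norm_num)]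

lemma ladder_even (a : ℝ) (n : ℕ) : ladder a (2 * n) = 2 * Real.sqrt n := by
  have : (2 * n) % 2 = 0 := by omega
  rw [ladder, this]
  push_cast
  rw [show (2 * (2 * (n : ℝ)) + 0 * (4 * a + 2)) = 2 ^ 2 * n by ring,
    Real.sqrt_mul (by norm_num), Real.sqrt_sq (by norm_num)]

lemma hermiteConst_even (a : ℝ) (n : ℕ) : hermiteConst a (2 * n) =
    (-1) ^ n * Real.sqrt (n.factorial / Real.Gamma (n + a + 1)) := by
  have h : (2 * n) % 2 = 0 := by omega
  have h' : (2 * n) / 2 = n := by omega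
  simp [hermiteConst, h, h']

lemma hermiteConst_odd (a : ℝ) (n : ℕ) : hermiteConst a (2 * n + 1) =
    (-1) ^ n * Real.sqrt (n.factorial / Real.Gamma (n + (a + 1) + 1)) := by
  have h : (2 * n + 1) % 2 = 1 := by omega
  have h' : (2 * n + 1) / 2 = n := by omega
  simp [hermiteConst, h, h']

/-- With the next lemma this expresses the neighbouring normalizing constants through `hermiteConst
a (2 * n + 1)`; the square roots that appear are half the ladder coefficients. -/
lemma hermiteConst_even_eq {a : ℝ} (ha : -1 < a) (n : ℕ) :
    hermiteConst a (2 * n) = Real.sqrt (n + a + 1) * hermiteConst a (2 * n + 1) := by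
  have h := gammaArg_pos ha n
  have hG := Real.Gamma_pos_of_pos h
  rw [hermiteConst_even, hermiteConst_odd, mul_left_comm, ← Real.sqrt_mul h.le, gamma_shift ha]
  congr 2
  field_simp

lemma hermiteConst_succ_even_eq {a : ℝ} (ha : -1 < a) (n : ℕ) :
    hermiteConst a (2 * (n + 1)) = -(Real.sqrt (n + 1) * hermiteConst a (2 * n + 1)) := by
  have h := gammaArg_pos ha n
  have hG := Real.Gamma_pos_of_pos h
  rw [hermiteConst_even, hermiteConst_odd, mul_left_comm, ← Real.sqrt_mul (by positivity),
    gamma_shift ha, gamma_succ ha, pow_succ, Nat.factorial_succ, mul_neg_one, neg_mul]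
  congr 3
  push_cast
  ring

lemma hermiteOne_even (a : ℝ) (n : ℕ) (x : ℝ) : hermiteOne a (2 * n) x =
    hermiteConst a (2 * n) * Real.exp (-x ^ 2 / 2) * laguerre n a (x ^ 2) := by
  have h : (2 * n) % 2 = 0 := by omega
  have h' : (2 * n) / 2 = n := by omega
  simp [hermiteOne, h, h']

lemma hermiteOne_odd (a : ℝ) (n : ℕ) (x : ℝ) : hermiteOne a (2 * n + 1) x =
    hermiteConst a (2 * n + 1) * Real.exp (-x ^ 2 / 2) * x * laguerre n (a + 1) (x ^ 2) := by
  have h : (2 * n + 1) % 2 = 1 := by omega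
  have h' : (2 * n + 1) / 2 = n := by omega
  simp [hermiteOne, h, h']

lemma hermiteOne_neg (a : ℝ) (k : ℕ) (x : ℝ) : hermiteOne a k (-x) = (-1) ^ k * hermiteOne a k x := by
  rcases Nat.even_or_odd' k with ⟨n, rfl | rfl⟩
  · simp [hermiteOne_even]
  · simp [hermiteOne_odd, pow_succ, pow_mul]

/-- The three term recurrence of the generalized Hermite functions. -/
lemma two_mul_mul_hermiteOne {a : ℝ} (ha : -1 < a) (k : ℕ) (x : ℝ) :
    2 * x * hermiteOne a k x =
      ladder a k * hermiteOne a (k - 1) x + ladder a (k + 1) * hermiteOne a (k + 1) x := by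
  rcases Nat.even_or_odd' k with ⟨n, rfl | rfl⟩
  · rw [hermiteOne_even, ladder_odd, hermiteOne_odd]
    have h1 := hermiteConst_even_eq ha n
    rcases n with _ | n
    -- At k = 0 the index k - 1 truncates to 0, harmlessly, because its coefficient is 0.
    · rw [mul_zero, ladder_zero, zero_mul, zero_add]
      rw [show laguerre 0 (a + 1) (x ^ 2) = laguerre 0 a (x ^ 2) by
        have h1 := gammaShift_ne_zero ha 0
        have h2 := gammaShift_ne_zero (a := a + 1) (by linarith) 0
        simp only [laguerre, zero_add, Finset.range_one, Finset.sum_singleton, pow_zero, one_mul,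
          Nat.factorial_zero, Nat.sub_zero, Nat.cast_one, mul_one] at h1 h2 ⊢
        rw [div_self h1, div_self h2]]
      rw [mul_zero] at h1
      rw [h1]
      ring
    · rw [show 2 * (n + 1) - 1 = 2 * n + 1 by omega, hermiteOne_odd, ladder_even,
        ← laguerre_add_laguerre ha]
      have h2 := hermiteConst_succ_even_eq ha n
      push_cast at h1 h2 ⊢
      linear_combination (2 * x * Real.exp (-x ^ 2 / 2) * laguerre (n + 1) a (x ^ 2)) * h1
        + 2 * x * Real.exp (-x ^ 2 / 2) * laguerre n (a + 1) (x ^ 2) * (h1 - h2)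
  · rw [show 2 * n + 1 - 1 = 2 * n by omega, show 2 * n + 1 + 1 = 2 * (n + 1) by ring,
      hermiteOne_odd, hermiteOne_even, hermiteOne_even, ladder_odd, ladder_even,
      hermiteConst_even_eq ha, hermiteConst_succ_even_eq ha]
    have h1 := mul_laguerre ha n (x ^ 2)
    have hs := Real.mul_self_sqrt (gammaArg_pos ha n).le
    have hr := Real.mul_self_sqrt (show (0 : ℝ) ≤ n + 1 by positivity)
    push_cast
    linear_combination (2 * hermiteConst a (2 * n + 1) * Real.exp (-x ^ 2 / 2)) *
      (h1 - laguerre n a (x ^ 2) * hs + laguerre (n + 1) a (x ^ 2) * hr)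

lemma hasDerivAt_exp_neg_sq (x : ℝ) :
    HasDerivAt (fun y : ℝ => Real.exp (-y ^ 2 / 2)) (-x * Real.exp (-x ^ 2 / 2)) x := by
  have h : HasDerivAt (fun y : ℝ => -y ^ 2 / 2) (-x) x := by
    refine ((hasDerivAt_pow 2 x).neg.div_const 2).congr_deriv ?_
    push_cast
    ring
  exact h.exp.congr_deriv (mul_comm _ _)

/-- The lowering relation `δ h_k = c_k h_{k-1}`. -/
lemma hasDerivAt_hermiteOne {a : ℝ} (ha : -1 < a) (k : ℕ) {x : ℝ} (hx : x ≠ 0) :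
    HasDerivAt (hermiteOne a k) (ladder a k * hermiteOne a (k - 1) x - x * hermiteOne a k x -
      (a + 1 / 2) * ((hermiteOne a k x - hermiteOne a k (-x)) / x)) x := by
  have hsq : HasDerivAt (fun y : ℝ => y ^ 2) (2 * x) x := by
    simpa using hasDerivAt_pow 2 x
  have hE := hasDerivAt_exp_neg_sq x
  rw [hermiteOne_neg]
  rcases Nat.even_or_odd' k with ⟨n, rfl | rfl⟩
  · have hf : hermiteOne a (2 * n) = fun y =>
      hermiteConst a (2 * n) * Real.exp (-y ^ 2 / 2) * laguerre n a (y ^ 2) :=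
      funext (hermiteOne_even a n)
    rw [hermiteOne_even, hf, pow_mul, neg_one_sq, one_pow, one_mul, sub_self, zero_div, mul_zero,
      sub_zero]
    rcases n with _ | n
    · have hL : HasDerivAt (fun y : ℝ => laguerre 0 a (y ^ 2)) (0 * (2 * x)) x :=
        HasDerivAt.comp x (h := fun y : ℝ => y ^ 2) (hasDerivAt_laguerre_zero a (x ^ 2)) hsq
      convert! (hE.const_mul (hermiteConst a (2 * 0))).mul hL using 1
      rw [mul_zero, ladder_zero]
      ring
    · have hL : HasDerivAt (fun y : ℝ => laguerre (n + 1) a (y ^ 2))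
        (-laguerre n (a + 1) (x ^ 2) * (2 * x)) x :=
        HasDerivAt.comp x (h := fun y : ℝ => y ^ 2) (hasDerivAt_laguerre_succ ha n (x ^ 2)) hsq
      convert! (hE.const_mul (hermiteConst a (2 * (n + 1)))).mul hL using 1
      have h2 := hermiteConst_succ_even_eq ha n
      rw [show 2 * (n + 1) - 1 = 2 * n + 1 by omega, hermiteOne_odd, ladder_even]
      push_cast
      linear_combination (2 * x * Real.exp (-x ^ 2 / 2) * laguerre n (a + 1) (x ^ 2)) * h2
  · have hf : hermiteOne a (2 * n + 1) = fun y => hermiteConst a (2 * n + 1) *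
      Real.exp (-y ^ 2 / 2) * y * laguerre n (a + 1) (y ^ 2) := funext (hermiteOne_odd a n)
    -- For odd k the reflection quotient is 2h/x. Together with the derivative of the factor x it
    -- contributes 2(a+1)L, and adding 2x²D gives twice the left side of `hD'`.
    obtain ⟨D, hD, hD'⟩ := add_one_mul_laguerre_deriv ha n (x ^ 2)
    have hL : HasDerivAt (fun y : ℝ => laguerre n (a + 1) (y ^ 2)) (D * (2 * x)) x :=
      HasDerivAt.comp x (h := fun y : ℝ => y ^ 2) hD hsq
    rw [hermiteOne_odd, hf]
    convert! ((hE.const_mul (hermiteConst a (2 * n + 1))).mul (hasDerivAt_id x)).mul hL using 1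
    rw [Odd.neg_one_pow ⟨n, rfl⟩, ladder_odd,
      show 2 * n + 1 - 1 = 2 * n by omega, hermiteOne_even, hermiteConst_even_eq ha]
    have hs := Real.mul_self_sqrt (gammaArg_pos ha n).le
    simp only [Pi.mul_apply, id]
    generalize Real.exp (-x ^ 2 / 2) = E
    field_simp
    linear_combination (4 * E * hermiteConst a (2 * n + 1)) *
      (laguerre n a (x ^ 2) * hs - hD')

lemma continuous_hermiteOne (a : ℝ) (k : ℕ) : Continuous (hermiteOne a k) := by
  unfold hermiteOne laguerre
  fun_prop

/-! ### Growth in the degree and decay in the variable. -/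

/-- The recurrence solved for the top index. The growth bound in k and the Gaussian decay in x are
both inductions on this inequality. -/
lemma abs_hermiteOne_succ_le {a : ℝ} (ha : -1 / 2 ≤ a) (k : ℕ) (x : ℝ) :
    ladder a (k + 1) * |hermiteOne a (k + 1) x| ≤
      2 * |x| * |hermiteOne a k x| + ladder a k * |hermiteOne a (k - 1) x| := by
  have h := two_mul_mul_hermiteOne (show -1 < a by linarith) k x
  have h2 : ladder a (k + 1) * hermiteOne a (k + 1) x =
    2 * x * hermiteOne a k x - ladder a k * hermiteOne a (k - 1) x := by linarith
  calc ladder a (k + 1) * |hermiteOne a (k + 1) x|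
      = |ladder a (k + 1) * hermiteOne a (k + 1) x| := by
        rw [abs_mul, abs_of_nonneg (ladder_nonneg _ _)]
    _ ≤ |2 * x * hermiteOne a k x| + |ladder a k * hermiteOne a (k - 1) x| := by
        rw [h2]; exact abs_sub _ _
    _ = _ := by
        rw [abs_mul, abs_mul, abs_mul, abs_of_nonneg (ladder_nonneg _ _), abs_two]

/-- Locally uniformly in `x`, the generalized Hermite functions grow subexponentially in `k`. -/
lemma exists_hermiteOne_le {a : ℝ} (ha : -1 / 2 ≤ a) (R : ℝ) {ρ : ℝ} (hρ : 1 < ρ) :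
    ∃ C, 0 ≤ C ∧ ∀ k x, |x| ≤ R → |hermiteOne a k x| ≤ C * ρ ^ k := by
  have hb : ∀ k, ∃ B, ∀ x ∈ Set.Icc (-R) R, ‖hermiteOne a k x‖ ≤ B := fun k =>
    isCompact_Icc.exists_bound_of_continuousOn (continuous_hermiteOne a k).continuousOn
  choose B hB using hb
  -- K is so large that, for l ≥ K, 2R ≤ (ρ-1) c_{l+2} and c_{l+1} ≤ ρ c_{l+2}. The recurrence then
  -- closes with the same constant, as (ρ-1) ρ^{l+1} + ρ ρ^l = ρ^{l+2}; the constant only has to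
  -- dominate the first K + 2 functions.
  obtain ⟨K, hK⟩ : ∃ K : ℕ, ((2 * R) ^ 2 / (ρ - 1) ^ 2 + (4 * a + 2) / (ρ ^ 2 - 1)) ≤ 2 * K := by
    obtain ⟨K, hK⟩ := exists_nat_ge
      (((2 * R) ^ 2 / (ρ - 1) ^ 2 + (4 * a + 2) / (ρ ^ 2 - 1)))
    exact ⟨K, hK.trans (by linarith [K.cast_nonneg (α := ℝ)])⟩
  have hρ1 : 0 < ρ - 1 := by linarith
  have hρ2 : 0 < ρ ^ 2 - 1 := by nlinarith
  have ha2 : 0 ≤ 4 * a + 2 := by linarith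
  have hC0 : 0 ≤ ∑ i ∈ Finset.range (K + 2), |B i| := Finset.sum_nonneg fun i _ => abs_nonneg _
  refine ⟨∑ i ∈ Finset.range (K + 2), |B i|, hC0, ?_⟩
  set C := ∑ i ∈ Finset.range (K + 2), |B i| with hC
  intro k
  induction k using Nat.strong_induction_on with
  | _ k ih =>
    intro x hx
    by_cases hk : k < K + 2
    · have h1 : |hermiteOne a k x| ≤ |B k| := (hB k x (abs_le.mp hx)).trans (le_abs_self _)
      have h2 : |B k| ≤ C :=
        Finset.single_le_sum (f := fun i => |B i|) (fun i _ => abs_nonneg _)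
          (Finset.mem_range.mpr hk)
      exact h1.trans (h2.trans (le_mul_of_one_le_right hC0 (one_le_pow₀ hρ.le)))
    · obtain ⟨l, rfl⟩ : ∃ l, k = l + 1 + 1 := ⟨k - 2, by omega⟩
      have hKl : (K : ℝ) ≤ l := by exact_mod_cast (by omega : K ≤ l)
      have hR : 0 ≤ R := (abs_nonneg x).trans hx
      have i1 := ih (l + 1) (by omega) x hx
      have i2 := ih l (by omega) x hx
      have hrec := abs_hermiteOne_succ_le ha (l + 1) x
      rw [Nat.add_sub_cancel] at hrec
      have hp := ladder_succ_pos ha (l + 1)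
      have hlow := two_mul_le_ladder_sq ha (l + 1 + 1)
      have hup := ladder_sq_le ha (l + 1)
      push_cast at hlow hup
      have q1 : (2 * R) ^ 2 / (ρ - 1) ^ 2 ≤ 2 * K := by
        have : 0 ≤ (4 * a + 2) / (ρ ^ 2 - 1) := by positivity
        linarith
      have q2 : (4 * a + 2) / (ρ ^ 2 - 1) ≤ 2 * K := by
        have : 0 ≤ (2 * R) ^ 2 / (ρ - 1) ^ 2 := by positivity
        linarith
      rw [div_le_iff₀ (by positivity)] at q1 q2
      have c1 : 2 * R ≤ (ρ - 1) * ladder a (l + 1 + 1) := by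
        refine le_of_sq_le_sq ?_ (by positivity)
        rw [mul_pow (ρ - 1)]
        nlinarith [sq_nonneg (ρ - 1)]
      have c2 : ladder a (l + 1) ≤ ρ * ladder a (l + 1 + 1) := by
        refine le_of_sq_le_sq ?_ (by positivity)
        rw [mul_pow ρ]
        nlinarith
      refine le_of_mul_le_mul_left ?_ hp
      calc ladder a (l + 1 + 1) * |hermiteOne a (l + 1 + 1) x|
          ≤ 2 * |x| * |hermiteOne a (l + 1) x| + ladder a (l + 1) * |hermiteOne a l x| := hrec
        _ ≤ ((ρ - 1) * ladder a (l + 1 + 1)) * (C * ρ ^ (l + 1)) +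
            (ρ * ladder a (l + 1 + 1)) * (C * ρ ^ l) :=
          add_le_add (mul_le_mul (by linarith) i1 (abs_nonneg _) (by positivity))
            (mul_le_mul c2 i2 (abs_nonneg _) (by positivity))
        _ = _ := by ring

/-- Gaussian decay in `x` of the generalized Hermite functions. -/
lemma exists_hermiteOne_le_exp {a : ℝ} (ha : -1 / 2 ≤ a) (k : ℕ) {c : ℝ} (hc : c < 1 / 2) :
    ∃ C, 0 ≤ C ∧ ∀ x, |hermiteOne a k x| ≤ C * Real.exp (-c * x ^ 2) := by
  -- A factor |x| costs an arbitrarily small loss in the Gaussian rate. Each induction step pays it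
  -- once, hence the strict inequality c < 1/2 and the induction over all such c.
  have key : ∀ c c' : ℝ, c < c' → ∀ x, |x| * Real.exp (-c' * x ^ 2) ≤
      (1 + 1 / (c' - c)) * Real.exp (-c * x ^ 2) := by
    intro c c' h x
    have hd : 0 < c' - c := by linarith
    have e : Real.exp (-c * x ^ 2) = Real.exp ((c' - c) * x ^ 2) * Real.exp (-c' * x ^ 2) := by
      rw [← Real.exp_add]; ring_nf
    rw [e, ← mul_assoc]
    gcongr
    have h1 := Real.add_one_le_exp ((c' - c) * x ^ 2)
    have h3 : |x| ≤ 1 + x ^ 2 := by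
      rw [← sq_abs x]; nlinarith [sq_nonneg (|x| - 1 / 2)]
    have h4 : (1 + 1 / (c' - c)) * ((c' - c) * x ^ 2 + 1) =
      1 + x ^ 2 + (c' - c) * x ^ 2 + 1 / (c' - c) := by field_simp; ring
    calc |x| ≤ (1 + 1 / (c' - c)) * ((c' - c) * x ^ 2 + 1) := by
          rw [h4]
          have : 0 ≤ (c' - c) * x ^ 2 + 1 / (c' - c) := by positivity
          linarith
      _ ≤ _ := by gcongr
  induction k using Nat.strong_induction_on generalizing c with
  | _ k ih =>
    rcases k with _ | k
    · refine ⟨|hermiteConst a 0 * laguerre 0 a 0|, abs_nonneg _, fun x => ?_⟩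
      have : hermiteOne a 0 x = hermiteConst a 0 * laguerre 0 a 0 * Real.exp (-x ^ 2 / 2) := by
        simp [hermiteOne, laguerre]; ring
      rw [this, abs_mul, abs_of_pos (Real.exp_pos _)]
      gcongr
      nlinarith [sq_nonneg x]
    · obtain ⟨c', hc1, hc2⟩ := exists_between hc
      obtain ⟨C1, hC1, h1⟩ := ih k (by omega) hc2
      obtain ⟨C2, hC2, h2⟩ := ih (k - 1) (by omega) hc
      have hp := ladder_succ_pos ha k
      have hd : 0 < c' - c := by linarith
      have hl := ladder_nonneg a k
      refine ⟨(2 * (C1 * (1 + 1 / (c' - c))) + ladder a k * C2) / ladder a (k + 1),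
        by positivity, fun x => ?_⟩
      refine le_of_mul_le_mul_left ((abs_hermiteOne_succ_le ha k x).trans ?_) hp
      have h3 := key c c' hc1 x
      calc 2 * |x| * |hermiteOne a k x| + ladder a k * |hermiteOne a (k - 1) x|
          ≤ 2 * |x| * (C1 * Real.exp (-c' * x ^ 2)) + ladder a k * (C2 * Real.exp (-c * x ^ 2)) := by
            gcongr
            · exact h1 x
            · exact h2 x
        _ = 2 * C1 * (|x| * Real.exp (-c' * x ^ 2)) + ladder a k * (C2 * Real.exp (-c * x ^ 2)) := by
            ring
        _ ≤ 2 * C1 * ((1 + 1 / (c' - c)) * Real.exp (-c * x ^ 2)) +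
              ladder a k * (C2 * Real.exp (-c * x ^ 2)) := by
            gcongr
        _ = _ := by field_simp

/-! ### The weighted measure as a product measure. -/

instance (a : ℝ) : SigmaFinite (wPlusOne a) := by unfold wPlusOne; infer_instance

instance {d : ℕ} (α : Fin d → ℝ) : SigmaFinite (wPlus α) := by unfold wPlus; infer_instance

lemma measurableSet_orthant (d : ℕ) : MeasurableSet (orthant d) := by
  have : orthant d = ⋂ i, {x | 0 < x i} := by ext x; simp [orthant]
  rw [this]
  exact MeasurableSet.iInter fun i => measurableSet_lt measurable_const (by fun_prop)

lemma ae_mem_orthant {d : ℕ} (α : Fin d → ℝ) : ∀ᵐ x ∂(wPlus α), x ∈ orthant d :=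
  (withDensity_absolutelyContinuous _ _).ae_le (ae_restrict_mem (measurableSet_orthant d))

lemma lintegral_pi_prod {d : ℕ} (μ : Fin d → Measure ℝ) [∀ i, SigmaFinite (μ i)]
    (f : Fin d → ℝ → ℝ≥0∞) (hf : ∀ i, Measurable (f i)) :
    ∫⁻ x, ∏ i, f i (x i) ∂(Measure.pi μ) = ∏ i, ∫⁻ x, f i x ∂(μ i) := by
  induction d with
  | zero => simp
  | succ n ih =>
    have hm := (measurePreserving_piFinSuccAbove μ 0).symm
    rw [← hm.lintegral_comp (by fun_prop)]
    simp only [Fin.prod_univ_succ, MeasurableEquiv.piFinSuccAbove_symm_apply, Fin.insertNthEquiv,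
      Fin.zero_succAbove, Equiv.coe_fn_mk, Fin.insertNth_zero', Fin.cons_zero, Fin.cons_succ]
    have hg : Measurable fun y : Fin n → ℝ => ∏ i, f i.succ (y i) :=
      Finset.measurable_prod _ fun i _ => (hf i.succ).comp (measurable_pi_apply i)
    rw [← ih (fun i => μ i.succ) _ (fun i => hf i.succ)]
    exact lintegral_prod_mul (hf 0).aemeasurable hg.aemeasurable

/-- The measure `dw_α^+` is the product of its one-dimensional factors. -/
lemma measurePreserving_wPlus {d : ℕ} (α : Fin d → ℝ) :
    MeasurePreserving (WithLp.ofLp : EuclideanSpace ℝ (Fin d) → (Fin d → ℝ)) (wPlus α)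
      (Measure.pi fun i => wPlusOne (α i)) := by
  refine ⟨by fun_prop, (Measure.pi_eq fun s hs => ?_).symm⟩
  have hmeas : Measurable (WithLp.ofLp : EuclideanSpace ℝ (Fin d) → (Fin d → ℝ)) := by fun_prop
  have hpi : MeasurableSet (Set.univ.pi s) := MeasurableSet.univ_pi hs
  rw [Measure.map_apply hmeas hpi, wPlus, withDensity_apply _ (hmeas hpi),
    Measure.restrict_restrict (hmeas hpi), ← lintegral_indicator
      ((hmeas hpi).inter (measurableSet_orthant d))]
  have h1 : ∀ x : EuclideanSpace ℝ (Fin d),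
      (WithLp.ofLp ⁻¹' Set.univ.pi s ∩ orthant d).indicator
        (fun x => ENNReal.ofReal (∏ j, x j ^ (2 * α j + 1))) x =
      (fun y : Fin d → ℝ => ∏ i, (s i ∩ Set.Ioi 0).indicator
        (fun y => ENNReal.ofReal (y ^ (2 * α i + 1))) (y i)) (WithLp.ofLp x) := by
    intro x
    by_cases hx : ∀ i, x i ∈ s i ∩ Set.Ioi 0
    · rw [Set.indicator_of_mem, ENNReal.ofReal_prod_of_nonneg]
      · exact Finset.prod_congr rfl fun i _ =>
          (Set.indicator_of_mem (hx i) fun y : ℝ => ENNReal.ofReal (y ^ (2 * α i + 1))).symm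
      · exact fun i _ => Real.rpow_nonneg (le_of_lt (hx i).2) _
      · exact ⟨fun i _ => (hx i).1, fun i => (hx i).2⟩
    · rw [Set.indicator_of_notMem]
      · push Not at hx
        obtain ⟨i, hi⟩ := hx
        exact (Finset.prod_eq_zero (Finset.mem_univ i) (Set.indicator_of_notMem hi _)).symm
      · exact fun h => hx fun i => ⟨h.1 i trivial, h.2 i⟩
  have hm : ∀ i, Measurable ((s i ∩ Set.Ioi 0).indicator
      (fun y : ℝ => ENNReal.ofReal (y ^ (2 * α i + 1)))) := fun i =>
    Measurable.indicator (by fun_prop) ((hs i).inter measurableSet_Ioi)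
  have hm' : Measurable fun y : Fin d → ℝ => ∏ i, (s i ∩ Set.Ioi 0).indicator
        (fun y => ENNReal.ofReal (y ^ (2 * α i + 1))) (y i) :=
    Finset.measurable_prod _ fun i _ => (hm i).comp (measurable_pi_apply i)
  rw [lintegral_congr h1, (PiLp.volume_preserving_ofLp (Fin d)).lintegral_comp hm', volume_pi,
    lintegral_pi_prod _ _ hm]
  refine Finset.prod_congr rfl fun i _ => ?_
  rw [wPlusOne, withDensity_apply _ (hs i), Measure.restrict_restrict (hs i),
    lintegral_indicator ((hs i).inter measurableSet_Ioi)]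

lemma integral_wPlus_prod {d : ℕ} (α : Fin d → ℝ) (f : Fin d → ℝ → ℝ) :
    ∫ x, ∏ i, f i (x i) ∂(wPlus α) = ∏ i, ∫ x, f i x ∂(wPlusOne (α i)) := by
  rw [← integral_fintype_prod_eq_prod]
  exact (measurePreserving_wPlus α).integral_comp
    (MeasurableEquiv.toLp 2 (Fin d → ℝ)).symm.measurableEmbedding
    (fun y : Fin d → ℝ => ∏ i, f i (y i))

lemma integrable_wPlus_prod {d : ℕ} (α : Fin d → ℝ) {f : Fin d → ℝ → ℝ}
    (hf : ∀ i, Integrable (f i) (wPlusOne (α i))) :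
    Integrable (fun x : EuclideanSpace ℝ (Fin d) => ∏ i, f i (x i)) (wPlus α) :=
  (measurePreserving_wPlus α).integrable_comp_of_integrable
    (g := fun y : Fin d → ℝ => ∏ i, f i (y i)) (Integrable.fintype_prod hf)

lemma integral_wPlusOne (a : ℝ) (g : ℝ → ℝ) :
    ∫ x, g x ∂(wPlusOne a) = ∫ x in Set.Ioi 0, x ^ (2 * a + 1) * g x := by
  rw [wPlusOne, integral_withDensity_eq_integral_toReal_smul (by fun_prop)
    (Filter.Eventually.of_forall fun x => ENNReal.ofReal_lt_top)]
  refine setIntegral_congr_fun measurableSet_Ioi fun x hx => ?_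
  simp [ENNReal.toReal_ofReal (Real.rpow_nonneg (le_of_lt hx) _)]

lemma integrable_wPlusOne_iff (a : ℝ) (g : ℝ → ℝ) :
    Integrable g (wPlusOne a) ↔
      IntegrableOn (fun x => x ^ (2 * a + 1) * g x) (Set.Ioi 0) := by
  rw [wPlusOne, integrable_withDensity_iff (by fun_prop)
    (Filter.Eventually.of_forall fun x => ENNReal.ofReal_lt_top)]
  refine integrable_congr ?_
  filter_upwards [ae_restrict_mem measurableSet_Ioi] with x hx
  rw [ENNReal.toReal_ofReal (Real.rpow_nonneg (le_of_lt hx) _), mul_comm]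

lemma integrable_wPlusOne_of_le {a : ℝ} (ha : -1 / 2 ≤ a) {g : ℝ → ℝ} (hg : Continuous g)
    {C c : ℝ} (hc : 0 < c) (h : ∀ x, |g x| ≤ C * Real.exp (-c * x ^ 2)) :
    Integrable g (wPlusOne a) := by
  rw [integrable_wPlusOne_iff]
  have h1 : IntegrableOn (fun x : ℝ => C * (x ^ (2 * a + 1) * Real.exp (-c * x ^ 2)))
      (Set.Ioi 0) :=
    (integrableOn_rpow_mul_exp_neg_mul_sq hc (by linarith)).const_mul C
  refine Integrable.mono' h1 ?_ ?_
  · exact (Measurable.mul (by fun_prop) hg.measurable).aestronglyMeasurable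
  · filter_upwards [ae_restrict_mem measurableSet_Ioi] with x hx
    have h0 := Real.rpow_nonneg (le_of_lt (Set.mem_Ioi.mp hx)) (2 * a + 1)
    rw [norm_mul, Real.norm_of_nonneg h0, Real.norm_eq_abs]
    calc x ^ (2 * a + 1) * |g x| ≤ x ^ (2 * a + 1) * (C * Real.exp (-c * x ^ 2)) := by
          gcongr; exact h x
      _ = _ := by ring

/-! ### Orthogonality on the half-line. -/

lemma exists_hermiteOne_mul_le_exp {a : ℝ} (ha : -1 / 2 ≤ a) (m n : ℕ) {c : ℝ} (hc : c < 1) :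
    ∃ C, ∀ x, |hermiteOne a m x * hermiteOne a n x| ≤ C * Real.exp (-c * x ^ 2) := by
  obtain ⟨C1, hC1, h1⟩ := exists_hermiteOne_le_exp ha m (c := c / 2) (by linarith)
  obtain ⟨C2, hC2, h2⟩ := exists_hermiteOne_le_exp ha n (c := c / 2) (by linarith)
  refine ⟨C1 * C2, fun x => ?_⟩
  rw [abs_mul]
  calc |hermiteOne a m x| * |hermiteOne a n x|
      ≤ (C1 * Real.exp (-(c / 2) * x ^ 2)) * (C2 * Real.exp (-(c / 2) * x ^ 2)) := by
        gcongr
        · exact h1 x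
        · exact h2 x
    _ = C1 * C2 * (Real.exp (-(c / 2) * x ^ 2) * Real.exp (-(c / 2) * x ^ 2)) := by ring
    _ = _ := by rw [← Real.exp_add]; ring_nf

lemma integrable_hermiteOne_mul {a : ℝ} (ha : -1 / 2 ≤ a) (m n : ℕ) :
    Integrable (fun x => hermiteOne a m x * hermiteOne a n x) (wPlusOne a) := by
  obtain ⟨C, hC⟩ := exists_hermiteOne_mul_le_exp ha m n (c := 1 / 2) (by norm_num)
  exact integrable_wPlusOne_of_le ha
    ((continuous_hermiteOne a m).mul (continuous_hermiteOne a n)) (by norm_num) hC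

/-- `δ` and `δ^*` are adjoint on the half-line, between functions of opposite parity. -/
lemma ladder_mul_integral_hermiteOne {a : ℝ} (ha : -1 / 2 ≤ a) {m n : ℕ}
    (hmn : (m + 1) % 2 = n % 2) :
    ladder a (m + 1) * ∫ x, hermiteOne a (m + 1) x * hermiteOne a n x ∂(wPlusOne a) =
      ladder a n * ∫ x, hermiteOne a m x * hermiteOne a (n - 1) x ∂(wPlusOne a) := by
  have ha1 : -1 < a := by linarith
  -- The identity is the vanishing of ∫ F' over (0,∞) for F = x^{2a+1} h_m h_n.
  set F : ℝ → ℝ := fun x => x ^ (2 * a + 1) * (hermiteOne a m x * hermiteOne a n x) with hF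
  set F' : ℝ → ℝ := fun x =>
    ladder a n * (x ^ (2 * a + 1) * (hermiteOne a m x * hermiteOne a (n - 1) x)) -
    ladder a (m + 1) * (x ^ (2 * a + 1) * (hermiteOne a (m + 1) x * hermiteOne a n x)) with hF'
  have i1 := (integrable_wPlusOne_iff a _).mp (integrable_hermiteOne_mul ha (m + 1) n)
  have i2 := (integrable_wPlusOne_iff a _).mp (integrable_hermiteOne_mul ha m (n - 1))
  have i3 := (integrable_wPlusOne_iff a _).mp (integrable_hermiteOne_mul ha m n)
  have iF' : IntegrableOn F' (Set.Ioi 0) := (i2.const_mul _).sub (i1.const_mul _)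
  have hder : ∀ x ∈ Set.Ioi (0 : ℝ), HasDerivAt F (F' x) x := by
    intro x hx
    have hx0 : x ≠ 0 := (ne_of_gt hx)
    have d1 := Real.hasDerivAt_rpow_const (x := x) (p := 2 * a + 1) (Or.inl hx0)
    have d2 := hasDerivAt_hermiteOne ha1 m hx0
    have d3 := hasDerivAt_hermiteOne ha1 n hx0
    refine (d1.mul (d2.mul d3)).congr_deriv ?_
    have hp : x ^ (2 * a + 1) = x ^ (2 * a + 1 - 1) * x := by
      rw [← Real.rpow_add_one hx0]; ring_nf
    have hrec := two_mul_mul_hermiteOne ha1 m x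
    -- Opposite parities make the two reflection quotients add up to 2 h_m h_n / x, which is exactly
    -- what the derivative of the weight x^{2a+1} compensates.
    have hpar : ((hermiteOne a m x - hermiteOne a m (-x)) / x) * hermiteOne a n x +
        hermiteOne a m x * ((hermiteOne a n x - hermiteOne a n (-x)) / x) =
        2 * (hermiteOne a m x * hermiteOne a n x) / x := by
      rw [hermiteOne_neg, hermiteOne_neg]
      rcases Nat.even_or_odd m with hm | hm
      · have hn : Odd n := by
          rw [Nat.odd_iff]; rw [Nat.even_iff] at hm; omega
        rw [hm.neg_one_pow, hn.neg_one_pow]; ring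
      · have hn : Even n := by
          rw [Nat.even_iff]; rw [Nat.odd_iff] at hm; omega
        rw [hm.neg_one_pow, hn.neg_one_pow]; ring
    have hx1 : x ^ (2 * a + 1) * ((a + 1 / 2) * (2 * (hermiteOne a m x * hermiteOne a n x) / x)) =
        (2 * a + 1) * x ^ (2 * a + 1 - 1) * (hermiteOne a m x * hermiteOne a n x) := by
      rw [hp]; field_simp
    simp only [hF', Pi.mul_apply]
    linear_combination (-1 : ℝ) * hx1 - (x ^ (2 * a + 1) * (a + 1 / 2)) * hpar
      - (x ^ (2 * a + 1) * hermiteOne a n x) * hrec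
  have hlim := tendsto_zero_of_hasDerivAt_of_integrableOn_Ioi hder iF' i3
  have hcont : ContinuousWithinAt F (Set.Ici 0) 0 := by
    refine Continuous.continuousWithinAt ?_
    exact (Real.continuous_rpow_const (by linarith)).mul
      ((continuous_hermiteOne a m).mul (continuous_hermiteOne a n))
  -- For a = -1/2 the weight does not vanish at 0; the boundary term is 0 because one of h_m, h_n is
  -- odd.
  have hF0 : F 0 = 0 := by
    have hm := hermiteOne_neg a m 0
    have hn := hermiteOne_neg a n 0
    rw [neg_zero] at hm hn
    simp only [hF]
    rcases Nat.even_or_odd m with h | h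
    · have h' : Odd n := by
        rw [Nat.odd_iff]; rw [Nat.even_iff] at h; omega
      rw [h'.neg_one_pow] at hn
      rw [show hermiteOne a n 0 = 0 by linarith]; ring
    · rw [h.neg_one_pow] at hm
      rw [show hermiteOne a m 0 = 0 by linarith]; ring
  have hint := integral_Ioi_of_hasDerivAt_of_tendsto hcont hder iF' hlim
  rw [hF0, sub_zero, hF', integral_sub (i2.const_mul _) (i1.const_mul _), integral_const_mul,
    integral_const_mul] at hint
  rw [integral_wPlusOne, integral_wPlusOne]
  linarith

/-- A Γ-integral. The value is 1/2 rather than 1 because only half of the line is covered; its d-th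
power is the origin of the factors 2^{-d}. -/
lemma integral_hermiteOne_zero {a : ℝ} (ha : -1 / 2 ≤ a) :
    ∫ x, hermiteOne a 0 x * hermiteOne a 0 x ∂(wPlusOne a) = 1 / 2 := by
  have hG : 0 < Real.Gamma (a + 1) := Real.Gamma_pos_of_pos (by linarith)
  have h0 : ∀ x, hermiteOne a 0 x * hermiteOne a 0 x =
      (Real.Gamma (a + 1))⁻¹ * Real.exp (-1 * x ^ 2) := by
    intro x
    have hL : laguerre 0 a (x ^ 2) = 1 := by
      have := gammaShift_ne_zero (show -1 < a by linarith) 0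
      simp only [laguerre, zero_add, Finset.range_one, Finset.sum_singleton, pow_zero, one_mul,
          Nat.factorial_zero, Nat.sub_zero, Nat.cast_one, mul_one] at this ⊢
      exact div_self this
    have hs := Real.mul_self_sqrt (show 0 ≤ 1 / Real.Gamma (a + 1) by positivity)
    have he : Real.exp (-1 * x ^ 2) = Real.exp (-x ^ 2 / 2) * Real.exp (-x ^ 2 / 2) := by
      rw [← Real.exp_add]; ring_nf
    have hc : hermiteConst a 0 = Real.sqrt (1 / Real.Gamma (a + 1)) := by
      simp [hermiteConst]
    have hh : hermiteOne a 0 x = hermiteConst a 0 * Real.exp (-x ^ 2 / 2) * laguerre 0 a (x ^ 2) :=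
      hermiteOne_even a 0 x
    rw [he, hh, hL, hc]
    linear_combination (Real.exp (-x ^ 2 / 2) * Real.exp (-x ^ 2 / 2)) * hs
  simp only [h0]
  rw [integral_const_mul, integral_wPlusOne]
  have h2 := integral_rpow_mul_exp_neg_mul_rpow (p := 2) (q := 2 * a + 1) (b := 1) two_pos
    (by linarith) one_pos
  simp only [Real.rpow_two] at h2
  rw [h2, Real.one_rpow, show (2 * a + 1 + 1) / 2 = a + 1 by ring]
  field_simp

/-- Orthogonality of the one-dimensional generalized Hermite functions on the half-line. -/
lemma integral_hermiteOne_mul {a : ℝ} (ha : -1 / 2 ≤ a) (m n : ℕ) (hmn : m % 2 = n % 2) :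
    ∫ x, hermiteOne a m x * hermiteOne a n x ∂(wPlusOne a) = if m = n then 1 / 2 else 0 := by
  -- Adjointness lowers both indices by one. When exactly one of them has reached 0, the coefficient
  -- `ladder a 0` kills the right side.
  induction m generalizing n with
  | zero =>
    rcases n with _ | n
    · simpa using integral_hermiteOne_zero ha
    · have h := ladder_mul_integral_hermiteOne ha (m := n) (n := 0) hmn.symm
      rw [ladder_zero, zero_mul] at h
      rw [if_neg (by omega)]
      simpa [(ladder_succ_pos ha n).ne', mul_comm (hermiteOne a 0 _)] using h
  | succ m ih =>
    have h := ladder_mul_integral_hermiteOne ha hmn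
    have hp := ladder_succ_pos ha m
    rcases n with _ | n
    · rw [ladder_zero, zero_mul] at h
      rw [if_neg (by omega)]
      simpa [hp.ne'] using h
    · rw [Nat.add_sub_cancel, ih n (by omega)] at h
      refine mul_left_cancel₀ hp.ne' (h.trans ?_)
      by_cases hmn' : m = n
      · simp [hmn']
      · simp [hmn']

/-! ### Completeness of a parity class. -/

section UniquenessPrinciple

open scoped BoundedContinuousFunction

/-- An integrable function which is orthogonal to a point separating monoid of bounded continuous
functions vanishes almost everywhere. -/
lemma ae_eq_zero_of_forall_mem_closure_integral_eq_zero {X : Type*} [TopologicalSpace X]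
    [PolishSpace X] [MeasurableSpace X] [BorelSpace X] {μ : Measure X} {φ : X → ℝ}
    (hφ : Integrable φ μ) (S : Set (X →ᵇ ℝ)) (hS : ∀ x y, x ≠ y → ∃ g ∈ S, g x ≠ g y)
    (h : ∀ g ∈ Submonoid.closure S, ∫ x, g x * φ x ∂μ = 0) : φ =ᵐ[μ] 0 := by
  let A : StarSubalgebra ℝ (X →ᵇ ℝ) :=
    { Algebra.adjoin ℝ S with
      star_mem' := fun {a} ha => by
        have : star a = a := by ext x; simp
        rw [this]; exact ha }
  have hgφ : ∀ g : X →ᵇ ℝ, Integrable (fun x => g x * φ x) μ := fun g =>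
    hφ.bdd_mul g.continuous.aestronglyMeasurable
      (Filter.Eventually.of_forall fun x => g.norm_coe_le_norm x)
  have hA : ∀ g ∈ A, ∫ x, g x * φ x ∂μ = 0 := by
    intro g hg
    have hg' : g ∈ Submodule.span ℝ (Submonoid.closure S : Set (X →ᵇ ℝ)) := by
      rw [← Algebra.adjoin_eq_span]; exact hg
    clear hg
    induction hg' using Submodule.span_induction with
    | mem g hg => exact h g hg
    | zero => simp
    | add g₁ g₂ _ _ h1 h2 =>
      have e : ∀ x, (g₁ + g₂) x * φ x = g₁ x * φ x + g₂ x * φ x := fun x => by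
        rw [BoundedContinuousFunction.add_apply]; ring
      simp only [e]
      rw [integral_add (hgφ g₁) (hgφ g₂), h1, h2, add_zero]
    | smul c g _ h1 =>
      have e : ∀ x, (c • g) x * φ x = c * (g x * φ x) := fun x => by
        rw [BoundedContinuousFunction.smul_apply, smul_eq_mul]; ring
      simp only [e]
      rw [integral_const_mul, h1, mul_zero]
  have fin : ∀ ψ : X → ℝ, Integrable ψ μ →
      IsFiniteMeasure (μ.withDensity fun x => ENNReal.ofReal (ψ x)) := fun ψ hψ =>
    isFiniteMeasure_withDensity_ofReal hψ.2
  have f1 := fin φ hφ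
  have f2 := fin (fun x => -φ x) hφ.neg
  have hint : ∀ (ψ : X → ℝ), Integrable ψ μ → ∀ g : X →ᵇ ℝ,
      ∫ x, g x ∂(μ.withDensity fun x => ENNReal.ofReal (ψ x)) = ∫ x, g x * max (ψ x) 0 ∂μ := by
    intro ψ hψ g
    rw [integral_withDensity_eq_integral_toReal_smul₀ hψ.1.aemeasurable.ennreal_ofReal
      (Filter.Eventually.of_forall fun x => ENNReal.ofReal_lt_top)]
    refine integral_congr_ae (Filter.Eventually.of_forall fun x => ?_)
    simp only [ENNReal.toReal_ofReal', smul_eq_mul]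
    ring
  -- The measures φ⁺μ and φ⁻μ are finite and have equal integrals against a point-separating
  -- algebra, so they coincide. Then φ⁺ = φ⁻ almost everywhere, which forces φ = 0.
  have hEq : μ.withDensity (fun x => ENNReal.ofReal (φ x)) =
      μ.withDensity fun x => ENNReal.ofReal (-φ x) := by
    refine ext_of_forall_mem_subalgebra_integral_eq_of_polish (𝕜 := ℝ) (A := A) ?_ fun g hg => ?_
    · intro x y hxy
      obtain ⟨g, hg, hgxy⟩ := hS x y hxy
      refine ⟨g, ⟨g.toContinuousMap, ⟨g, Algebra.subset_adjoin hg, rfl⟩, rfl⟩, hgxy⟩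
    · rw [hint φ hφ, hint (fun x => -φ x) hφ.neg, ← sub_eq_zero, ← integral_sub]
      · refine Eq.trans (integral_congr_ae (Filter.Eventually.of_forall fun x => ?_)) (hA g hg)
        simp only
        rw [← mul_sub]
        congr 1
        rcases le_total (φ x) 0 with h0 | h0
        · rw [max_eq_right h0, max_eq_left (by linarith)]; ring
        · rw [max_eq_left h0, max_eq_right (by linarith)]; ring
      · exact hφ.pos_part.bdd_mul g.continuous.aestronglyMeasurable
          (Filter.Eventually.of_forall fun x => g.norm_coe_le_norm x)
      · exact hφ.neg.pos_part.bdd_mul g.continuous.aestronglyMeasurable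
          (Filter.Eventually.of_forall fun x => g.norm_coe_le_norm x)
  have hae := (withDensity_eq_iff hφ.1.aemeasurable.ennreal_ofReal
    hφ.neg.1.aemeasurable.ennreal_ofReal
    (by simpa using (measure_lt_top (μ.withDensity fun x => ENNReal.ofReal (φ x)) Set.univ).ne)).mp hEq
  filter_upwards [hae] with x hx
  simp only [Pi.neg_apply] at hx
  rcases le_total (φ x) 0 with h0 | h0
  · rw [ENNReal.ofReal_of_nonpos h0, eq_comm, ENNReal.ofReal_eq_zero] at hx
    exact le_antisymm h0 (neg_nonpos.mp hx)
  · have : ENNReal.ofReal (-φ x) = 0 := ENNReal.ofReal_of_nonpos (by linarith)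
    rw [this, ENNReal.ofReal_eq_zero] at hx
    exact le_antisymm hx h0

end UniquenessPrinciple

/-- The multi-indices with the parities prescribed by `ε`. -/
def parityClass (ε : Fin d → ZMod 2) : Set (Fin d → ℕ) := {m | ∀ i, (m i : ZMod 2) = ε i}

lemma mod_two_eq_of_mem_parityClass {ε : Fin d → ZMod 2} {m n : Fin d → ℕ}
    (hm : m ∈ parityClass ε) (hn : n ∈ parityClass ε) (i : Fin d) : m i % 2 = n i % 2 :=
  (ZMod.natCast_eq_natCast_iff' _ _ _).mp ((hm i).trans (hn i).symm)

lemma continuous_hermite (α : Fin d → ℝ) (m : Fin d → ℕ) : Continuous (hermite α m) :=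
  continuous_finsetProd _ fun i _ => (continuous_hermiteOne (α i) (m i)).comp (by fun_prop)

lemma hermite_update (α : Fin d → ℝ) (m : Fin d → ℕ) (i : Fin d) (k : ℕ)
    (x : EuclideanSpace ℝ (Fin d)) : hermite α (Function.update m i k) x =
      hermiteOne (α i) k (x i) * ∏ j ∈ Finset.univ.erase i, hermiteOne (α j) (m j) (x j) := by
  rw [hermite, ← Finset.mul_prod_erase _ _ (Finset.mem_univ i), Function.update_self]
  congr 1
  refine Finset.prod_congr rfl fun j hj => ?_
  rw [Function.update_of_ne (Finset.ne_of_mem_erase hj)]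

lemma hermite_eq_mul_prod_erase (α : Fin d → ℝ) (m : Fin d → ℕ) (i : Fin d)
    (x : EuclideanSpace ℝ (Fin d)) : hermite α m x =
      hermiteOne (α i) (m i) (x i) * ∏ j ∈ Finset.univ.erase i, hermiteOne (α j) (m j) (x j) := by
  rw [← hermite_update, Function.update_eq_self]

lemma two_mul_mul_hermite {α : Fin d → ℝ} (hα : ∀ i, -1 / 2 ≤ α i) (m : Fin d → ℕ) (i : Fin d)
    (x : EuclideanSpace ℝ (Fin d)) : 2 * x i * hermite α m x =
      ladder (α i) (m i) * hermite α (Function.update m i (m i - 1)) x +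
      ladder (α i) (m i + 1) * hermite α (Function.update m i (m i + 1)) x := by
  rw [hermite_update, hermite_update, hermite_eq_mul_prod_erase α m i, ← mul_assoc,
    two_mul_mul_hermiteOne (by linarith [hα i])]
  ring

lemma integral_hermite_mul {α : Fin d → ℝ} (hα : ∀ i, -1 / 2 ≤ α i) {m n : Fin d → ℕ}
    (hmn : ∀ i, m i % 2 = n i % 2) :
    ∫ x, hermite α m x * hermite α n x ∂(wPlus α) = if m = n then (1 / 2) ^ d else 0 := by
  simp only [hermite, ← Finset.prod_mul_distrib]
  rw [integral_wPlus_prod α (fun i y => hermiteOne (α i) (m i) y * hermiteOne (α i) (n i) y)]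
  simp only [fun i => integral_hermiteOne_mul (hα i) _ _ (hmn i)]
  split_ifs with h
  · simp [h]
  · obtain ⟨i, hi⟩ := Function.ne_iff.mp h
    exact Finset.prod_eq_zero (Finset.mem_univ i) (if_neg hi)

lemma memLp_wPlus_prod {α : Fin d → ℝ} (hα : ∀ i, -1 / 2 ≤ α i) {g : Fin d → ℝ → ℝ}
    (hg : ∀ i, Continuous (g i))
    (hb : ∀ i, ∃ C c, 0 < c ∧ ∀ x, |g i x| ≤ C * Real.exp (-c * x ^ 2)) :
    MemLp (fun x : EuclideanSpace ℝ (Fin d) => ∏ i, g i (x i)) 2 (wPlus α) := by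
  have hc : Continuous fun x : EuclideanSpace ℝ (Fin d) => ∏ i, g i (x i) :=
    continuous_finsetProd _ fun i _ => (hg i).comp (by fun_prop)
  rw [memLp_two_iff_integrable_sq hc.aestronglyMeasurable]
  simp only [← Finset.prod_pow]
  refine integrable_wPlus_prod α (f := fun i y => g i y ^ 2) fun i => ?_
  obtain ⟨C, c, hc, h⟩ := hb i
  refine integrable_wPlusOne_of_le (hα i) ((hg i).pow 2) (C := C ^ 2) (c := 2 * c) (by linarith)
    fun x => ?_
  rw [abs_pow]
  calc |g i x| ^ 2 ≤ (C * Real.exp (-c * x ^ 2)) ^ 2 := by gcongr; exact h x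
    _ = C ^ 2 * Real.exp (-(2 * c) * x ^ 2) := by
      rw [mul_pow, ← Real.exp_nat_mul]; push_cast; ring_nf

lemma memLp_hermite {α : Fin d → ℝ} (hα : ∀ i, -1 / 2 ≤ α i) (m : Fin d → ℕ) :
    MemLp (hermite α m) 2 (wPlus α) := by
  refine memLp_wPlus_prod hα (fun i => continuous_hermiteOne (α i) (m i)) fun i => ?_
  obtain ⟨C, _, hC⟩ := exists_hermiteOne_le_exp (hα i) (m i) (c := 1 / 4) (by norm_num)
  exact ⟨C, 1 / 4, by norm_num, hC⟩

/-- This provides the dominating function for expanding e^{-x_i²/4} in its power series. It holds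
because h_m decays like e^{-cx²} for every c < 1/2; the choice c = 3/8 leaves a rate 1/8. -/
lemma memLp_exp_mul_hermite {α : Fin d → ℝ} (hα : ∀ i, -1 / 2 ≤ α i) (m : Fin d → ℕ) (i : Fin d) :
    MemLp (fun x => Real.exp (x i ^ 2 / 4) * hermite α m x) 2 (wPlus α) := by
  have e : (fun x : EuclideanSpace ℝ (Fin d) => Real.exp (x i ^ 2 / 4) * hermite α m x) =
      fun x => ∏ j, (if j = i then Real.exp (x j ^ 2 / 4) else 1) * hermiteOne (α j) (m j) (x j) := by
    funext x
    rw [Finset.prod_mul_distrib, Finset.prod_ite_eq' Finset.univ i, if_pos (Finset.mem_univ i),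
      hermite]
  rw [e]
  refine memLp_wPlus_prod hα
    (g := fun j y => (if j = i then Real.exp (y ^ 2 / 4) else 1) * hermiteOne (α j) (m j) y)
    (fun j => Continuous.mul ?_ (continuous_hermiteOne _ _)) fun j => ?_
  · split_ifs
    · fun_prop
    · fun_prop
  · obtain ⟨C, hC0, hC⟩ := exists_hermiteOne_le_exp (hα j) (m j) (c := 3 / 8) (by norm_num)
    refine ⟨C, 1 / 8, by norm_num, fun x => ?_⟩
    have h1 : |if j = i then Real.exp (x ^ 2 / 4) else 1| ≤ Real.exp (x ^ 2 / 4) := by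
      split_ifs
      · exact (abs_of_pos (Real.exp_pos _)).le
      · rw [abs_one]; exact Real.one_le_exp (by positivity)
    rw [abs_mul]
    calc _ ≤ Real.exp (x ^ 2 / 4) * (C * Real.exp (-(3 / 8) * x ^ 2)) := by
          gcongr; exact hC x
      _ = C * (Real.exp (x ^ 2 / 4) * Real.exp (-(3 / 8) * x ^ 2)) := by ring
      _ = _ := by rw [← Real.exp_add]; ring_nf

lemma integrable_mul_hermite {α : Fin d → ℝ} (hα : ∀ i, -1 / 2 ≤ α i)
    {f : EuclideanSpace ℝ (Fin d) → ℝ} (hf : MemLp f 2 (wPlus α)) (m : Fin d → ℕ) :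
    Integrable (fun x => f x * hermite α m x) (wPlus α) :=
  hf.integrable_mul (memLp_hermite hα m)

/-- By the recurrence, x_i^k h_m is a combination of functions h_{m+l e_i} with l ≡ k mod 2. Each
step of the induction leaves the parity class, so the claim is made for all m with the parity
condition placed on m + k e_i. -/
lemma integral_pow_mul_hermite_eq_zero {α : Fin d → ℝ} (hα : ∀ i, -1 / 2 ≤ α i)
    {ε : Fin d → ZMod 2} {f : EuclideanSpace ℝ (Fin d) → ℝ} (hf : MemLp f 2 (wPlus α))
    (h : ∀ m ∈ parityClass ε, ∫ x, f x * hermite α m x ∂(wPlus α) = 0) (i : Fin d) (k : ℕ) :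
    ∀ m : Fin d → ℕ, Integrable (fun x => x i ^ k * (f x * hermite α m x)) (wPlus α) ∧
      (Function.update m i (m i + k) ∈ parityClass ε →
        ∫ x, x i ^ k * (f x * hermite α m x) ∂(wPlus α) = 0) := by
  induction k with
  | zero =>
    intro m
    simp only [pow_zero, one_mul, add_zero, Function.update_eq_self]
    exact ⟨integrable_mul_hermite hα hf m, h m⟩
  | succ k ih =>
    intro m
    obtain ⟨i1, z1⟩ := ih (Function.update m i (m i - 1))
    obtain ⟨i2, z2⟩ := ih (Function.update m i (m i + 1))
    have e : ∀ x : EuclideanSpace ℝ (Fin d), x i ^ (k + 1) * (f x * hermite α m x) =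
        ladder (α i) (m i) / 2 *
          (x i ^ k * (f x * hermite α (Function.update m i (m i - 1)) x)) +
        ladder (α i) (m i + 1) / 2 *
          (x i ^ k * (f x * hermite α (Function.update m i (m i + 1)) x)) := by
      intro x
      have := two_mul_mul_hermite hα m i x
      rw [pow_succ]
      linear_combination (x i ^ k * f x / 2) * this
    simp only [e]
    refine ⟨(i1.const_mul _).add (i2.const_mul _), fun hm => ?_⟩
    rw [integral_add (i1.const_mul _) (i2.const_mul _), integral_const_mul, integral_const_mul,
      z2 (by
        rw [Function.update_self, Function.update_idem, add_assoc, add_comm 1 k]; exact hm),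
      mul_zero, add_zero]
    -- If m_i = 0, the truncated index m_i - 1 has the wrong parity, but its coefficient vanishes.
    rcases Nat.eq_zero_or_pos (m i) with h0 | h0
    · rw [h0, ladder_zero]; ring
    · rw [z1, mul_zero]
      intro j
      have := hm j
      by_cases hj : j = i
      · subst hj
        simp only [Function.update_self] at this ⊢
        rw [← this, ZMod.natCast_eq_natCast_iff']
        omega
      · simpa [Function.update_of_ne hj] using this

/-- Even powers of x_i preserve the parity class, so the exponential series can be integrated term
by term. Thus the annihilator of the class is stable under multiplication by these Gaussians. -/
lemma integral_exp_mul_hermite_eq_zero {α : Fin d → ℝ} (hα : ∀ i, -1 / 2 ≤ α i)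
    {ε : Fin d → ZMod 2} {f : EuclideanSpace ℝ (Fin d) → ℝ} (hf : MemLp f 2 (wPlus α))
    (h : ∀ m ∈ parityClass ε, ∫ x, f x * hermite α m x ∂(wPlus α) = 0) (i : Fin d)
    {m : Fin d → ℕ} (hm : m ∈ parityClass ε) :
    ∫ x, (Real.exp (-(x i ^ 2 / 4)) * f x) * hermite α m x ∂(wPlus α) = 0 := by
  have hpow := fun k => integral_pow_mul_hermite_eq_zero hα hf h i k m
  have hz : ∀ k : ℕ, ∫ x, (-(x i ^ 2 / 4)) ^ k / k.factorial * (f x * hermite α m x) ∂(wPlus α)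
      = 0 := by
    intro k
    have e : ∀ x : EuclideanSpace ℝ (Fin d),
        (-(x i ^ 2 / 4)) ^ k / k.factorial * (f x * hermite α m x) =
        ((-1 / 4) ^ k / k.factorial) * (x i ^ (2 * k) * (f x * hermite α m x)) := by
      intro x
      rw [pow_mul, show -(x i ^ 2 / 4) = (-1 / 4) * x i ^ 2 by ring, mul_pow]
      ring
    simp only [e]
    rw [integral_const_mul, (hpow (2 * k)).2, mul_zero]
    intro j
    have := hm j
    by_cases hj : j = i
    · subst hj
      simp only [Function.update_self]
      rw [← this, ZMod.natCast_eq_natCast_iff']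
      omega
    · simpa [Function.update_of_ne hj] using this
  have hmeas : ∀ k : ℕ, AEStronglyMeasurable (fun x : EuclideanSpace ℝ (Fin d) =>
      (-(x i ^ 2 / 4)) ^ k / k.factorial * (f x * hermite α m x)) (wPlus α) := fun k =>
    AEStronglyMeasurable.mul (Continuous.aestronglyMeasurable (by fun_prop))
      (integrable_mul_hermite hα hf m).1
  have hsum := hasSum_integral_of_dominated_convergence
    (μ := wPlus α) (F := fun (k : ℕ) (x : EuclideanSpace ℝ (Fin d)) =>
      (-(x i ^ 2 / 4)) ^ k / k.factorial * (f x * hermite α m x))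
    (f := fun x => Real.exp (-(x i ^ 2 / 4)) * (f x * hermite α m x))
    (fun k x => (x i ^ 2 / 4) ^ k / k.factorial * |f x * hermite α m x|) hmeas
    (fun k => Filter.Eventually.of_forall fun x => ?_)
    (Filter.Eventually.of_forall fun x => ?_) ?_ (Filter.Eventually.of_forall fun x => ?_)
  · simp only [hz] at hsum
    simp only [mul_assoc]
    exact hsum.unique hasSum_zero
  · rw [norm_mul, norm_div, norm_pow, norm_neg, Real.norm_of_nonneg (by positivity : 0 ≤ x i ^ 2 / 4),
      Real.norm_natCast, Real.norm_eq_abs]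
  · exact (Real.summable_pow_div_factorial _).mul_right _
  · have e : ∀ x : EuclideanSpace ℝ (Fin d),
        ∑' k : ℕ, (x i ^ 2 / 4) ^ k / k.factorial * |f x * hermite α m x| =
        |f x * (Real.exp (x i ^ 2 / 4) * hermite α m x)| := by
      intro x
      have hexp : Real.exp (x i ^ 2 / 4) = ∑' k : ℕ, (x i ^ 2 / 4) ^ k / k.factorial := by
        rw [Real.exp_eq_exp_ℝ, NormedSpace.exp_eq_tsum_div]
      rw [tsum_mul_right, ← hexp, mul_left_comm (f x), abs_mul (Real.exp _),
        abs_of_pos (Real.exp_pos _)]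
    simp only [e]
    exact (hf.integrable_mul (memLp_exp_mul_hermite hα m i)).abs
  · refine HasSum.mul_right _ ?_
    rw [Real.exp_eq_exp_ℝ]
    exact NormedSpace.expSeries_div_hasSum_exp _

lemma hermiteOne_pos_of_lt_two {a : ℝ} (ha : -1 / 2 ≤ a) {k : ℕ} (hk : k < 2) {x : ℝ} (hx : 0 < x) :
    0 < hermiteOne a k x := by
  have hG : 0 < Real.Gamma (a + 1) := Real.Gamma_pos_of_pos (by linarith)
  have hG' : 0 < Real.Gamma (a + 1 + 1) := Real.Gamma_pos_of_pos (by linarith)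
  interval_cases k
  · simp only [hermiteOne, hermiteConst, laguerre, Nat.zero_div, Nat.zero_mod, zero_add,
      Finset.range_one, Finset.sum_singleton, pow_zero, Nat.cast_zero, add_zero, Nat.factorial_zero,
      Nat.sub_zero]
    positivity
  · simp only [hermiteOne, hermiteConst, laguerre, show 1 / 2 = 0 from rfl, show 1 % 2 = 1 from rfl,
      zero_add, Finset.range_one, Finset.sum_singleton, pow_zero, Nat.cast_zero, Nat.cast_one,
      Nat.factorial_zero, Nat.sub_zero]
    positivity

open scoped BoundedContinuousFunction in
/-- Completeness of the generalized Hermite functions of prescribed parities. -/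
lemma ae_eq_zero_of_integral_mul_hermite_eq_zero {α : Fin d → ℝ} (hα : ∀ i, -1 / 2 ≤ α i)
    {ε : Fin d → ZMod 2} {f : EuclideanSpace ℝ (Fin d) → ℝ} (hf : MemLp f 2 (wPlus α))
    (h : ∀ m ∈ parityClass ε, ∫ x, f x * hermite α m x ∂(wPlus α) = 0) :
    f =ᵐ[wPlus α] 0 := by
  -- The lowest index of the class. Its Hermite function is positive on the orthant and makes f
  -- h_{m₀} integrable, so it suffices to show that this product vanishes.
  set m₀ : Fin d → ℕ := fun i => (ε i).val with hm₀
  have hm₀ε : m₀ ∈ parityClass ε := fun i => by simp [hm₀]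
  have hopen : IsOpen (orthant d) := by
    have : orthant d = ⋂ i, {x | 0 < x i} := by ext x; simp [orthant]
    rw [this]
    exact isOpen_iInter_of_finite fun i => isOpen_lt continuous_const (by fun_prop)
  have : PolishSpace (orthant d) := hopen.polishSpace
  have hemb := MeasurableEmbedding.subtype_coe (measurableSet_orthant d)
  set μ : Measure (orthant d) := (wPlus α).comap Subtype.val with hμ
  have hres : (wPlus α).restrict (orthant d) = wPlus α :=
    Measure.restrict_eq_self_of_ae_mem (ae_mem_orthant α)
  have hmap : μ.map Subtype.val = wPlus α := by
    rw [hμ, hemb.map_comap, Subtype.range_coe, hres]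
  have hint : ∀ F : EuclideanSpace ℝ (Fin d) → ℝ, ∫ x, F x.1 ∂μ = ∫ x, F x ∂(wPlus α) := by
    intro F
    rw [← hmap, hemb.integral_map]
  -- These Gaussians are bounded and continuous. They separate points only where all coordinates are
  -- positive, which is why the argument lives on the subtype `orthant d`.
  let E : Fin d → (orthant d →ᵇ ℝ) := fun i =>
    BoundedContinuousFunction.ofNormedAddCommGroup (fun x => Real.exp (-(x.1 i ^ 2 / 4)))
      (by fun_prop) 1 fun x => by
        rw [Real.norm_of_nonneg (Real.exp_pos _).le, Real.exp_le_one_iff]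
        have : 0 ≤ x.1 i ^ 2 / 4 := by positivity
        linarith
  have hφint : Integrable (fun x : orthant d => f x.1 * hermite α m₀ x.1) μ := by
    have := integrable_mul_hermite hα hf m₀
    rw [← hmap, hemb.integrable_map_iff] at this
    exact this
  -- Orthogonality to the whole class, not just to h_{m₀}, is carried along, since only that
  -- property survives multiplication by a further Gaussian.
  have key : ∀ g ∈ Submonoid.closure (Set.range E), ∃ G : EuclideanSpace ℝ (Fin d) → ℝ,
      (∀ x : orthant d, g x = G x.1) ∧ MemLp (fun x => G x * f x) 2 (wPlus α) ∧
      ∀ m ∈ parityClass ε, ∫ x, (G x * f x) * hermite α m x ∂(wPlus α) = 0 := by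
    intro g hg
    induction hg using Submonoid.closure_induction_right with
    | one => exact ⟨fun _ => 1, fun x => rfl, by simpa using hf, by simpa using h⟩
    | mul_right g _ y hy ih =>
      obtain ⟨i, rfl⟩ := hy
      obtain ⟨G, hG, hGf, hG0⟩ := ih
      refine ⟨fun x => Real.exp (-(x i ^ 2 / 4)) * G x, fun x => ?_, ?_, ?_⟩
      · rw [BoundedContinuousFunction.mul_apply, hG, mul_comm]; rfl
      · simp only [mul_assoc]
        refine MemLp.of_le hGf (AEStronglyMeasurable.mul
          (Continuous.aestronglyMeasurable (by fun_prop)) hGf.1)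
          (Filter.Eventually.of_forall fun x => ?_)
        rw [norm_mul]
        refine mul_le_of_le_one_left (norm_nonneg _) ?_
        rw [Real.norm_of_nonneg (Real.exp_pos _).le, Real.exp_le_one_iff]
        have : 0 ≤ x i ^ 2 / 4 := by positivity
        linarith
      · intro m hm
        have := integral_exp_mul_hermite_eq_zero hα hGf hG0 i hm
        simpa only [mul_assoc] using this
  have hzero := ae_eq_zero_of_forall_mem_closure_integral_eq_zero hφint (Set.range E) ?_ ?_
  · have h2 : ∀ᵐ x ∂(μ.map Subtype.val), f x * hermite α m₀ x = 0 := by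
      rw [hemb.ae_map_iff]; exact hzero
    rw [hmap] at h2
    filter_upwards [h2, ae_mem_orthant α] with x hx hxo
    refine (mul_eq_zero.mp hx).resolve_right (ne_of_gt ?_)
    exact Finset.prod_pos fun i _ => hermiteOne_pos_of_lt_two (hα i) (ZMod.val_lt (ε i)) (hxo i)
  · intro x y hxy
    have : ∃ i, x.1 i ≠ y.1 i := by
      by_contra! hcon
      exact hxy (Subtype.ext (PiLp.ext hcon))
    obtain ⟨i, hi⟩ := this
    refine ⟨E i, ⟨i, rfl⟩, fun he => hi ?_⟩
    have he' : Real.exp (-(x.1 i ^ 2 / 4)) = Real.exp (-(y.1 i ^ 2 / 4)) := he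
    have := Real.exp_injective he'
    exact (sq_eq_sq₀ (x.2 i).le (y.2 i).le).mp (by linarith)
  · intro g hg
    obtain ⟨G, hG, _, hG0⟩ := key g hg
    have := hG0 m₀ hm₀ε
    rw [← hint] at this
    simpa only [hG, mul_assoc] using this

/-! ### Orthonormal basis and Parseval's identity. -/

lemma memLp_hermite_ofReal {α : Fin d → ℝ} (hα : ∀ i, -1 / 2 ≤ α i) (m : Fin d → ℕ) :
    MemLp (fun x => (hermite α m x : ℂ)) 2 (wPlus α) :=
  (memLp_hermite hα m).ofReal

/-- The generalized Hermite functions normalized in `L²(dw_α^+)`. -/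
noncomputable def hermiteLp {α : Fin d → ℝ} (hα : ∀ i, -1 / 2 ≤ α i) (m : Fin d → ℕ) :
    Lp ℂ 2 (wPlus α) := ((Real.sqrt (2 ^ d) : ℝ) : ℂ) • (memLp_hermite_ofReal hα m).toLp

lemma coeff_congr_ae (α : Fin d → ℝ) {f g : EuclideanSpace ℝ (Fin d) → ℂ} (h : f =ᵐ[wPlus α] g)
    (m : Fin d → ℕ) : coeff α f m = coeff α g m := by
  refine integral_congr_ae ?_
  filter_upwards [h] with x hx
  rw [hx]

lemma integrable_coeff {α : Fin d → ℝ} (hα : ∀ i, -1 / 2 ≤ α i) {f : EuclideanSpace ℝ (Fin d) → ℂ}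
    (hf : MemLp f 2 (wPlus α)) (m : Fin d → ℕ) :
    Integrable (fun x => f x * (hermite α m x : ℂ)) (wPlus α) :=
  hf.integrable_mul (memLp_hermite_ofReal hα m)

lemma inner_hermiteLp {α : Fin d → ℝ} (hα : ∀ i, -1 / 2 ≤ α i) (m : Fin d → ℕ)
    (f : Lp ℂ 2 (wPlus α)) :
    inner ℂ (hermiteLp hα m) f = ((Real.sqrt (2 ^ d) : ℝ) : ℂ) * coeff α f m := by
  rw [hermiteLp, inner_smul_left, Complex.conj_ofReal, L2.inner_def]
  congr 1
  refine integral_congr_ae ?_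
  filter_upwards [(memLp_hermite_ofReal hα m).coeFn_toLp] with x hx
  rw [hx, RCLike.inner_apply, Complex.conj_ofReal]

lemma coeff_hermite {α : Fin d → ℝ} (hα : ∀ i, -1 / 2 ≤ α i) {m n : Fin d → ℕ}
    (h : ∀ i, n i % 2 = m i % 2) :
    coeff α (fun x => (hermite α n x : ℂ)) m = if n = m then (1 / 2) ^ d else 0 := by
  have := integral_hermite_mul hα h
  rw [coeff]
  simp only [← Complex.ofReal_mul]
  rw [integral_complex_ofReal, this]
  split_ifs <;> push_cast <;> rfl

lemma sqrt_two_pow_mul_self (d : ℕ) :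
    ((Real.sqrt (2 ^ d) : ℝ) : ℂ) * ((Real.sqrt (2 ^ d) : ℝ) : ℂ) = 2 ^ d := by
  rw [← Complex.ofReal_mul, Real.mul_self_sqrt (by positivity)]
  push_cast; rfl

lemma inner_hermiteLp_hermiteLp {α : Fin d → ℝ} (hα : ∀ i, -1 / 2 ≤ α i) {m n : Fin d → ℕ}
    (h : ∀ i, n i % 2 = m i % 2) :
    inner ℂ (hermiteLp hα m) (hermiteLp hα n) = if n = m then (1 : ℂ) else 0 := by
  nth_rw 2 [hermiteLp]
  rw [inner_smul_right, inner_hermiteLp, coeff_congr_ae α (memLp_hermite_ofReal hα n).coeFn_toLp,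
    coeff_hermite hα h, ← mul_assoc, sqrt_two_pow_mul_self]
  split_ifs
  · rw [← mul_pow]; norm_num
  · simp

lemma orthonormal_hermiteLp {α : Fin d → ℝ} (hα : ∀ i, -1 / 2 ≤ α i) (ε : Fin d → ZMod 2) :
    Orthonormal ℂ (fun m : parityClass ε => hermiteLp hα m.1) := by
  classical
  rw [orthonormal_iff_ite]
  intro m n
  rw [inner_hermiteLp_hermiteLp hα (mod_two_eq_of_mem_parityClass n.2 m.2)]
  by_cases h : m = n
  · simp [h]
  · rw [if_neg h, if_neg fun h' => h (Subtype.ext h'.symm)]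

lemma eq_zero_of_coeff_eq_zero {α : Fin d → ℝ} (hα : ∀ i, -1 / 2 ≤ α i) {ε : Fin d → ZMod 2}
    (f : Lp ℂ 2 (wPlus α)) (h : ∀ m ∈ parityClass ε, coeff α f m = 0) : f = 0 := by
  have hf := Lp.memLp f
  have h1 : ∀ m ∈ parityClass ε, ∫ x, (f x).re * hermite α m x ∂(wPlus α) = 0 := by
    intro m hm
    have := congrArg Complex.re (h m hm)
    rw [coeff, ← RCLike.re_eq_complex_re, ← integral_re (integrable_coeff hα hf m)] at this
    simpa using this
  have h2 : ∀ m ∈ parityClass ε, ∫ x, (f x).im * hermite α m x ∂(wPlus α) = 0 := by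
    intro m hm
    have := congrArg Complex.im (h m hm)
    rw [coeff, ← RCLike.im_eq_complex_im, ← integral_im (integrable_coeff hα hf m)] at this
    simpa using this
  have e1 := ae_eq_zero_of_integral_mul_hermite_eq_zero hα hf.re h1
  have e2 := ae_eq_zero_of_integral_mul_hermite_eq_zero hα hf.im h2
  rw [Lp.eq_zero_iff_ae_eq_zero]
  filter_upwards [e1, e2] with x h1 h2
  exact Complex.ext h1 h2

/-- The coefficients of `f` with respect to the generalized Hermite functions of parity `ε`. -/
noncomputable def parityCoeff (α : Fin d → ℝ) (ε : Fin d → ZMod 2)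
    (f : EuclideanSpace ℝ (Fin d) → ℂ) : (Fin d → ℕ) → ℂ :=
  (parityClass ε).indicator (coeff α f)

/-- Parseval's identity for the generalized Hermite functions on the orthant. -/
lemma tsum_parityCoeff {α : Fin d → ℝ} (hα : ∀ i, -1 / 2 ≤ α i) (ε : Fin d → ZMod 2)
    {f : EuclideanSpace ℝ (Fin d) → ℂ} (hf : MemLp f 2 (wPlus α)) :
    ∑' m, ‖parityCoeff α ε f m‖ₑ ^ 2 = (2⁻¹) ^ d * eLpNorm f 2 (wPlus α) ^ 2 := by
  set F := hf.toLp with hF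
  have hc : ∀ m, coeff α F m = coeff α f m := coeff_congr_ae α hf.coeFn_toLp
  let b := HilbertBasis.mkOfOrthogonalEqBot (orthonormal_hermiteLp hα ε) (by
    rw [Submodule.eq_bot_iff]
    intro g hg
    refine eq_zero_of_coeff_eq_zero (ε := ε) hα g fun m hm => ?_
    have := (Submodule.mem_orthogonal _ _).mp hg (hermiteLp hα m)
      (Submodule.subset_span ⟨⟨m, hm⟩, rfl⟩)
    rw [inner_hermiteLp] at this
    refine (mul_eq_zero.mp this).resolve_left ?_
    exact_mod_cast (Real.sqrt_pos.mpr (by positivity)).ne')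
  have hb : ∀ m, b m = hermiteLp hα m.1 := fun m => by
    simp [b]
  have h1 := b.hasSum_inner_mul_inner F F
  have h2 : HasSum (fun m : parityClass ε => (2 : ℝ) ^ d * ‖coeff α f m‖ ^ 2) (‖F‖ ^ 2) := by
    have h3 := Complex.hasSum_re h1
    rw [← RCLike.re_eq_complex_re, inner_self_eq_norm_sq] at h3
    convert h3 using 2 with m
    rw [hb, ← inner_conj_symm, inner_hermiteLp, hc, ← Complex.normSq_eq_conj_mul_self,
      RCLike.re_eq_complex_re, Complex.ofReal_re, Complex.normSq_eq_norm_sq, norm_mul, mul_pow, Complex.norm_real,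
      Real.norm_of_nonneg (Real.sqrt_nonneg _), Real.sq_sqrt (by positivity)]
  have h4 : ∑' m, ‖parityCoeff α ε f m‖ₑ ^ 2 =
      ∑' m : parityClass ε, ENNReal.ofReal (‖coeff α f m‖ ^ 2) := by
    rw [tsum_subtype (parityClass ε) (fun m => ENNReal.ofReal (‖coeff α f m‖ ^ 2))]
    refine tsum_congr fun m => ?_
    by_cases hm : m ∈ parityClass ε
    · rw [parityCoeff, Set.indicator_of_mem hm, Set.indicator_of_mem hm,
        ENNReal.ofReal_pow (norm_nonneg _), ofReal_norm]
    · rw [parityCoeff, Set.indicator_of_notMem hm, Set.indicator_of_notMem hm]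
      simp
  have h5 : HasSum (fun m : parityClass ε => ‖coeff α f m‖ ^ 2) ((2⁻¹ : ℝ) ^ d * ‖F‖ ^ 2) := by
    simpa only [← mul_assoc, ← mul_pow, inv_mul_cancel₀ (two_ne_zero (α := ℝ)), one_pow, one_mul]
      using h2.mul_left ((2⁻¹ : ℝ) ^ d)
  rw [h4, ← ENNReal.ofReal_tsum_of_nonneg (fun m => by positivity) h5.summable, h5.tsum_eq,
    ENNReal.ofReal_mul (by positivity), ENNReal.ofReal_pow (by positivity),
    ENNReal.ofReal_pow (norm_nonneg _), ENNReal.ofReal_inv_of_pos two_pos, hF, Lp.norm_toLp,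
    ENNReal.ofReal_toReal hf.eLpNorm_ne_top]
  norm_num

/-! ### Families of subexponential growth. -/

/-- A family `u` of functions on `K` grows subexponentially with the degree of the index. -/
def SubExp {ι X : Type*} (deg : ι → ℕ) (K : Set X) (u : ι → X → ℝ) : Prop :=
  ∀ ρ : ℝ, 1 < ρ → ∃ C, 0 ≤ C ∧ ∀ m, ∀ x ∈ K, |u m x| ≤ C * ρ ^ deg m

namespace SubExp

variable {ι X : Type*} {deg : ι → ℕ} {K : Set X} {u v : ι → X → ℝ}

lemma of_le (hu : SubExp deg K u) (h : ∀ m, ∀ x ∈ K, |v m x| ≤ |u m x|) : SubExp deg K v := by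
  intro ρ hρ
  obtain ⟨C, hC, hu⟩ := hu ρ hρ
  exact ⟨C, hC, fun m x hx => (h m x hx).trans (hu m x hx)⟩

lemma add (hu : SubExp deg K u) (hv : SubExp deg K v) :
    SubExp deg K fun m x => u m x + v m x := by
  intro ρ hρ
  obtain ⟨C, hC, hu⟩ := hu ρ hρ
  obtain ⟨D, hD, hv⟩ := hv ρ hρ
  refine ⟨C + D, by positivity, fun m x hx => (abs_add_le _ _).trans ?_⟩
  rw [add_mul]
  exact add_le_add (hu m x hx) (hv m x hx)

/-- The base ρ is shared as √ρ · √ρ between the factors. -/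
lemma mul (hu : SubExp deg K u) (hv : SubExp deg K v) :
    SubExp deg K fun m x => u m x * v m x := by
  intro ρ hρ
  have hs : 1 < Real.sqrt ρ := by rwa [Real.lt_sqrt zero_le_one, one_pow]
  obtain ⟨C, hC, hu⟩ := hu _ hs
  obtain ⟨D, hD, hv⟩ := hv _ hs
  refine ⟨C * D, by positivity, fun m x hx => ?_⟩
  rw [abs_mul]
  calc |u m x| * |v m x| ≤ (C * Real.sqrt ρ ^ deg m) * (D * Real.sqrt ρ ^ deg m) :=
        mul_le_mul (hu m x hx) (hv m x hx) (abs_nonneg _) (by positivity)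
    _ = C * D * (Real.sqrt ρ * Real.sqrt ρ) ^ deg m := by rw [mul_pow]; ring
    _ = _ := by rw [Real.mul_self_sqrt (by linarith)]

lemma of_bounded (h : ∃ C, ∀ m, ∀ x ∈ K, |u m x| ≤ C) : SubExp deg K u := by
  intro ρ hρ
  obtain ⟨C, h⟩ := h
  refine ⟨|C|, abs_nonneg _, fun m x hx => ((h m x hx).trans (le_abs_self _)).trans ?_⟩
  exact le_mul_of_one_le_right (abs_nonneg _) (one_le_pow₀ hρ.le)

lemma comp (hu : SubExp deg K u) (τ : ι → ι) (c : ℕ) (hτ : ∀ m, deg (τ m) ≤ deg m + c) :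
    SubExp deg K fun m x => u (τ m) x := by
  intro ρ hρ
  obtain ⟨C, hC, hu⟩ := hu _ hρ
  refine ⟨C * ρ ^ c, by positivity, fun m x hx => (hu (τ m) x hx).trans ?_⟩
  rw [mul_assoc, ← pow_add, add_comm c]
  gcongr
  · exact hρ.le
  · exact hτ m

/-- Bernoulli's inequality n(ρ-1) ≤ ρ^n. -/
lemma degree : SubExp deg K fun m _ => (deg m : ℝ) := by
  intro ρ hρ
  have hd : 0 < ρ - 1 := by linarith
  refine ⟨1 / (ρ - 1), by positivity, fun m x _ => ?_⟩
  have h := one_add_mul_le_pow (show (-2 : ℝ) ≤ ρ - 1 by linarith) (deg m)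
  rw [add_sub_cancel] at h
  rw [Nat.abs_cast, div_mul_eq_mul_div, le_div_iff₀ hd]
  linarith

lemma mono {K' : Set X} (hu : SubExp deg K u) (h : K' ⊆ K) : SubExp deg K' u := by
  intro ρ hρ
  obtain ⟨C, hC, hu⟩ := hu ρ hρ
  exact ⟨C, hC, fun m x hx => hu m x (h hx)⟩

end SubExp

/-- The total degree of a multi-index. -/
def totalDegree (m : Fin d → ℕ) : ℕ := ∑ i, m i

lemma SubExp.prod {K : Fin d → Set ℝ} {u : Fin d → ℕ → ℝ → ℝ}
    (h : ∀ i, SubExp id (K i) (u i)) :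
    SubExp totalDegree {x : EuclideanSpace ℝ (Fin d) | ∀ i, x i ∈ K i}
      fun m x => ∏ i, u i (m i) (x i) := by
  intro ρ hρ
  choose C hC hb using fun i => h i ρ hρ
  refine ⟨∏ i, C i, Finset.prod_nonneg fun i _ => hC i, fun m x hx => ?_⟩
  rw [Finset.abs_prod, totalDegree, ← Finset.prod_pow_eq_pow_sum, ← Finset.prod_mul_distrib]
  exact Finset.prod_le_prod (fun i _ => abs_nonneg _) fun i _ => hb i (m i) (x i) (hx i)

lemma subExp_hermiteOne {a : ℝ} (ha : -1 / 2 ≤ a) (R : ℝ) :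
    SubExp id {x | |x| ≤ R} (hermiteOne a) := fun _ hρ => by
  obtain ⟨C, hC, h⟩ := exists_hermiteOne_le ha R hρ
  exact ⟨C, hC, fun k x hx => h k x hx⟩

lemma ladder_le {a : ℝ} (ha : -1 / 2 ≤ a) (k : ℕ) : ladder a k ≤ k + (2 * a + 2) := by
  have h := ladder_sq_le ha k
  have hk : (0 : ℝ) ≤ k := k.cast_nonneg
  refine le_of_sq_le_sq (h.trans ?_) (by linarith)
  nlinarith

lemma subExp_ladder {X : Type*} (K : Set X) {a : ℝ} (ha : -1 / 2 ≤ a) :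
    SubExp id K fun k _ => ladder a k := by
  have h1 : SubExp (X := X) id K fun k _ => ((id k : ℕ) : ℝ) := SubExp.degree
  have h2 : SubExp (X := X) (id : ℕ → ℕ) K fun _ _ => 2 * a + 2 :=
    SubExp.of_bounded ⟨|2 * a + 2|, fun _ _ _ => le_rfl⟩
  refine (h1.add h2).of_le fun k x _ => ?_
  rw [abs_of_nonneg (ladder_nonneg a k)]
  exact (ladder_le ha k).trans (le_abs_self _)

/-- The derivative of a one-dimensional generalized Hermite function. -/
noncomputable def hermiteOneDeriv (a : ℝ) (k : ℕ) (x : ℝ) : ℝ :=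
  ladder a k * hermiteOne a (k - 1) x - x * hermiteOne a k x -
    (a + 1 / 2) * ((hermiteOne a k x - hermiteOne a k (-x)) / x)

lemma subExp_hermiteOneDeriv {a : ℝ} (ha : -1 / 2 ≤ a) (R : ℝ) :
    SubExp id {x | 1 / R ≤ x ∧ x ≤ R ∧ 0 < R} (hermiteOneDeriv a) := by
  set K : Set ℝ := {x | 1 / R ≤ x ∧ x ≤ R ∧ 0 < R} with hK
  have hpos : ∀ x ∈ K, 0 < x := fun x hx => lt_of_lt_of_le (one_div_pos.mpr hx.2.2) hx.1
  have hh : SubExp id K (hermiteOne a) :=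
    (subExp_hermiteOne ha R).mono fun x hx => by
      simpa [abs_of_pos (hpos x hx)] using hx.2.1
  have h1 : SubExp id K fun k x => ladder a k * hermiteOne a (k - 1) x :=
    (subExp_ladder K ha).mul (hh.comp (fun k => k - 1) 0 fun k => Nat.sub_le _ _)
  -- On K one has 1/x ≤ R and |h(x) - h(-x)| ≤ 2|h(x)|, so the reflection term is at most (a+1/2) ·
  -- 2R · |h(x)|. The signs are chosen so that this factor has absolute value x + (a+1/2) · 2R.
  have h2 : SubExp (id : ℕ → ℕ) K fun _ x => -x - (a + 1 / 2) * (2 * R) := by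
    refine SubExp.of_bounded ⟨R + |(a + 1 / 2) * (2 * R)|, fun _ x hx => ?_⟩
    refine (abs_sub _ _).trans ?_
    rw [abs_neg, abs_of_pos (hpos x hx)]
    linarith [hx.2.1]
  refine (((h1.mul (SubExp.of_bounded ⟨1, fun _ _ _ => abs_one.le⟩ :
    SubExp id K fun _ _ => (1 : ℝ))).of_le (v := fun k x =>
      |ladder a k * hermiteOne a (k - 1) x|) (by simp)).add ((h2.mul hh).of_le
      (v := fun k x => |(-x - (a + 1 / 2) * (2 * R)) * hermiteOne a k x|) (by simp))).of_le ?_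
  intro k x hx
  have hx0 := hpos x hx
  have ha0 : 0 ≤ a + 1 / 2 := by linarith
  have hR0 := hx.2.2
  rw [abs_of_nonneg (by positivity : 0 ≤ |ladder a k * hermiteOne a (k - 1) x| +
    |(-x - (a + 1 / 2) * (2 * R)) * hermiteOne a k x|), hermiteOneDeriv, sub_sub]
  refine (abs_sub _ _).trans (add_le_add le_rfl ?_)
  have hxi : 1 / x ≤ R := by
    rw [div_le_iff₀ hx0]
    have := hx.1
    rwa [div_le_iff₀ hR0, mul_comm] at this
  have hdiff : |(hermiteOne a k x - hermiteOne a k (-x)) / x| ≤ 2 * R * |hermiteOne a k x| := by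
    have : |hermiteOne a k x - hermiteOne a k (-x)| ≤ 2 * |hermiteOne a k x| := by
      refine (abs_sub _ _).trans ?_
      rw [hermiteOne_neg, abs_mul, abs_pow, abs_neg, abs_one, one_pow]
      linarith
    rw [abs_div, abs_of_pos hx0, div_eq_mul_one_div]
    calc _ ≤ (2 * |hermiteOne a k x|) * R := mul_le_mul this hxi (by positivity) (by positivity)
      _ = _ := by ring
  have e : |(-x - (a + 1 / 2) * (2 * R)) * hermiteOne a k x| =
      (x + (a + 1 / 2) * (2 * R)) * |hermiteOne a k x| := by
    rw [abs_mul, ← abs_neg, abs_of_nonneg (by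
      have : 0 ≤ (a + 1 / 2) * (2 * R) := by positivity
      linarith)]
    ring
  rw [e]
  refine (abs_add_le _ _).trans ?_
  rw [abs_mul, abs_of_pos hx0, abs_mul, abs_of_nonneg ha0, add_mul]
  linarith [mul_le_mul_of_nonneg_left hdiff ha0]

lemma subExp_hermite {α : Fin d → ℝ} (hα : ∀ i, -1 / 2 ≤ α i) (R : ℝ) :
    SubExp totalDegree {x : EuclideanSpace ℝ (Fin d) | ∀ i, |x i| ≤ R} (hermite α) :=
  SubExp.prod fun i => subExp_hermiteOne (hα i) R

lemma eigen_pos (hd : 1 ≤ d) {α : Fin d → ℝ} (hα : ∀ i, -1 / 2 ≤ α i) (n : ℕ) : 0 < eigen α n := by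
  have h1 : ∑ _i : Fin d, (-1 / 2 : ℝ) ≤ ∑ i, α i := Finset.sum_le_sum fun i _ => hα i
  rw [Finset.sum_const, Finset.card_univ, Fintype.card_fin, nsmul_eq_mul] at h1
  have h2 : (1 : ℝ) ≤ d := by exact_mod_cast hd
  have h3 : (0 : ℝ) ≤ n := n.cast_nonneg
  rw [eigen]
  linarith

lemma summable_pow_totalDegree (d : ℕ) {q : ℝ} (hq0 : 0 ≤ q) (hq1 : q < 1) :
    Summable fun m : Fin d → ℕ => q ^ totalDegree m := by
  induction d with
  | zero => exact (hasSum_fintype _).summable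
  | succ n ih =>
    rw [← (Fin.consEquiv fun _ : Fin (n + 1) => ℕ).summable_iff]
    have := (summable_geometric_of_lt_one hq0 hq1).mul_of_nonneg ih
      (fun _ => pow_nonneg hq0 _) (fun _ => pow_nonneg hq0 _)
    refine this.congr fun p => ?_
    simp [totalDegree, Fin.sum_univ_succ, pow_add, Fin.consEquiv]

/-- Subexponentially growing families are summable against the heat factors, uniformly for times
bounded away from zero. -/
lemma SubExp.exists_summable_bound {X : Type*} {K : Set X} {u : (Fin d → ℕ) → X → ℝ}
    (hu : SubExp totalDegree K u) (hd : 1 ≤ d) {α : Fin d → ℝ} (hα : ∀ i, -1 / 2 ≤ α i)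
    {t₀ : ℝ} (ht₀ : 0 < t₀) :
    ∃ B : (Fin d → ℕ) → ℝ, Summable B ∧ ∀ m, ∀ x ∈ K, ∀ t, t₀ ≤ t →
      |u m x| * Real.exp (-t * eigen α (totalDegree m)) ≤ B m := by
  -- Growth e^{t₀|m|} against the heat factor e^{-2t₀|m|} leaves the summable e^{-t₀|m|}.
  obtain ⟨C, hC, hu⟩ := hu (Real.exp t₀) (Real.one_lt_exp_iff.mpr ht₀)
  refine ⟨fun m => C * Real.exp (-t₀ * (2 * ∑ i, α i + 2 * d)) *
    Real.exp (-t₀) ^ totalDegree m, (summable_pow_totalDegree d (Real.exp_pos _).le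
      (Real.exp_lt_one_iff.mpr (by linarith))).mul_left _, fun m x hx t ht => ?_⟩
  have h1 : Real.exp (-t * eigen α (totalDegree m)) ≤ Real.exp (-t₀ * eigen α (totalDegree m)) := by
    rw [Real.exp_le_exp]
    nlinarith [eigen_pos hd hα (totalDegree m)]
  calc |u m x| * Real.exp (-t * eigen α (totalDegree m))
      ≤ (C * Real.exp t₀ ^ totalDegree m) * Real.exp (-t₀ * eigen α (totalDegree m)) :=
        mul_le_mul (hu m x hx) h1 (Real.exp_pos _).le (by positivity)
    _ = _ := by
      beta_reduce
      rw [eigen, ← Real.exp_nat_mul, ← Real.exp_nat_mul, mul_assoc, mul_assoc, ← Real.exp_add,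
        ← Real.exp_add]
      ring_nf

/-- Numerical sequences are families on a one-point space; this moves them to the domain of the
functions they multiply. -/
lemma SubExp.const {ι X : Type*} {deg : ι → ℕ} {c : ι → ℝ}
    (h : SubExp deg (Set.univ : Set Unit) fun m _ => c m) (K : Set X) :
    SubExp deg K fun m _ => c m := by
  intro ρ hρ
  obtain ⟨C, hC, h⟩ := h ρ hρ
  exact ⟨C, hC, fun m _ _ => h m () trivial⟩

/-! ### Hermite expansions with heat factors: convergence and derivatives. -/

/-- Coefficient sequences of subexponential growth. -/
def SubExpSeq (b : (Fin d → ℕ) → ℂ) : Prop :=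
  SubExp totalDegree (Set.univ : Set Unit) fun m _ => ‖b m‖

/-- The general term of an expansion in generalized Hermite functions, with heat factors. -/
noncomputable def expansionTerm (α : Fin d → ℝ) (b : (Fin d → ℕ) → ℂ)
    (τ : (Fin d → ℕ) → Fin d → ℕ) (t : ℝ) (x : EuclideanSpace ℝ (Fin d)) (m : Fin d → ℕ) : ℂ :=
  b m * (Real.exp (-t * eigen α (totalDegree m)) : ℂ) * (hermite α (τ m) x : ℂ)

/-- The expansion `∑_m b_m e^{-tλ_{|m|}} h_{τ(m)}`. -/
noncomputable def expansion (α : Fin d → ℝ) (b : (Fin d → ℕ) → ℂ)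
    (τ : (Fin d → ℕ) → Fin d → ℕ) (t : ℝ) (x : EuclideanSpace ℝ (Fin d)) : ℂ :=
  ∑' m, expansionTerm α b τ t x m

lemma exists_abs_le (x : EuclideanSpace ℝ (Fin d)) :
    x ∈ {y : EuclideanSpace ℝ (Fin d) | ∀ i, |y i| ≤ ‖x‖} := fun i => PiLp.norm_apply_le x i

section Expansion

variable {α : Fin d → ℝ} {b : (Fin d → ℕ) → ℂ} {τ : (Fin d → ℕ) → Fin d → ℕ} {c : ℕ}

lemma norm_expansionTerm (t : ℝ) (x : EuclideanSpace ℝ (Fin d)) (m : Fin d → ℕ) :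
    ‖expansionTerm α b τ t x m‖ =
      |‖b m‖ * hermite α (τ m) x| * Real.exp (-t * eigen α (totalDegree m)) := by
  rw [expansionTerm, norm_mul, norm_mul, Complex.norm_real, Complex.norm_real,
    Real.norm_of_nonneg (Real.exp_pos _).le, abs_mul, abs_norm, Real.norm_eq_abs]
  ring

lemma exists_expansionTerm_bound (hd : 1 ≤ d) (hα : ∀ i, -1 / 2 ≤ α i) (hb : SubExpSeq b)
    (hτ : ∀ m, totalDegree (τ m) ≤ totalDegree m + c) {t₀ : ℝ} (ht₀ : 0 < t₀) (R : ℝ) :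
    ∃ B : (Fin d → ℕ) → ℝ, Summable B ∧ ∀ m, ∀ x : EuclideanSpace ℝ (Fin d), (∀ i, |x i| ≤ R) →
      ∀ t, t₀ ≤ t → ‖expansionTerm α b τ t x m‖ ≤ B m := by
  obtain ⟨B, hB, h⟩ := ((hb.const _).mul ((subExp_hermite hα R).comp τ c hτ)).exists_summable_bound
    hd hα ht₀
  exact ⟨B, hB, fun m x hx t ht => by rw [norm_expansionTerm]; exact h m x hx t ht⟩

lemma summable_expansionTerm (hd : 1 ≤ d) (hα : ∀ i, -1 / 2 ≤ α i) (hb : SubExpSeq b)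
    (hτ : ∀ m, totalDegree (τ m) ≤ totalDegree m + c) {t : ℝ} (ht : 0 < t)
    (x : EuclideanSpace ℝ (Fin d)) : Summable (expansionTerm α b τ t x) := by
  obtain ⟨B, hB, h⟩ := exists_expansionTerm_bound hd hα hb hτ ht ‖x‖
  exact Summable.of_norm_bounded hB fun m => h m x (exists_abs_le x) t le_rfl

lemma subExpSeq_eigen_mul (hb : SubExpSeq b) :
    SubExpSeq fun m => -(eigen α (totalDegree m) : ℂ) * b m := by
  have h1 : SubExp (totalDegree : (Fin d → ℕ) → ℕ) (Set.univ : Set Unit) fun m _ =>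
      (totalDegree m : ℝ) := SubExp.degree
  have h0 : SubExp (totalDegree : (Fin d → ℕ) → ℕ) (Set.univ : Set Unit) fun _ _ =>
      2 * ∑ i, α i + 2 * (d : ℝ) := SubExp.of_bounded ⟨_, fun _ _ _ => le_rfl⟩
  refine (((h1.add h1).add h0).mul hb).of_le fun m x _ => ?_
  rw [norm_mul, norm_neg, Complex.norm_real, abs_mul, abs_mul, Real.norm_eq_abs, abs_abs, eigen]
  exact le_of_eq (by congr 2; ring)

/-- Differentiation in t multiplies the coefficients by -λ, which keeps them subexponential; the
differentiated series is dominated uniformly for s > t/2. -/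
lemma hasDerivAt_expansion (hd : 1 ≤ d) (hα : ∀ i, -1 / 2 ≤ α i) (hb : SubExpSeq b)
    (hτ : ∀ m, totalDegree (τ m) ≤ totalDegree m + c) {t : ℝ} (ht : 0 < t)
    (x : EuclideanSpace ℝ (Fin d)) :
    HasDerivAt (fun s => expansion α b τ s x)
      (expansion α (fun m => -(eigen α (totalDegree m) : ℂ) * b m) τ t x) t := by
  obtain ⟨B, hB, h⟩ := exists_expansionTerm_bound hd hα (subExpSeq_eigen_mul (α := α) hb) hτ
    (half_pos ht) ‖x‖
  refine hasDerivAt_tsum_of_isPreconnected (t := Set.Ioi (t / 2)) (y₀ := t) hB isOpen_Ioi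
    isPreconnected_Ioi (fun m s _ => ?_) (fun m s hs => h m x (exists_abs_le x) s (le_of_lt hs))
    (half_lt_self ht) (summable_expansionTerm hd hα hb hτ ht x) (half_lt_self ht)
  have h1 : HasDerivAt (fun s : ℝ => Real.exp (-s * eigen α (totalDegree m)))
      (Real.exp (-s * eigen α (totalDegree m)) * (-1 * eigen α (totalDegree m))) s :=
    ((hasDerivAt_id s).neg.mul_const _).exp
  have h2 := (h1.ofReal_comp.const_mul (b m)).mul_const ((hermite α (τ m) x : ℂ))
  refine h2.congr_deriv ?_
  rw [expansionTerm]
  push_cast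
  ring

end Expansion

/-- The derivative of a generalized Hermite function on the orthant. -/
noncomputable def hermiteFDeriv (α : Fin d → ℝ) (m : Fin d → ℕ) (x : EuclideanSpace ℝ (Fin d)) :
    EuclideanSpace ℝ (Fin d) →L[ℝ] ℝ :=
  ∑ i, (∏ j ∈ Finset.univ.erase i, hermiteOne (α j) (m j) (x j)) •
    (hermiteOneDeriv (α i) (m i) (x i) • EuclideanSpace.proj (𝕜 := ℝ) i)

lemma hasFDerivAt_hermite {α : Fin d → ℝ} (hα : ∀ i, -1 / 2 ≤ α i) (m : Fin d → ℕ)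
    {x : EuclideanSpace ℝ (Fin d)} (hx : x ∈ orthant d) :
    HasFDerivAt (hermite α m) (hermiteFDeriv α m x) x := by
  refine HasFDerivAt.finsetProd fun i _ => ?_
  exact (hasDerivAt_hermiteOne (by linarith [hα i]) (m i) (hx i).ne').comp_hasFDerivAt x
    (EuclideanSpace.proj (𝕜 := ℝ) i).hasFDerivAt

lemma hermiteFDeriv_single (α : Fin d → ℝ) (m : Fin d → ℕ) (x : EuclideanSpace ℝ (Fin d))
    (j : Fin d) : hermiteFDeriv α m x (EuclideanSpace.single j 1) =
      hermiteOneDeriv (α j) (m j) (x j) *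
        ∏ i ∈ Finset.univ.erase j, hermiteOne (α i) (m i) (x i) := by
  simp only [hermiteFDeriv, sum_apply, smul_apply,
    EuclideanSpace.coe_proj, smul_eq_mul]
  rw [Finset.sum_eq_single j]
  · simp [mul_comm]
  · intro i _ hij
    simp [hij]
  · simp

/-- Each partial derivative is a product of one-dimensional families with one factor differentiated.
The box stays away from the coordinate hyperplanes because that factor involves 1/x_i. -/
lemma subExp_hermiteFDeriv {α : Fin d → ℝ} (hα : ∀ i, -1 / 2 ≤ α i) (R : ℝ) :
    SubExp totalDegree
      {x : EuclideanSpace ℝ (Fin d) | ∀ i, x i ∈ {y | 1 / R ≤ y ∧ y ≤ R ∧ 0 < R}}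
      fun m x => ‖hermiteFDeriv α m x‖ := by
  set K : Set (EuclideanSpace ℝ (Fin d)) := {x | ∀ i, x i ∈ {y | 1 / R ≤ y ∧ y ≤ R ∧ 0 < R}}
  have h1 : ∀ i : Fin d, SubExp totalDegree K fun m x => |hermiteOneDeriv (α i) (m i) (x i) *
      ∏ j ∈ Finset.univ.erase i, hermiteOne (α j) (m j) (x j)| := by
    intro i
    have := SubExp.prod (K := fun _ : Fin d => {y | 1 / R ≤ y ∧ y ≤ R ∧ 0 < R})
      (u := fun j k y => if j = i then hermiteOneDeriv (α j) k y else hermiteOne (α j) k y)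
      fun j => by
        by_cases hj : j = i
        · simpa only [hj, if_true] using subExp_hermiteOneDeriv (hα i) R
        · simp only [hj, if_false]
          refine (subExp_hermiteOne (hα j) R).mono fun x hx => ?_
          have : 0 < x := lt_of_lt_of_le (one_div_pos.mpr hx.2.2) hx.1
          simpa [abs_of_pos this] using hx.2.1
    refine this.of_le fun m x _ => ?_
    rw [abs_abs, ← Finset.mul_prod_erase _ _ (Finset.mem_univ i), if_pos rfl]
    refine le_of_eq (congrArg _ (congrArg _ (Finset.prod_congr rfl fun j hj => ?_)))
    rw [if_neg (Finset.ne_of_mem_erase hj)]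
  have h2 : ∀ s : Finset (Fin d), SubExp totalDegree K fun m x => ∑ i ∈ s, |hermiteOneDeriv (α i) (m i) (x i) *
      ∏ j ∈ Finset.univ.erase i, hermiteOne (α j) (m j) (x j)| := by
    intro s
    induction s using Finset.induction_on with
    | empty => simpa using (SubExp.of_bounded ⟨0, fun _ _ _ => by simp⟩ :
        SubExp totalDegree K fun _ _ => (0 : ℝ))
    | insert i s his ih =>
      simp only [Finset.sum_insert his]
      exact (h1 i).add ih
  refine (h2 Finset.univ).of_le fun m x _ => ?_
  rw [abs_norm, abs_of_nonneg (Finset.sum_nonneg fun i _ => abs_nonneg _)]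
  refine (norm_sum_le _ _).trans (Finset.sum_le_sum fun i _ => ?_)
  rw [norm_smul, norm_smul, Real.norm_eq_abs, Real.norm_eq_abs, abs_mul, mul_comm, mul_right_comm]
  refine mul_le_of_le_one_right (by positivity) ?_
  refine ContinuousLinearMap.opNorm_le_bound _ zero_le_one fun y => ?_
  rw [one_mul]
  exact PiLp.norm_apply_le y i

lemma measurable_expansion (α : Fin d → ℝ) (b : (Fin d → ℕ) → ℂ) (τ : (Fin d → ℕ) → Fin d → ℕ) :
    Measurable fun p : EuclideanSpace ℝ (Fin d) × ℝ => expansion α b τ p.2 p.1 := by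
  refine Measurable.tsum fun m => ?_
  have h := (continuous_hermite α (τ m)).measurable
  unfold expansionTerm
  fun_prop

lemma parityCoeff_le {α : Fin d → ℝ} (hα : ∀ i, -1 / 2 ≤ α i) (ε : Fin d → ZMod 2)
    {f : EuclideanSpace ℝ (Fin d) → ℂ} (hf : MemLp f 2 (wPlus α)) (m : Fin d → ℕ) :
    ‖parityCoeff α ε f m‖ ≤ (eLpNorm f 2 (wPlus α)).toReal := by
  have h1 := (ENNReal.le_tsum (f := fun m => ‖parityCoeff α ε f m‖ₑ ^ 2) m).trans_eq
    (tsum_parityCoeff hα ε hf)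
  have h2 : ‖parityCoeff α ε f m‖ₑ ^ 2 ≤ eLpNorm f 2 (wPlus α) ^ 2 :=
    h1.trans (mul_le_of_le_one_left' (pow_le_one' (by simp) _))
  have h3 : ‖parityCoeff α ε f m‖ₑ ≤ eLpNorm f 2 (wPlus α) := by
    contrapose! h2
    exact ENNReal.pow_lt_pow_left two_ne_zero h2
  rw [← toReal_enorm]
  exact ENNReal.toReal_mono hf.eLpNorm_ne_top h3

lemma subExpSeq_parityCoeff {α : Fin d → ℝ} (hα : ∀ i, -1 / 2 ≤ α i) (ε : Fin d → ZMod 2)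
    {f : EuclideanSpace ℝ (Fin d) → ℂ} (hf : MemLp f 2 (wPlus α)) :
    SubExpSeq (parityCoeff α ε f) :=
  SubExp.of_bounded ⟨_, fun m _ _ => by rw [abs_norm]; exact parityCoeff_le hα ε hf m⟩

/-! ### The semigroup and its derivatives as expansions. -/

/-- The level sums are the fibre sums, over the total degree, of one series indexed by
multi-indices. Convergence in n thus follows from absolute convergence of the latter. -/
lemma semigroupTerm_eq_tsum (α : Fin d → ℝ) (ε : Fin d → ZMod 2)
    (f : EuclideanSpace ℝ (Fin d) → ℂ) (t : ℝ) (x : EuclideanSpace ℝ (Fin d)) (n : ℕ) :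
    semigroupTerm α ε f t x n =
      ∑' m : (totalDegree ⁻¹' {n} : Set (Fin d → ℕ)), expansionTerm α (parityCoeff α ε f) id t x m.1 := by
  have hset : (totalDegree ⁻¹' {n} : Set (Fin d → ℕ)) =
      ((Finset.univ.piAntidiag n : Finset (Fin d → ℕ)) : Set (Fin d → ℕ)) := by
    ext m; simp [totalDegree]
  rw [hset, Finset.tsum_subtype', semigroupTerm, level, Finset.sum_filter, Finset.mul_sum]
  refine Finset.sum_congr rfl fun m hm => ?_
  have hn : totalDegree m = n := by
    have := (Finset.mem_piAntidiag.mp hm).1; exact this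
  rw [expansionTerm, hn, id]
  by_cases h : ∀ i, (m i : ZMod 2) = ε i
  · rw [if_pos h, parityCoeff, Set.indicator_of_mem (show m ∈ parityClass ε from h)]
    ring
  · rw [if_neg h, parityCoeff, Set.indicator_of_notMem (show m ∉ parityClass ε from h)]
    ring

section Semigroup

variable {α : Fin d → ℝ} {f : EuclideanSpace ℝ (Fin d) → ℂ}

lemma hasSum_semigroupTerm (hd : 1 ≤ d) (hα : ∀ i, -1 / 2 ≤ α i) (ε : Fin d → ZMod 2)
    (hf : MemLp f 2 (wPlus α)) {t : ℝ} (ht : 0 < t) (x : EuclideanSpace ℝ (Fin d)) :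
    HasSum (semigroupTerm α ε f t x) (expansion α (parityCoeff α ε f) id t x) := by
  have h := (summable_expansionTerm (τ := id) (c := 0) hd hα (subExpSeq_parityCoeff hα ε hf)
    (fun _ => le_rfl) ht x).hasSum.tsum_fiberwise totalDegree
  rw [funext (semigroupTerm_eq_tsum α ε f t x)]
  exact h

lemma semigroup_eq_expansion (hd : 1 ≤ d) (hα : ∀ i, -1 / 2 ≤ α i) (ε : Fin d → ZMod 2)
    (hf : MemLp f 2 (wPlus α)) {t : ℝ} (ht : 0 < t) :
    semigroup α ε f t = expansion α (parityCoeff α ε f) id t :=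
  funext fun x => (hasSum_semigroupTerm hd hα ε hf ht x).tsum_eq

lemma hasDerivAt_semigroup (hd : 1 ≤ d) (hα : ∀ i, -1 / 2 ≤ α i) (ε : Fin d → ZMod 2)
    (hf : MemLp f 2 (wPlus α)) {t : ℝ} (ht : 0 < t) (x : EuclideanSpace ℝ (Fin d)) :
    HasDerivAt (fun s => semigroup α ε f s x) (expansion α
      (fun m => -(eigen α (totalDegree m) : ℂ) * parityCoeff α ε f m) id t x) t := by
  refine (hasDerivAt_expansion (c := 0) hd hα (subExpSeq_parityCoeff hα ε hf)
    (fun _ => le_rfl) ht x).congr_of_eventuallyEq ?_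
  filter_upwards [lt_mem_nhds ht] with s hs
  rw [semigroup_eq_expansion hd hα ε hf hs]
  rfl

lemma vertical_eq_expansion (hd : 1 ≤ d) (hα : ∀ i, -1 / 2 ≤ α i) (ε : Fin d → ZMod 2)
    (hf : MemLp f 2 (wPlus α)) {t : ℝ} (ht : 0 < t) (x : EuclideanSpace ℝ (Fin d)) :
    vertical α ε f t x = expansion α
      (fun m => -(eigen α (totalDegree m) : ℂ) * parityCoeff α ε f m) id t x :=
  (hasDerivAt_semigroup hd hα ε hf ht x).deriv

/-- The Fréchet derivative of the general term of an expansion on the orthant. -/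
noncomputable def expansionTermFDeriv (α : Fin d → ℝ) (b : (Fin d → ℕ) → ℂ) (t : ℝ)
    (x : EuclideanSpace ℝ (Fin d)) (m : Fin d → ℕ) : EuclideanSpace ℝ (Fin d) →L[ℝ] ℂ :=
  (b m * (Real.exp (-t * eigen α (totalDegree m)) : ℂ)) •
    (Complex.ofRealCLM.comp (hermiteFDeriv α m x))

lemma hasFDerivAt_expansionTerm (hα : ∀ i, -1 / 2 ≤ α i) (b : (Fin d → ℕ) → ℂ) (t : ℝ)
    {x : EuclideanSpace ℝ (Fin d)} (hx : x ∈ orthant d) (m : Fin d → ℕ) :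
    HasFDerivAt (fun y => expansionTerm α b id t y m) (expansionTermFDeriv α b t x m) x :=
  (Complex.ofRealCLM.hasFDerivAt.comp x (hasFDerivAt_hermite hα m hx)).const_mul _

lemma norm_expansionTermFDeriv_le (α : Fin d → ℝ) (b : (Fin d → ℕ) → ℂ) (t : ℝ)
    (x : EuclideanSpace ℝ (Fin d)) (m : Fin d → ℕ) : ‖expansionTermFDeriv α b t x m‖ ≤
      |‖b m‖ * ‖hermiteFDeriv α m x‖| * Real.exp (-t * eigen α (totalDegree m)) := by
  rw [expansionTermFDeriv, norm_smul, norm_mul, Complex.norm_real,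
    Real.norm_of_nonneg (Real.exp_pos _).le, abs_mul, abs_norm, abs_norm, mul_right_comm]
  gcongr
  refine (ContinuousLinearMap.opNorm_comp_le _ _).trans ?_
  rw [Complex.ofRealCLM_norm, one_mul]

lemma exists_expansionTermFDeriv_bound (hd : 1 ≤ d) (hα : ∀ i, -1 / 2 ≤ α i)
    {b : (Fin d → ℕ) → ℂ} (hb : SubExpSeq b) {t : ℝ} (ht : 0 < t) (R : ℝ) :
    ∃ B : (Fin d → ℕ) → ℝ, Summable B ∧ ∀ m,
      ∀ x ∈ {x : EuclideanSpace ℝ (Fin d) | ∀ i, x i ∈ {y | 1 / R ≤ y ∧ y ≤ R ∧ 0 < R}},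
        ‖expansionTermFDeriv α b t x m‖ ≤ B m := by
  obtain ⟨B, hB, h⟩ := ((hb.const _).mul (subExp_hermiteFDeriv hα R)).exists_summable_bound
    hd hα ht
  exact ⟨B, hB, fun m x hx => (norm_expansionTermFDeriv_le α b t x m).trans (h m x hx t le_rfl)⟩

lemma exists_box {x : EuclideanSpace ℝ (Fin d)} (hx : x ∈ orthant d) :
    ∃ R : ℝ, 0 < R ∧ ∀ i, 1 / R < x i ∧ x i < R := by
  have h : ∀ i : Fin d, ∃ r : ℝ, 0 < r ∧ 1 / r < x i ∧ x i < r := fun i => by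
    have hi : 0 < x i := hx i
    refine ⟨x i + 1 / x i + 1, by positivity, ?_, ?_⟩
    · rw [div_lt_iff₀ (by positivity)]
      have : x i * (x i + 1 / x i + 1) = x i * x i + 1 + x i := by field_simp
      rw [this]
      nlinarith
    · have : 0 < 1 / x i := by positivity
      linarith
  choose r hr0 hr1 hr2 using h
  refine ⟨1 + ∑ i, r i, by
    have := Finset.sum_nonneg fun i (_ : i ∈ Finset.univ) => (hr0 i).le
    linarith, fun i => ?_⟩
  have hle : r i ≤ 1 + ∑ i, r i := by
    have := Finset.single_le_sum (f := r) (fun i _ => (hr0 i).le) (Finset.mem_univ i)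
    linarith
  exact ⟨(one_div_le_one_div_of_le (hr0 i) hle).trans_lt (hr1 i), (hr2 i).trans_le hle⟩

/-- Termwise differentiation on an open convex box around x whose closure stays inside the orthant,
where the derivatives are uniformly dominated. -/
lemma hasFDerivAt_expansion (hd : 1 ≤ d) (hα : ∀ i, -1 / 2 ≤ α i)
    {b : (Fin d → ℕ) → ℂ} (hb : SubExpSeq b) {t : ℝ} (ht : 0 < t)
    {x : EuclideanSpace ℝ (Fin d)} (hx : x ∈ orthant d) :
    Summable (expansionTermFDeriv α b t x) ∧
    HasFDerivAt (expansion α b id t) (∑' m, expansionTermFDeriv α b t x m) x := by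
  obtain ⟨R, hR0, hR⟩ := exists_box hx
  obtain ⟨B, hB, hbd⟩ := exists_expansionTermFDeriv_bound hd hα hb ht R
  set s : Set (EuclideanSpace ℝ (Fin d)) := {y | ∀ i, y i ∈ Set.Ioo (1 / R) R} with hs
  have hopen : IsOpen s := by
    have : s = ⋂ i, {y | y i ∈ Set.Ioo (1 / R) R} := by ext; simp [hs]
    rw [this]
    exact isOpen_iInter_of_finite fun i => isOpen_Ioo.preimage (by fun_prop)
  have hconv : Convex ℝ s := by
    intro y hy z hz p q hp hq hpq i
    exact convex_Ioo (1 / R) R (hy i) (hz i) hp hq hpq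
  have hK : ∀ y ∈ s, y ∈ {x : EuclideanSpace ℝ (Fin d) | ∀ i, x i ∈ {y | 1 / R ≤ y ∧ y ≤ R ∧ 0 < R}} :=
    fun y hy i => ⟨(hy i).1.le, (hy i).2.le, hR0⟩
  have hso : ∀ y ∈ s, y ∈ orthant d := fun y hy i => (one_div_pos.mpr hR0).trans (hy i).1
  refine ⟨Summable.of_norm_bounded hB fun m => hbd m x (hK x hR), ?_⟩
  exact hasFDerivAt_tsum_of_isPreconnected hB hopen hconv.isPreconnected
    (fun m y hy => hasFDerivAt_expansionTerm hα b t (hso y hy) m) (fun m y hy => hbd m y (hK y hy))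
    (x₀ := x) hR (summable_expansionTerm (τ := id) (c := 0) hd hα hb (fun _ => le_rfl) ht x) hR

lemma hermite_reflect (α : Fin d → ℝ) (m : Fin d → ℕ) (j : Fin d) (x : EuclideanSpace ℝ (Fin d)) :
    hermite α m (reflect j x) = hermiteOne (α j) (m j) (-(x j)) *
      ∏ i ∈ Finset.univ.erase j, hermiteOne (α i) (m i) (x i) := by
  rw [hermite_eq_mul_prod_erase α m j]
  congr 1
  · simp [reflect]
  · refine Finset.prod_congr rfl fun i hi => ?_
    simp [reflect, Function.update_of_ne (Finset.ne_of_mem_erase hi)]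

/-- The lowering relation, term by term. The derivative, the reflection quotient and the
multiplication by x_j are summed separately; the reflected series makes sense because expansions
converge on all of ℝ^d. -/
lemma delta_expansion (hd : 1 ≤ d) (hα : ∀ i, -1 / 2 ≤ α i)
    {b : (Fin d → ℕ) → ℂ} (hb : SubExpSeq b) {t : ℝ} (ht : 0 < t)
    {x : EuclideanSpace ℝ (Fin d)} (hx : x ∈ orthant d) (j : Fin d) :
    delta α j (expansion α b id t) x = expansion α (fun m => (ladder (α j) (m j) : ℂ) * b m)
      (fun m => Function.update m j (m j - 1)) t x := by
  obtain ⟨hs, hder⟩ := hasFDerivAt_expansion hd hα hb ht hx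
  have hxj : (x j : ℂ) ≠ 0 := by exact_mod_cast (hx j).ne'
  have hsum := fun y => (summable_expansionTerm (τ := id) (c := 0) hd hα hb
    (fun _ => le_rfl) ht y)
  have h1 := ((hs.hasSum.mapL (ContinuousLinearMap.apply ℝ ℂ (EuclideanSpace.single j (1 : ℝ)))))
  have h2 := ((hsum x).hasSum.sub (hsum (reflect j x)).hasSum).div_const (x j : ℂ)
  have h3 := (h1.add (h2.mul_left ((α j + 1 / 2 : ℝ) : ℂ))).add ((hsum x).hasSum.mul_left (x j : ℂ))
  rw [delta, dunkl, hder.hasLineDerivAt _ |>.lineDeriv]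
  refine h3.tsum_eq.symm.trans (tsum_congr fun m => ?_)
  simp only [ContinuousLinearMap.apply_apply, expansionTermFDeriv, smul_apply,
    ContinuousLinearMap.comp_apply, hermiteFDeriv_single, expansionTerm, id, hermite_reflect,
    hermite_update, smul_eq_mul, Complex.ofRealCLM_apply]
  rw [hermite_eq_mul_prod_erase α m j]
  simp only [hermiteOneDeriv]
  push_cast
  ring

lemma subExpSeq_ladder_mul (hα : ∀ i, -1 / 2 ≤ α i) {b : (Fin d → ℕ) → ℂ} (hb : SubExpSeq b)
    (j : Fin d) (k : ℕ) : SubExpSeq fun m => (ladder (α j) (m j + k) : ℂ) * b m := by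
  have h1 : SubExp (totalDegree : (Fin d → ℕ) → ℕ) (Set.univ : Set Unit) fun m _ =>
      (totalDegree m : ℝ) := SubExp.degree
  have h0 : SubExp (totalDegree : (Fin d → ℕ) → ℕ) (Set.univ : Set Unit) fun _ _ =>
      k + (2 * α j + 2) := SubExp.of_bounded ⟨_, fun _ _ _ => le_rfl⟩
  refine ((h1.add h0).mul hb).of_le fun m x _ => ?_
  rw [norm_mul, Complex.norm_real, Real.norm_eq_abs, abs_mul, abs_mul, abs_abs]
  refine mul_le_mul_of_nonneg_right ?_ (abs_nonneg _)
  rw [abs_of_nonneg (ladder_nonneg _ _)]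
  refine (ladder_le (hα j) _).trans (le_trans ?_ (le_abs_self _))
  have : (m j : ℝ) ≤ totalDegree m := by
    exact_mod_cast Finset.single_le_sum (f := m) (fun i _ => Nat.zero_le _) (Finset.mem_univ j)
  push_cast
  linarith

lemma totalDegree_lower_le (m : Fin d → ℕ) (j : Fin d) :
    totalDegree (Function.update m j (m j - 1)) ≤ totalDegree m + 1 := by
  rw [totalDegree, totalDegree, ← Finset.add_sum_erase _ _ (Finset.mem_univ j),
    ← Finset.add_sum_erase _ m (Finset.mem_univ j), Function.update_self,
    Finset.sum_congr rfl fun i hi => Function.update_of_ne (Finset.ne_of_mem_erase hi) _ _]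
  omega

lemma totalDegree_raise_le (m : Fin d → ℕ) (j : Fin d) :
    totalDegree (Function.update m j (m j + 1)) ≤ totalDegree m + 1 := by
  rw [totalDegree, totalDegree, ← Finset.add_sum_erase _ _ (Finset.mem_univ j),
    ← Finset.add_sum_erase _ m (Finset.mem_univ j), Function.update_self,
    Finset.sum_congr rfl fun i hi => Function.update_of_ne (Finset.ne_of_mem_erase hi) _ _]
  omega

/-- Since δ_j^* = 2x_j - δ_j, the three-term recurrence turns the lowering formula into the raising
one without differentiating again. -/
lemma deltaStar_expansion (hd : 1 ≤ d) (hα : ∀ i, -1 / 2 ≤ α i)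
    {b : (Fin d → ℕ) → ℂ} (hb : SubExpSeq b) {t : ℝ} (ht : 0 < t)
    {x : EuclideanSpace ℝ (Fin d)} (hx : x ∈ orthant d) (j : Fin d) :
    deltaStar α j (expansion α b id t) x =
      expansion α (fun m => (ladder (α j) (m j + 1) : ℂ) * b m)
        (fun m => Function.update m j (m j + 1)) t x := by
  have h1 : deltaStar α j (expansion α b id t) x =
      2 * (x j : ℂ) * expansion α b id t x - delta α j (expansion α b id t) x := by
    rw [deltaStar, delta]; ring
  have s0 := (summable_expansionTerm (τ := id) (c := 0) hd hα hb (fun _ => le_rfl) ht x).hasSum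
  have s1 := (summable_expansionTerm hd hα (subExpSeq_ladder_mul hα hb j 0)
    (fun m => totalDegree_lower_le m j) ht x).hasSum
  rw [h1, delta_expansion hd hα hb ht hx]
  refine ((s0.mul_left (2 * (x j : ℂ))).sub s1).tsum_eq.symm.trans (tsum_congr fun m => ?_)
  simp only [expansionTerm, id, add_zero]
  have := congrArg (fun r : ℝ => (r : ℂ)) (two_mul_mul_hermite hα m j x)
  push_cast at this
  linear_combination (b m * (Real.exp (-t * eigen α (totalDegree m)) : ℂ)) * this

lemma horizontal_eq_expansion (hd : 1 ≤ d) (hα : ∀ i, -1 / 2 ≤ α i) (ε : Fin d → ZMod 2)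
    (hf : MemLp f 2 (wPlus α)) {t : ℝ} (ht : 0 < t) {x : EuclideanSpace ℝ (Fin d)}
    (hx : x ∈ orthant d) (j : Fin d) : horizontal α ε j f t x =
      expansion α (fun m => (ladder (α j) (m j) : ℂ) * parityCoeff α ε f m)
        (fun m => Function.update m j (m j - 1)) t x := by
  rw [horizontal, semigroup_eq_expansion hd hα ε hf ht,
    delta_expansion hd hα (subExpSeq_parityCoeff hα ε hf) ht hx]

lemma horizontalStar_eq_expansion (hd : 1 ≤ d) (hα : ∀ i, -1 / 2 ≤ α i) (ε : Fin d → ZMod 2)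
    (hf : MemLp f 2 (wPlus α)) {t : ℝ} (ht : 0 < t) {x : EuclideanSpace ℝ (Fin d)}
    (hx : x ∈ orthant d) (j : Fin d) : horizontalStar α ε j f t x =
      expansion α (fun m => (ladder (α j) (m j + 1) : ℂ) * parityCoeff α ε f m)
        (fun m => Function.update m j (m j + 1)) t x := by
  rw [horizontalStar, semigroup_eq_expansion hd hα ε hf ht,
    deltaStar_expansion hd hα (subExpSeq_parityCoeff hα ε hf) ht hx]

lemma differentiableAt_semigroup (hd : 1 ≤ d) (hα : ∀ i, -1 / 2 ≤ α i) (ε : Fin d → ZMod 2)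
    (hf : MemLp f 2 (wPlus α)) {t : ℝ} (ht : 0 < t) {x : EuclideanSpace ℝ (Fin d)}
    (hx : x ∈ orthant d) : DifferentiableAt ℝ (semigroup α ε f t) x := by
  rw [semigroup_eq_expansion hd hα ε hf ht]
  exact (hasFDerivAt_expansion hd hα (subExpSeq_parityCoeff hα ε hf) ht hx).2.differentiableAt

end Semigroup

/-! ### Space-time energies. -/

/-- On the support of the coefficient sequence `b`, the index map `τ` is injective with values in a
single parity class, and it changes the degree by a bounded amount. -/
structure Admissible (b : (Fin d → ℕ) → ℂ) (τ : (Fin d → ℕ) → Fin d → ℕ) (c : ℕ) : Prop where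
  subExp : SubExpSeq b
  degree_le : ∀ m, totalDegree (τ m) ≤ totalDegree m + c
  parity : ∀ m n, b m ≠ 0 → b n ≠ 0 → ∀ i, τ m i % 2 = τ n i % 2
  inj : ∀ m n, b m ≠ 0 → b n ≠ 0 → τ m = τ n → m = n

lemma norm_hermiteLp {α : Fin d → ℝ} (hα : ∀ i, -1 / 2 ≤ α i) (m : Fin d → ℕ) :
    ‖hermiteLp hα m‖ = 1 := by
  have h := inner_hermiteLp_hermiteLp hα (m := m) (n := m) fun _ => rfl
  rw [if_pos rfl] at h
  have h2 : ‖hermiteLp hα m‖ ^ 2 = 1 := by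
    rw [← inner_self_eq_norm_sq (𝕜 := ℂ), h]
    simp
  exact (pow_eq_one_iff_of_nonneg (norm_nonneg _) two_ne_zero).mp h2

/-- Parseval's identity for expansions, at a fixed time. -/
lemma lintegral_expansion {α : Fin d → ℝ} (hd : 1 ≤ d) (hα : ∀ i, -1 / 2 ≤ α i)
    {b : (Fin d → ℕ) → ℂ} {τ : (Fin d → ℕ) → Fin d → ℕ} {c : ℕ} (hb : Admissible b τ c)
    {t : ℝ} (ht : 0 < t) :
    ∫⁻ x, ‖expansion α b τ t x‖ₑ ^ 2 ∂(wPlus α) = (2⁻¹) ^ d *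
      ∑' m, ‖b m‖ₑ ^ 2 * ENNReal.ofReal (Real.exp (-(2 * eigen α (totalDegree m)) * t)) := by
  set s : ℝ := Real.sqrt (2 ^ d) with hs
  have hs0 : 0 < s := Real.sqrt_pos.mpr (by positivity)
  have hs2 : s ^ 2 = 2 ^ d := Real.sq_sqrt (by positivity)
  -- Coefficients with respect to the normalized functions; they are absolutely summable, so the
  -- series converges in L², and its sum agrees almost everywhere with the pointwise one.
  set β : (Fin d → ℕ) → ℂ := fun m => (s : ℂ)⁻¹ *
    (b m * (Real.exp (-t * eigen α (totalDegree m)) : ℂ)) with hβ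
  set F : (Fin d → ℕ) → Lp ℂ 2 (wPlus α) := fun m => β m • hermiteLp hα (τ m) with hF
  have hnF : ∀ m, ‖F m‖ = ‖β m‖ := fun m => by rw [hF, norm_smul, norm_hermiteLp, mul_one]
  obtain ⟨B, hB, hbd⟩ := hb.subExp.exists_summable_bound hd hα ht
  have hsumβ : Summable fun m => ‖β m‖ := by
    refine Summable.of_nonneg_of_le (fun m => norm_nonneg _) (fun m => ?_) (hB.mul_left s⁻¹)
    rw [hβ, norm_mul, norm_inv, Complex.norm_real, Real.norm_of_nonneg hs0.le, norm_mul,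
      Complex.norm_real, Real.norm_of_nonneg (Real.exp_pos _).le]
    have := hbd m () trivial t le_rfl
    rw [abs_norm] at this
    gcongr
  have hsumF : Summable fun m => ‖F m‖ := by simpa only [hnF] using hsumβ
  have hsumF' : ∑' m, ‖F m‖ₑ ≠ ∞ := tsum_enorm_ne_top_iff_summable_norm.mpr hsumF
  have hae := Lp.hasSum_coeFn_tsum hsumF'
  have hFm : ∀ᵐ x ∂(wPlus α), ∀ m, F m x = expansionTerm α b τ t x m := by
    rw [ae_all_iff]
    intro m
    have h1 := Lp.coeFn_smul (β m) (hermiteLp hα (τ m))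
    have h2 := Lp.coeFn_smul ((Real.sqrt (2 ^ d) : ℝ) : ℂ) (memLp_hermite_ofReal hα (τ m)).toLp
    filter_upwards [h1, h2, (memLp_hermite_ofReal hα (τ m)).coeFn_toLp] with x h1 h2 h3
    rw [hF, h1, Pi.smul_apply, hermiteLp, h2, Pi.smul_apply, h3, smul_eq_mul, smul_eq_mul,
      expansionTerm, hβ, ← hs]
    have : (s : ℂ) ≠ 0 := by exact_mod_cast hs0.ne'
    field_simp
  have hexp : (∑' m, F m : Lp ℂ 2 (wPlus α)) =ᵐ[wPlus α] expansion α b τ t := by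
    filter_upwards [hae, hFm] with x h1 h2
    rw [expansion, ← h1.tsum_eq]
    exact tsum_congr h2
  set S : Lp ℂ 2 (wPlus α) := ∑' m, F m with hS
  have hSsum : HasSum F S := (Summable.of_norm hsumF).hasSum
  have hin : ∀ m, inner ℂ (F m) S = ((‖β m‖ ^ 2 : ℝ) : ℂ) := by
    intro m
    have h1 := hSsum.mapL (innerSL ℂ (F m))
    refine h1.unique ?_
    -- Either a coefficient vanishes, or both indices lie in the support of b, where τ is injective
    -- with values in one parity class.
    have h2 : ∀ n, n ≠ m → innerSL ℂ (F m) (F n) = 0 := by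
      intro n hn
      rw [innerSL_apply_apply]
      by_cases hm0 : b m = 0
      · simp [hF, hβ, hm0]
      by_cases hn0 : b n = 0
      · simp [hF, hβ, hn0]
      rw [hF, inner_smul_left, inner_smul_right,
        inner_hermiteLp_hermiteLp hα (hb.parity n m hn0 hm0),
        if_neg fun h => hn (hb.inj n m hn0 hm0 h)]
      simp
    have h3 := hasSum_single m h2
    have h4 : innerSL ℂ (F m) (F m) = ((‖β m‖ ^ 2 : ℝ) : ℂ) := by
      rw [innerSL_apply_apply, inner_self_eq_norm_sq_to_K, hnF]
      push_cast
      rfl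
    rw [← h4]
    exact h3
  have hnorm : HasSum (fun m => ‖β m‖ ^ 2) (‖S‖ ^ 2) := by
    have h1 := hSsum.mapL (innerSL ℂ S)
    have h2 := Complex.hasSum_re h1
    simp only [innerSL_apply_apply] at h2
    rw [← RCLike.re_eq_complex_re, inner_self_eq_norm_sq] at h2
    convert h2 using 2 with m
    rw [← inner_conj_symm, hin m, Complex.conj_ofReal]
    rfl
  have hS2 : ∫⁻ x, ‖expansion α b τ t x‖ₑ ^ 2 ∂(wPlus α) = ENNReal.ofReal (‖S‖ ^ 2) := by
    rw [ENNReal.ofReal_pow (norm_nonneg _), ofReal_norm, Lp.enorm_def,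
      eLpNorm_eq_lintegral_rpow_enorm_toReal two_ne_zero ENNReal.ofNat_ne_top]
    rw [← ENNReal.rpow_natCast, ← ENNReal.rpow_mul]
    norm_num
    exact lintegral_congr_ae (hexp.mono fun x hx => by simp only [hx])
  rw [hS2, ← hnorm.tsum_eq, ENNReal.ofReal_tsum_of_nonneg (fun m => by positivity) hnorm.summable,
    ← ENNReal.tsum_mul_left]
  refine tsum_congr fun m => ?_
  rw [hβ]
  simp only
  rw [norm_mul, norm_mul, norm_inv, Complex.norm_real, Complex.norm_real,
    Real.norm_of_nonneg hs0.le, Real.norm_of_nonneg (Real.exp_pos _).le, mul_pow, mul_pow, inv_pow,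
    hs2, ← inv_pow, ENNReal.ofReal_mul (by positivity), ENNReal.ofReal_mul (by positivity),
    ENNReal.ofReal_pow (by positivity), ENNReal.ofReal_pow (norm_nonneg _), ofReal_norm,
    ENNReal.ofReal_inv_of_pos two_pos, ← Real.exp_nat_mul]
  congr 2
  · norm_num
  · rw [show ((2 : ℕ) : ℝ) * (-t * eigen α (totalDegree m)) =
      -(2 * eigen α (totalDegree m)) * t by push_cast; ring]

/-- The family `u` is given on `(0,∞) × ℝ^d_+` by the expansion with coefficients `b` and index
map `τ`. -/
def HasExpansion (α : Fin d → ℝ) (b : (Fin d → ℕ) → ℂ) (τ : (Fin d → ℕ) → Fin d → ℕ)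
    (u : ℝ → EuclideanSpace ℝ (Fin d) → ℂ) : Prop :=
  ∀ t, 0 < t → ∀ x ∈ orthant d, u t x = expansion α b τ t x

/-- The weighted space-time energy `∫_0^∞ ρ(t) ‖u_t‖² dt`. -/
noncomputable def energy (α : Fin d → ℝ) (ρ : ℝ → ℝ≥0∞)
    (u : ℝ → EuclideanSpace ℝ (Fin d) → ℂ) : ℝ≥0∞ :=
  ∫⁻ t in Set.Ioi (0 : ℝ), ρ t * ∫⁻ x, ‖u t x‖ₑ ^ 2 ∂(wPlus α)

lemma lintegral_exp_neg_mul {l : ℝ} (hl : 0 < l) :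
    ∫⁻ t in Set.Ioi (0 : ℝ), ENNReal.ofReal (Real.exp (-l * t)) = ENNReal.ofReal (1 / l) := by
  have h := integral_exp_mul_Ioi (a := -l) (by linarith) 0
  have hi := integrableOn_exp_mul_Ioi (a := -l) (by linarith) 0
  rw [← ofReal_integral_eq_lintegral_ofReal hi (ae_of_all _ fun t => (Real.exp_pos _).le), h]
  simp

lemma lintegral_mul_exp_neg_mul {l : ℝ} (hl : 0 < l) :
    ∫⁻ t in Set.Ioi (0 : ℝ), ENNReal.ofReal t * ENNReal.ofReal (Real.exp (-l * t)) =
      ENNReal.ofReal (1 / l ^ 2) := by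
  have h := Real.integral_rpow_mul_exp_neg_mul_Ioi (a := 2) (r := l) two_pos hl
  have h2 : ∫ t in Set.Ioi (0 : ℝ), t * Real.exp (-l * t) = 1 / l ^ 2 := by
    rw [Real.Gamma_two, mul_one, Real.rpow_two, one_div, inv_pow, ← one_div] at h
    rw [← h]
    refine setIntegral_congr_fun measurableSet_Ioi fun t _ => ?_
    norm_num
  have hi : IntegrableOn (fun t : ℝ => t * Real.exp (-l * t)) (Set.Ioi 0) := by
    refine .of_integral_ne_zero ?_
    rw [h2]
    positivity
  rw [← h2, ofReal_integral_eq_lintegral_ofReal hi]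
  · refine setLIntegral_congr_fun measurableSet_Ioi fun t ht => ?_
    rw [ENNReal.ofReal_mul (le_of_lt ht)]
  · filter_upwards [ae_restrict_mem measurableSet_Ioi] with t ht
    have : (0 : ℝ) < t := ht
    positivity

/-- All terms are nonnegative, so Tonelli exchanges sum and time integral. The energy is diagonal in
the coefficients, with the Laplace transform of ρ at 2λ as weight. -/
lemma energy_eq_tsum {α : Fin d → ℝ} (hd : 1 ≤ d) (hα : ∀ i, -1 / 2 ≤ α i) {ρ : ℝ → ℝ≥0∞}
    (hρ : Measurable ρ) {b : (Fin d → ℕ) → ℂ} {τ : (Fin d → ℕ) → Fin d → ℕ} {c : ℕ}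
    (hb : Admissible b τ c) {u : ℝ → EuclideanSpace ℝ (Fin d) → ℂ} (hu : HasExpansion α b τ u) :
    energy α ρ u = (2⁻¹) ^ d * ∑' m, ‖b m‖ₑ ^ 2 * ∫⁻ t in Set.Ioi (0 : ℝ),
      ρ t * ENNReal.ofReal (Real.exp (-(2 * eigen α (totalDegree m)) * t)) := by
  have h1 : energy α ρ u = ∫⁻ t in Set.Ioi (0 : ℝ), ∑' m, (2⁻¹) ^ d * ‖b m‖ₑ ^ 2 *
      (ρ t * ENNReal.ofReal (Real.exp (-(2 * eigen α (totalDegree m)) * t))) := by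
    refine setLIntegral_congr_fun measurableSet_Ioi fun t ht => ?_
    have h2 : ∫⁻ x, ‖u t x‖ₑ ^ 2 ∂(wPlus α) = ∫⁻ x, ‖expansion α b τ t x‖ₑ ^ 2 ∂(wPlus α) :=
      lintegral_congr_ae ((ae_mem_orthant α).mono fun x hx => by simp only [hu t ht x hx])
    rw [h2, lintegral_expansion hd hα hb ht, ← ENNReal.tsum_mul_left, ← ENNReal.tsum_mul_left]
    refine tsum_congr fun m => ?_
    ring
  rw [h1, lintegral_tsum fun m => by fun_prop, ← ENNReal.tsum_mul_left]
  refine tsum_congr fun m => ?_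
  rw [lintegral_const_mul _ (by fun_prop), mul_assoc]

lemma measurable_expansion_left (α : Fin d → ℝ) (b : (Fin d → ℕ) → ℂ)
    (τ : (Fin d → ℕ) → Fin d → ℕ) (t : ℝ) : Measurable (expansion α b τ t) := by
  have h := (measurable_expansion α b τ).comp (measurable_prodMk_right (y := t))
  rw [Function.comp_def] at h
  exact h

lemma eLpNorm_two_sq {X : Type*} [MeasurableSpace X] {F : Type*} [TopologicalSpace F]
    [ContinuousENorm F] (μ : Measure X) (g : X → F) :
    eLpNorm g 2 μ ^ 2 = ∫⁻ x, ‖g x‖ₑ ^ 2 ∂μ := by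
  rw [eLpNorm_eq_lintegral_rpow_enorm_toReal two_ne_zero ENNReal.ofNat_ne_top,
    ← ENNReal.rpow_natCast, ← ENNReal.rpow_mul]
  norm_num

/-- The squared `L²((0,∞), ρ dt)`-norm of `u_t(x)`. -/
noncomputable def timeSq (ρ : ℝ → ℝ≥0∞) (u : ℝ → EuclideanSpace ℝ (Fin d) → ℂ)
    (x : EuclideanSpace ℝ (Fin d)) : ℝ≥0∞ :=
  ∫⁻ t in Set.Ioi (0 : ℝ), ρ t * ‖u t x‖ₑ ^ 2

/-- The family is controlled only for t > 0 and x in the orthant; there it agrees with a jointly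
measurable expansion, hence measurability up to a null set. -/
lemma HasExpansion.aemeasurable_timeSq {α : Fin d → ℝ} {ρ : ℝ → ℝ≥0∞} (hρ : Measurable ρ)
    {b : (Fin d → ℕ) → ℂ} {τ : (Fin d → ℕ) → Fin d → ℕ}
    {u : ℝ → EuclideanSpace ℝ (Fin d) → ℂ} (hu : HasExpansion α b τ u) :
    AEMeasurable (timeSq ρ u) (wPlus α) := by
  have hm := measurable_expansion α b τ
  have h2 : Measurable fun p : EuclideanSpace ℝ (Fin d) × ℝ =>
    ρ p.2 * ‖expansion α b τ p.2 p.1‖ₑ ^ 2 := by fun_prop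
  refine ⟨fun x => ∫⁻ t in Set.Ioi (0 : ℝ), ρ t * ‖expansion α b τ t x‖ₑ ^ 2,
    h2.lintegral_prod_right', ?_⟩
  filter_upwards [ae_mem_orthant α] with x hx
  refine setLIntegral_congr_fun measurableSet_Ioi fun t ht => ?_
  simp only [hu t ht x hx]

lemma HasExpansion.lintegral_timeSq {α : Fin d → ℝ} {ρ : ℝ → ℝ≥0∞} (hρ : Measurable ρ)
    {b : (Fin d → ℕ) → ℂ} {τ : (Fin d → ℕ) → Fin d → ℕ}
    {u : ℝ → EuclideanSpace ℝ (Fin d) → ℂ} (hu : HasExpansion α b τ u) :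
    ∫⁻ x, timeSq ρ u x ∂(wPlus α) = energy α ρ u := by
  have hm := measurable_expansion α b τ
  have h2 : Measurable fun p : EuclideanSpace ℝ (Fin d) × ℝ =>
    ρ p.2 * ‖expansion α b τ p.2 p.1‖ₑ ^ 2 := by fun_prop
  have h1 : ∫⁻ x, timeSq ρ u x ∂(wPlus α) =
      ∫⁻ x, (∫⁻ t in Set.Ioi (0 : ℝ), ρ t * ‖expansion α b τ t x‖ₑ ^ 2) ∂(wPlus α) := by
    refine lintegral_congr_ae ?_
    filter_upwards [ae_mem_orthant α] with x hx
    refine setLIntegral_congr_fun measurableSet_Ioi fun t ht => ?_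
    simp only [hu t ht x hx]
  rw [h1, lintegral_lintegral_swap h2.aemeasurable]
  refine setLIntegral_congr_fun measurableSet_Ioi fun t ht => ?_
  have h3 : ∫⁻ x, ‖u t x‖ₑ ^ 2 ∂(wPlus α) = ∫⁻ x, ‖expansion α b τ t x‖ₑ ^ 2 ∂(wPlus α) :=
    lintegral_congr_ae ((ae_mem_orthant α).mono fun x hx => by simp only [hu t ht x hx])
  have h4 := measurable_expansion_left α b τ t
  rw [h3, ← lintegral_const_mul _ (by fun_prop)]

lemma eLpNorm_measDt_sq (u : ℝ → EuclideanSpace ℝ (Fin d) → ℂ) (x : EuclideanSpace ℝ (Fin d)) :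
    eLpNorm (fun t => u t x) 2 measDt ^ 2 = timeSq 1 u x := by
  rw [eLpNorm_two_sq, measDt, timeSq]
  simp

lemma eLpNorm_measTdt_sq (u : ℝ → EuclideanSpace ℝ (Fin d) → ℂ) (x : EuclideanSpace ℝ (Fin d)) :
    eLpNorm (fun t => u t x) 2 measTdt ^ 2 = timeSq ENNReal.ofReal u x := by
  rw [eLpNorm_two_sq, measTdt, timeSq,
    lintegral_withDensity_eq_lintegral_mul_non_measurable _ (by fun_prop)
      (ae_of_all _ fun t => ENNReal.ofReal_lt_top)]
  rfl

/-! ### Admissibility, and bounds for the multipliers. -/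

section Coefficients

variable {α : Fin d → ℝ} {ε : Fin d → ZMod 2} {f : EuclideanSpace ℝ (Fin d) → ℂ}

lemma mem_parityClass_of_mul_ne_zero {z : ℂ} {m : Fin d → ℕ} (h : z * parityCoeff α ε f m ≠ 0) :
    m ∈ parityClass ε :=
  Set.mem_of_indicator_ne_zero (right_ne_zero_of_mul h)

lemma admissible_vertical (hα : ∀ i, -1 / 2 ≤ α i) (hf : MemLp f 2 (wPlus α)) :
    Admissible (fun m => -(eigen α (totalDegree m) : ℂ) * parityCoeff α ε f m) id 0 where
  subExp := subExpSeq_eigen_mul (subExpSeq_parityCoeff hα ε hf)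
  degree_le _ := le_rfl
  parity _ _ hm hn := mod_two_eq_of_mem_parityClass (mem_parityClass_of_mul_ne_zero hm)
    (mem_parityClass_of_mul_ne_zero hn)
  inj _ _ _ _ h := h

/-- Lowering fails to be injective only through truncation at m_j = 0, and there the ladder
coefficient vanishes, so such m are outside the support. -/
lemma admissible_horizontal (hα : ∀ i, -1 / 2 ≤ α i) (hf : MemLp f 2 (wPlus α)) (j : Fin d) :
    Admissible (fun m => (ladder (α j) (m j) : ℂ) * parityCoeff α ε f m)
      (fun m => Function.update m j (m j - 1)) 1 where
  subExp := subExpSeq_ladder_mul hα (subExpSeq_parityCoeff hα ε hf) j 0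
  degree_le m := totalDegree_lower_le m j
  parity m n hm hn i := by
    have h := mod_two_eq_of_mem_parityClass (mem_parityClass_of_mul_ne_zero hm)
      (mem_parityClass_of_mul_ne_zero hn)
    have hm0 : m j ≠ 0 := fun h0 => hm (by simp [h0, ladder_zero])
    have hn0 : n j ≠ 0 := fun h0 => hn (by simp [h0, ladder_zero])
    rcases eq_or_ne i j with rfl | hij
    · have := h i
      rw [Function.update_self, Function.update_self]
      omega
    · rw [Function.update_of_ne hij, Function.update_of_ne hij, h i]
  inj m n hm hn h := by
    have hm0 : m j ≠ 0 := fun h0 => hm (by simp [h0, ladder_zero])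
    have hn0 : n j ≠ 0 := fun h0 => hn (by simp [h0, ladder_zero])
    funext i
    have h1 := congrFun h i
    rcases eq_or_ne i j with rfl | hij
    · rw [Function.update_self, Function.update_self] at h1
      omega
    · rwa [Function.update_of_ne hij, Function.update_of_ne hij] at h1

lemma admissible_horizontalStar (hα : ∀ i, -1 / 2 ≤ α i) (hf : MemLp f 2 (wPlus α)) (j : Fin d) :
    Admissible (fun m => (ladder (α j) (m j + 1) : ℂ) * parityCoeff α ε f m)
      (fun m => Function.update m j (m j + 1)) 1 where
  subExp := subExpSeq_ladder_mul hα (subExpSeq_parityCoeff hα ε hf) j 1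
  degree_le m := totalDegree_raise_le m j
  parity m n hm hn i := by
    have h := mod_two_eq_of_mem_parityClass (mem_parityClass_of_mul_ne_zero hm)
      (mem_parityClass_of_mul_ne_zero hn)
    rcases eq_or_ne i j with rfl | hij
    · have := h i
      rw [Function.update_self, Function.update_self]
      omega
    · rw [Function.update_of_ne hij, Function.update_of_ne hij, h i]
  inj m n _ _ h := by
    funext i
    have h1 := congrFun h i
    rcases eq_or_ne i j with rfl | hij
    · rw [Function.update_self, Function.update_self] at h1
      omega
    · rwa [Function.update_of_ne hij, Function.update_of_ne hij] at h1

lemma hasExpansion_vertical (hd : 1 ≤ d) (hα : ∀ i, -1 / 2 ≤ α i) (hf : MemLp f 2 (wPlus α)) :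
    HasExpansion α (fun m => -(eigen α (totalDegree m) : ℂ) * parityCoeff α ε f m) id
      (vertical α ε f) :=
  fun _ ht x _ => vertical_eq_expansion hd hα ε hf ht x

lemma hasExpansion_horizontal (hd : 1 ≤ d) (hα : ∀ i, -1 / 2 ≤ α i) (hf : MemLp f 2 (wPlus α))
    (j : Fin d) : HasExpansion α (fun m => (ladder (α j) (m j) : ℂ) * parityCoeff α ε f m)
      (fun m => Function.update m j (m j - 1)) (horizontal α ε j f) :=
  fun _ ht _ hx => horizontal_eq_expansion hd hα ε hf ht hx j

lemma hasExpansion_horizontalStar (hd : 1 ≤ d) (hα : ∀ i, -1 / 2 ≤ α i)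
    (hf : MemLp f 2 (wPlus α)) (j : Fin d) :
    HasExpansion α (fun m => (ladder (α j) (m j + 1) : ℂ) * parityCoeff α ε f m)
      (fun m => Function.update m j (m j + 1)) (horizontalStar α ε j f) :=
  fun _ ht _ hx => horizontalStar_eq_expansion hd hα ε hf ht hx j

/-- The multiplier λ² ∫ t e^{-2λt} dt equals 1/4 for every m. The squared constant collects 2^{-2}
from this, 2^{-d} from the norms of the h_m and 2^{-d} from Parseval's identity for f. -/
lemma energy_vertical (hd : 1 ≤ d) (hα : ∀ i, -1 / 2 ≤ α i) (hf : MemLp f 2 (wPlus α)) :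
    energy α ENNReal.ofReal (vertical α ε f) =
      ((2⁻¹ : ℝ≥0∞) ^ (d + 1) * eLpNorm f 2 (wPlus α)) ^ 2 := by
  rw [energy_eq_tsum hd hα ENNReal.measurable_ofReal (admissible_vertical hα hf)
    (hasExpansion_vertical hd hα hf)]
  have h : ∀ m, ‖-(eigen α (totalDegree m) : ℂ) * parityCoeff α ε f m‖ₑ ^ 2 *
      ∫⁻ t in Set.Ioi (0 : ℝ), ENNReal.ofReal t *
        ENNReal.ofReal (Real.exp (-(2 * eigen α (totalDegree m)) * t)) =
      (2⁻¹) ^ 2 * ‖parityCoeff α ε f m‖ₑ ^ 2 := by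
    intro m
    have he := eigen_pos hd hα (totalDegree m)
    rw [lintegral_mul_exp_neg_mul (by positivity), enorm_mul, mul_pow, mul_right_comm]
    congr 1
    rw [enorm_neg, ← ofReal_norm, Complex.norm_real, Real.norm_of_nonneg he.le,
      ← ENNReal.ofReal_pow he.le, ← ENNReal.ofReal_mul (by positivity),
      show eigen α (totalDegree m) ^ 2 * (1 / (2 * eigen α (totalDegree m)) ^ 2) = (2⁻¹) ^ 2 by
        field_simp,
      ENNReal.ofReal_pow (by positivity), ENNReal.ofReal_inv_of_pos two_pos]
    norm_num
  rw [tsum_congr h, ENNReal.tsum_mul_left, tsum_parityCoeff hα ε hf]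
  ring

/-- The energy of the horizontal derivatives, written as a sum over the Hermite coefficients. -/
lemma energy_ladder (hd : 1 ≤ d) (hα : ∀ i, -1 / 2 ≤ α i) {g : (Fin d → ℕ) → ℝ}
    (hg : ∀ m, 0 ≤ g m) {τ : (Fin d → ℕ) → Fin d → ℕ} {c : ℕ}
    {u : ℝ → EuclideanSpace ℝ (Fin d) → ℂ}
    (hb : Admissible (fun m => (g m : ℂ) * parityCoeff α ε f m) τ c)
    (hu : HasExpansion α (fun m => (g m : ℂ) * parityCoeff α ε f m) τ u) :
    energy α 1 u = (2⁻¹) ^ d * ∑' m,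
      ENNReal.ofReal (g m ^ 2 / (2 * eigen α (totalDegree m))) * ‖parityCoeff α ε f m‖ₑ ^ 2 := by
  rw [energy_eq_tsum hd hα measurable_one hb hu]
  congr 1
  refine tsum_congr fun m => ?_
  have he := eigen_pos hd hα (totalDegree m)
  simp only [Pi.one_apply, one_mul]
  rw [lintegral_exp_neg_mul (by positivity), enorm_mul, mul_pow, mul_right_comm]
  congr 1
  rw [← ofReal_norm, Complex.norm_real, Real.norm_of_nonneg (hg m), ← ENNReal.ofReal_pow (hg m),
    ← ENNReal.ofReal_mul (by have := hg m; positivity), mul_one_div]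

/-- Two-sided bounds for sums of horizontal energies from bounds on the multipliers. -/
lemma le_sum_energy_ladder (hd : 1 ≤ d) (hα : ∀ i, -1 / 2 ≤ α i) (hf : MemLp f 2 (wPlus α))
    {g : Fin d → (Fin d → ℕ) → ℝ} (hg : ∀ j m, 0 ≤ g j m)
    {τ : Fin d → (Fin d → ℕ) → Fin d → ℕ} {c : ℕ}
    {u : Fin d → ℝ → EuclideanSpace ℝ (Fin d) → ℂ}
    (hb : ∀ j, Admissible (fun m => (g j m : ℂ) * parityCoeff α ε f m) (τ j) c)
    (hu : ∀ j, HasExpansion α (fun m => (g j m : ℂ) * parityCoeff α ε f m) (τ j) (u j))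
    {k : ℝ} (hk : ∀ m, parityCoeff α ε f m ≠ 0 →
      k * eigen α (totalDegree m) ≤ ∑ j, g j m ^ 2) :
    ENNReal.ofReal (k / 2) * ((2⁻¹) ^ d * eLpNorm f 2 (wPlus α)) ^ 2 ≤
      ∑ j, energy α 1 (u j) := by
  rw [Finset.sum_congr rfl fun j _ => energy_ladder hd hα (hg j) (hb j) (hu j),
    ← Finset.mul_sum, ← Summable.tsum_finsetSum fun _ _ => ENNReal.summable,
    show ENNReal.ofReal (k / 2) * ((2⁻¹) ^ d * eLpNorm f 2 (wPlus α)) ^ 2 =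
      (2⁻¹) ^ d * (ENNReal.ofReal (k / 2) * ((2⁻¹) ^ d * eLpNorm f 2 (wPlus α) ^ 2)) by ring,
    ← tsum_parityCoeff hα ε hf, ← ENNReal.tsum_mul_left]
  gcongr with m
  rw [← Finset.sum_mul]
  -- Only indices with nonzero coefficient need the multiplier bound; this is how m = 0 gets
  -- excluded for the lowering operators.
  by_cases hm : parityCoeff α ε f m = 0
  · simp [hm]
  have he := eigen_pos hd hα (totalDegree m)
  gcongr
  rw [← ENNReal.ofReal_sum_of_nonneg fun j _ => by positivity, ← Finset.sum_div]
  refine ENNReal.ofReal_le_ofReal ?_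
  rw [div_le_div_iff₀ two_pos (by positivity)]
  nlinarith [hk m hm]

lemma energy_ladder_le (hd : 1 ≤ d) (hα : ∀ i, -1 / 2 ≤ α i) (hf : MemLp f 2 (wPlus α))
    {g : (Fin d → ℕ) → ℝ} (hg : ∀ m, 0 ≤ g m) {τ : (Fin d → ℕ) → Fin d → ℕ} {c : ℕ}
    {u : ℝ → EuclideanSpace ℝ (Fin d) → ℂ}
    (hb : Admissible (fun m => (g m : ℂ) * parityCoeff α ε f m) τ c)
    (hu : HasExpansion α (fun m => (g m : ℂ) * parityCoeff α ε f m) τ u)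
    {k : ℝ} (hk : ∀ m, g m ^ 2 ≤ k * eigen α (totalDegree m)) :
    energy α 1 u ≤ ENNReal.ofReal (k / 2) * ((2⁻¹) ^ d * eLpNorm f 2 (wPlus α)) ^ 2 := by
  rw [energy_ladder hd hα hg hb hu,
    show ENNReal.ofReal (k / 2) * ((2⁻¹) ^ d * eLpNorm f 2 (wPlus α)) ^ 2 =
      (2⁻¹) ^ d * (ENNReal.ofReal (k / 2) * ((2⁻¹) ^ d * eLpNorm f 2 (wPlus α) ^ 2)) by ring,
    ← tsum_parityCoeff hα ε hf, ← ENNReal.tsum_mul_left (a := ENNReal.ofReal (k / 2))]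
  refine mul_le_mul_right (ENNReal.tsum_le_tsum fun m => mul_le_mul_left
    (ENNReal.ofReal_le_ofReal ?_) _) _
  have he := eigen_pos hd hα (totalDegree m)
  rw [div_le_div_iff₀ (by positivity) two_pos]
  nlinarith [hk m]

/-- The eigenvalue is a sum over coordinates of the terms 2m_i + 2α_i + 2, all at least 1, so it
dominates any one of them. -/
lemma two_mul_le_eigen_sub (hα : ∀ i, -1 / 2 ≤ α i) (m : Fin d → ℕ) (j : Fin d) :
    2 * (m j : ℝ) + (2 * α j + 1) ≤ eigen α (totalDegree m) := by
  have h1 : eigen α (totalDegree m) = ∑ i, (2 * (m i : ℝ) + 2 * α i + 2) := by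
    rw [eigen, totalDegree, Finset.sum_add_distrib, Finset.sum_add_distrib, ← Finset.mul_sum,
      ← Finset.mul_sum]
    push_cast
    simp
    ring
  rw [h1]
  have h2 : 2 * (m j : ℝ) + 2 * α j + 2 ≤ ∑ i, (2 * (m i : ℝ) + 2 * α i + 2) :=
    Finset.single_le_sum (f := fun i => 2 * (m i : ℝ) + 2 * α i + 2)
      (fun i _ => by have := hα i; have : (0 : ℝ) ≤ m i := (m i).cast_nonneg; linarith)
      (Finset.mem_univ j)
  linarith

lemma ladder_sq_le_eigen (hα : ∀ i, -1 / 2 ≤ α i) (m : Fin d → ℕ) (j : Fin d) :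
    ladder (α j) (m j) ^ 2 ≤ 2 * eigen α (totalDegree m) := by
  have h1 := ladder_sq_le (hα j) (m j)
  have h2 := two_mul_le_eigen_sub hα m j
  have h3 : (0 : ℝ) ≤ m j := (m j).cast_nonneg
  linarith

lemma exists_ladder_succ_sq_le_eigen (hd : 1 ≤ d) (hα : ∀ i, -1 / 2 ≤ α i) :
    ∃ k, 0 ≤ k ∧ ∀ (m : Fin d → ℕ) (j : Fin d),
      ladder (α j) (m j + 1) ^ 2 ≤ k * eigen α (totalDegree m) := by
  have h0 := eigen_pos hd hα 0
  -- The summand 2 serves as for the lowering coefficients. The shift from m_j to m_j + 1 adds 2,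
  -- absorbed by 2/λ_0 because λ_0 is the smallest eigenvalue.
  refine ⟨2 + 2 / eigen α 0, by positivity, fun m j => ?_⟩
  have h1 := ladder_sq_le (hα j) (m j + 1)
  have h2 := two_mul_le_eigen_sub hα m j
  have h3 : (0 : ℝ) ≤ m j := (m j).cast_nonneg
  have h4 : eigen α 0 ≤ eigen α (totalDegree m) := by
    simp [eigen]
  have h5 : 2 ≤ 2 / eigen α 0 * eigen α (totalDegree m) := by
    rw [div_mul_eq_mul_div, le_div_iff₀ h0]
    linarith
  push_cast at h1
  linarith

/-- With λ = 2|m| + e, the quotient 2n/(2n+e) is at least its value at n = 1, which gives k =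
2/(2+e). Raising uses n = |m| + d, always at least 1; lowering uses n = |m|, at least 1 unless m =
0. -/
lemma exists_eigen_le_sum (hd : 1 ≤ d) (hα : ∀ i, -1 / 2 ≤ α i) :
    ∃ k, 0 < k ∧ (∀ m : Fin d → ℕ,
      k * eigen α (totalDegree m) ≤ ∑ j, ladder (α j) (m j + 1) ^ 2) ∧
      ∀ m : Fin d → ℕ, m ≠ 0 → k * eigen α (totalDegree m) ≤ ∑ j, ladder (α j) (m j) ^ 2 := by
  have h0 := eigen_pos hd hα 0
  set e := eigen α 0 with he
  have hE : ∀ m : Fin d → ℕ, eigen α (totalDegree m) = 2 * totalDegree m + e := fun m => by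
    rw [he, eigen, eigen]; push_cast; ring
  have hk : ∀ n : ℝ, 1 ≤ n → 2 / (2 + e) * (2 * n + e) ≤ 2 * n := fun n hn => by
    rw [div_mul_eq_mul_div, div_le_iff₀ (by linarith)]
    nlinarith
  have hcast : ∀ m : Fin d → ℕ, (totalDegree m : ℝ) = ∑ j, (m j : ℝ) := fun m => by
    rw [totalDegree]; push_cast; rfl
  refine ⟨2 / (2 + e), by positivity, fun m => ?_, fun m hm => ?_⟩
  · have h1 : 2 * (∑ j, (m j : ℝ) + d) ≤ ∑ j, ladder (α j) (m j + 1) ^ 2 := by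
      calc 2 * (∑ j, (m j : ℝ) + d) = ∑ j, 2 * ((m j + 1 : ℕ) : ℝ) := by
            push_cast
            rw [← Finset.mul_sum, Finset.sum_add_distrib]
            simp
        _ ≤ _ := Finset.sum_le_sum fun j _ => two_mul_le_ladder_sq (hα j) _
    have h2 : (1 : ℝ) ≤ d := by exact_mod_cast hd
    have h3 : (0 : ℝ) ≤ totalDegree m := Nat.cast_nonneg _
    have h4 := hk (totalDegree m + d) (by linarith)
    rw [hE, ← hcast] at *
    refine le_trans ?_ (h4.trans h1)
    gcongr
    linarith
  · have h1 : 2 * ∑ j, (m j : ℝ) ≤ ∑ j, ladder (α j) (m j) ^ 2 := by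
      rw [Finset.mul_sum]
      exact Finset.sum_le_sum fun j _ => two_mul_le_ladder_sq (hα j) _
    have h2 : totalDegree m ≠ 0 := fun h => hm (by
      funext i
      rw [totalDegree, Finset.sum_eq_zero_iff] at h
      exact h i (Finset.mem_univ i))
    have h3 : (1 : ℝ) ≤ totalDegree m := by exact_mod_cast Nat.one_le_iff_ne_zero.mpr h2
    rw [hE]
    rw [← hcast] at h1
    exact (hk _ h3).trans h1

end Coefficients

/-! ### Volumes of cubes and doubling. -/

/-- With the next lemma, V_r(x) is comparable with r(x+r)^{2a+1} uniformly in x > 0. As 2a + 1 ≥ 0,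
the weight is largest at the right end. -/
lemma wPlusOne_Ioo_le {a : ℝ} (ha : -1 / 2 ≤ a) {r x : ℝ} (hr : 0 < r) (hx : 0 < x) :
    wPlusOne a (Set.Ioo (x - r) (x + r)) ≤ ENNReal.ofReal (2 * r * (x + r) ^ (2 * a + 1)) := by
  rw [wPlusOne, withDensity_apply _ measurableSet_Ioo, Measure.restrict_restrict measurableSet_Ioo]
  calc ∫⁻ y in Set.Ioo (x - r) (x + r) ∩ Set.Ioi 0, ENNReal.ofReal (y ^ (2 * a + 1))
      ≤ ∫⁻ y in Set.Ioo (x - r) (x + r) ∩ Set.Ioi 0, ENNReal.ofReal ((x + r) ^ (2 * a + 1)) := by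
        refine setLIntegral_mono' (measurableSet_Ioo.inter measurableSet_Ioi) fun y hy => ?_
        exact ENNReal.ofReal_le_ofReal
          (Real.rpow_le_rpow (le_of_lt hy.2) hy.1.2.le (by linarith))
    _ ≤ ∫⁻ y in Set.Ioo (x - r) (x + r), ENNReal.ofReal ((x + r) ^ (2 * a + 1)) :=
        lintegral_mono_set Set.inter_subset_left
    _ = _ := by
        rw [setLIntegral_const, Real.volume_Ioo, ← ENNReal.ofReal_mul (by positivity)]
        congr 1
        ring

/-- The right quarter of the interval lies in (0,∞), and the weight there is at least its value at x
+ r/2. -/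
lemma le_wPlusOne_Ioo {a : ℝ} (ha : -1 / 2 ≤ a) {r x : ℝ} (hr : 0 < r) (hx : 0 < x) :
    ENNReal.ofReal (r / 2 * (x + r / 2) ^ (2 * a + 1)) ≤ wPlusOne a (Set.Ioo (x - r) (x + r)) := by
  rw [wPlusOne, withDensity_apply _ measurableSet_Ioo, Measure.restrict_restrict measurableSet_Ioo]
  calc ENNReal.ofReal (r / 2 * (x + r / 2) ^ (2 * a + 1))
      = ∫⁻ y in Set.Ioo (x + r / 2) (x + r), ENNReal.ofReal ((x + r / 2) ^ (2 * a + 1)) := by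
        rw [setLIntegral_const, Real.volume_Ioo, ← ENNReal.ofReal_mul (by positivity)]
        congr 1
        ring
    _ ≤ ∫⁻ y in Set.Ioo (x + r / 2) (x + r), ENNReal.ofReal (y ^ (2 * a + 1)) := by
        refine setLIntegral_mono' measurableSet_Ioo fun y hy => ?_
        exact ENNReal.ofReal_le_ofReal
          (Real.rpow_le_rpow (by positivity) hy.1.le (by linarith))
    _ ≤ _ := by
        refine lintegral_mono_set fun y hy => ?_
        have h1 := hy.1
        exact ⟨⟨by linarith, hy.2⟩, Set.mem_Ioi.mpr (by linarith)⟩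

lemma ofReal_volOne {a : ℝ} (ha : -1 / 2 ≤ a) {r x : ℝ} (hr : 0 < r) (hx : 0 < x) :
    ENNReal.ofReal (volOne a r x) = wPlusOne a (Set.Ioo (x - r) (x + r)) :=
  ENNReal.ofReal_toReal ((wPlusOne_Ioo_le ha hr hx).trans_lt ENNReal.ofReal_lt_top).ne

lemma volOne_le {a : ℝ} (ha : -1 / 2 ≤ a) {r x : ℝ} (hr : 0 < r) (hx : 0 < x) :
    volOne a r x ≤ 2 * (r * (x + r) ^ (2 * a + 1)) := by
  have h := wPlusOne_Ioo_le ha hr hx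
  rw [← ofReal_volOne ha hr hx, ENNReal.ofReal_le_ofReal_iff (by positivity)] at h
  linarith

lemma volOne_nonneg (a r x : ℝ) : 0 ≤ volOne a r x := ENNReal.toReal_nonneg

lemma le_volOne {a : ℝ} (ha : -1 / 2 ≤ a) {r x : ℝ} (hr : 0 < r) (hx : 0 < x) :
    r * (x + r) ^ (2 * a + 1) ≤ 2 * 2 ^ (2 * a + 1) * volOne a r x := by
  have h := le_wPlusOne_Ioo ha hr hx
  rw [← ofReal_volOne ha hr hx, ENNReal.ofReal_le_ofReal_iff (volOne_nonneg a r x)] at h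
  have h2 : (x + r) ^ (2 * a + 1) ≤ 2 ^ (2 * a + 1) * (x + r / 2) ^ (2 * a + 1) := by
    rw [← Real.mul_rpow two_pos.le (by positivity)]
    exact Real.rpow_le_rpow (by positivity) (by linarith) (by linarith)
  calc r * (x + r) ^ (2 * a + 1)
      ≤ r * (2 ^ (2 * a + 1) * (x + r / 2) ^ (2 * a + 1)) := by gcongr
    _ = 2 * 2 ^ (2 * a + 1) * (r / 2 * (x + r / 2) ^ (2 * a + 1)) := by ring
    _ ≤ _ := by gcongr

lemma volOne_pos {a : ℝ} (ha : -1 / 2 ≤ a) {r x : ℝ} (hr : 0 < r) (hx : 0 < x) :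
    0 < volOne a r x := by
  have h := le_volOne ha hr hx
  have h2 : 0 < r * (x + r) ^ (2 * a + 1) := by positivity
  have h3 : (0 : ℝ) < 2 * 2 ^ (2 * a + 1) := by positivity
  exact pos_of_mul_pos_right (h2.trans_le h) h3.le

lemma vol_pos {α : Fin d → ℝ} (hα : ∀ i, -1 / 2 ≤ α i) {r : ℝ} (hr : 0 < r)
    {x : EuclideanSpace ℝ (Fin d)} (hx : x ∈ orthant d) : 0 < vol α r x :=
  Finset.prod_pos fun i _ => volOne_pos (hα i) hr (hx i)

/-- Volumes of cubes of the same size whose centres lie within one another are comparable. -/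
lemma exists_vol_le_of_abs_sub_lt {α : Fin d → ℝ} (hα : ∀ i, -1 / 2 ≤ α i) :
    ∃ D, 0 < D ∧ ∀ r, 0 < r → ∀ x ∈ orthant d, ∀ z ∈ orthant d, (∀ i, |x i - z i| < r) →
      vol α r x ≤ D * vol α r z := by
  refine ⟨∏ i, (2 * 2 ^ (2 * α i + 1) * (2 * 2 ^ (2 * α i + 1))),
    Finset.prod_pos fun i _ => by positivity, fun r hr x hx z hz h => ?_⟩
  rw [vol, vol, ← Finset.prod_mul_distrib]
  refine Finset.prod_le_prod (fun i _ => (volOne_pos (hα i) hr (hx i)).le) fun i _ => ?_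
  have hxi := hx i
  have hzi := hz i
  have hi := abs_lt.mp (h i)
  have hz2 : (x i + r) ^ (2 * α i + 1) ≤ 2 ^ (2 * α i + 1) * (z i + r) ^ (2 * α i + 1) := by
    rw [← Real.mul_rpow two_pos.le (by positivity)]
    exact Real.rpow_le_rpow (by positivity) (by linarith) (by linarith [hα i])
  calc volOne (α i) r (x i) ≤ 2 * (r * (x i + r) ^ (2 * α i + 1)) := volOne_le (hα i) hr hxi
    _ ≤ 2 * (r * (2 ^ (2 * α i + 1) * (z i + r) ^ (2 * α i + 1))) := by gcongr
    _ = 2 * 2 ^ (2 * α i + 1) * (r * (z i + r) ^ (2 * α i + 1)) := by ring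
    _ ≤ 2 * 2 ^ (2 * α i + 1) * (2 * 2 ^ (2 * α i + 1) * volOne (α i) r (z i)) := by
        exact mul_le_mul_of_nonneg_left (le_volOne (hα i) hr hzi) (by positivity)
    _ = _ := by ring

/-- The doubling property of the measure `w_α^+` on cubes. -/
lemma exists_vol_le_vol_div {α : Fin d → ℝ} (hd : 1 ≤ d) (hα : ∀ i, -1 / 2 ≤ α i) :
    ∃ D, 0 < D ∧ ∀ r, 0 < r → ∀ x ∈ orthant d, vol α r x ≤ D * vol α (r / d) x := by
  have hd1 : (1 : ℝ) ≤ d := by exact_mod_cast hd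
  have hd0 : (0 : ℝ) < d := by linarith
  refine ⟨∏ i, (2 * d * d ^ (2 * α i + 1) * (2 * 2 ^ (2 * α i + 1))),
    Finset.prod_pos fun i _ => by positivity, fun r hr x hx => ?_⟩
  rw [vol, vol, ← Finset.prod_mul_distrib]
  refine Finset.prod_le_prod (fun i _ => (volOne_pos (hα i) hr (hx i)).le) fun i _ => ?_
  have hxi := hx i
  have hz2 : (x i + r) ^ (2 * α i + 1) ≤ d ^ (2 * α i + 1) * (x i + r / d) ^ (2 * α i + 1) := by
    rw [← Real.mul_rpow hd0.le (by positivity)]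
    refine Real.rpow_le_rpow (by positivity) ?_ (by linarith [hα i])
    rw [mul_add, mul_div_cancel₀ _ hd0.ne']
    nlinarith
  calc volOne (α i) r (x i) ≤ 2 * (r * (x i + r) ^ (2 * α i + 1)) := volOne_le (hα i) hr hxi
    _ ≤ 2 * (r * (d ^ (2 * α i + 1) * (x i + r / d) ^ (2 * α i + 1))) := by gcongr
    _ = 2 * d * d ^ (2 * α i + 1) * (r / d * (x i + r / d) ^ (2 * α i + 1)) := by
        field_simp
    _ ≤ 2 * d * d ^ (2 * α i + 1) * (2 * 2 ^ (2 * α i + 1) * volOne (α i) (r / d) (x i)) := by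
        exact mul_le_mul_of_nonneg_left (le_volOne (hα i) (by positivity) hxi) (by positivity)
    _ = _ := by ring

/-- The cube centred at `x` with side lengths `2r`. -/
def cube (r : ℝ) (x : EuclideanSpace ℝ (Fin d)) : Set (EuclideanSpace ℝ (Fin d)) :=
  {z | ∀ i, |x i - z i| < r}

lemma wPlus_cube {α : Fin d → ℝ} (hα : ∀ i, -1 / 2 ≤ α i) {r : ℝ} (hr : 0 < r)
    {x : EuclideanSpace ℝ (Fin d)} (hx : x ∈ orthant d) :
    wPlus α (cube r x) = ENNReal.ofReal (vol α r x) := by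
  have h : cube r x = WithLp.ofLp ⁻¹' Set.pi Set.univ fun i => Set.Ioo (x i - r) (x i + r) := by
    ext z
    simp only [cube, Set.mem_ofPred_eq, Set.mem_preimage, Set.mem_univ_pi, Set.mem_Ioo, abs_lt]
    refine forall_congr' fun i => ⟨fun h => ⟨?_, ?_⟩, fun h => ⟨?_, ?_⟩⟩ <;> linarith [h.1, h.2]
  rw [h, (measurePreserving_wPlus α).measure_preimage
    (MeasurableSet.univ_pi fun i => measurableSet_Ioo).nullMeasurableSet, Measure.pi_pi, vol,
    ENNReal.ofReal_prod_of_nonneg fun i _ => (volOne_pos (hα i) hr (hx i)).le]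
  exact Finset.prod_congr rfl fun i _ => (ofReal_volOne (hα i) hr (hx i)).symm

lemma measurable_measureReal_Ioo (μ : Measure ℝ) [SFinite μ] :
    Measurable fun q : ℝ × ℝ => μ.real (Set.Ioo (q.1 - Real.sqrt q.2) (q.1 + Real.sqrt q.2)) := by
  have h3 : Measurable fun w : (ℝ × ℝ) × ℝ => w.1.1 - Real.sqrt w.1.2 := by fun_prop
  have h4 : Measurable fun w : (ℝ × ℝ) × ℝ => w.1.1 + Real.sqrt w.1.2 := by fun_prop
  have h2 := (measurableSet_lt h3 measurable_snd).inter (measurableSet_lt measurable_snd h4)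
  exact (measurable_measure_prodMk_left (ν := μ) h2).ennreal_toReal

lemma measurable_vol (α : Fin d → ℝ) :
    Measurable fun p : EuclideanSpace ℝ (Fin d) × ℝ => vol α (Real.sqrt p.2) p.1 := by
  have h3 : ∀ j, Measurable fun p : EuclideanSpace ℝ (Fin d) × ℝ => (p.1 j, p.2) := fun j => by
    fun_prop
  simp only [vol]
  refine Finset.measurable_prod _ fun j _ => ?_
  have h := (measurable_measureReal_Ioo (wPlusOne (α j))).comp (h3 j)
  rw [Function.comp_def] at h
  exact h

/-- The averages `∫_{|x-z|<r} dw_α^+(x) / V_r(x)` are bounded above and below. -/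
lemma exists_average_bounds {α : Fin d → ℝ} (hd : 1 ≤ d) (hα : ∀ i, -1 / 2 ≤ α i) :
    ∃ c C : ℝ≥0, 0 < c ∧ ∀ r, 0 < r → ∀ z ∈ orthant d,
      c ≤ ∫⁻ x in {x | ‖z - x‖ < r}, (ENNReal.ofReal (vol α r x))⁻¹ ∂(wPlus α) ∧
      ∫⁻ x in {x | ‖z - x‖ < r}, (ENNReal.ofReal (vol α r x))⁻¹ ∂(wPlus α) ≤ C := by
  obtain ⟨D, hD, hD'⟩ := exists_vol_le_of_abs_sub_lt hα
  obtain ⟨E, hE, hE'⟩ := exists_vol_le_vol_div hd hα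
  have hd0 : (0 : ℝ) < d := by exact_mod_cast hd
  refine ⟨(D * E)⁻¹.toNNReal, D.toNNReal, by positivity, fun r hr z hz => ?_⟩
  have hv := vol_pos hα hr hz
  -- The ball of radius r lies between the cubes of half-sides r/d and r: the supremum norm is at
  -- most the Euclidean norm, which is at most the ℓ¹ norm. On it V_r(x) is comparable with V_r(z)
  -- up to D, and E bounds V_r(z) by V_{r/d}(z).
  have hball : MeasurableSet {x : EuclideanSpace ℝ (Fin d) | ‖z - x‖ < r} :=
    measurableSet_lt (by fun_prop) measurable_const
  have hsub1 : {x : EuclideanSpace ℝ (Fin d) | ‖z - x‖ < r} ⊆ cube r z := fun x hx i =>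
    lt_of_le_of_lt (by simpa using PiLp.norm_apply_le (z - x) i) hx
  have hsub2 : cube (r / d) z ⊆ {x : EuclideanSpace ℝ (Fin d) | ‖z - x‖ < r} := fun x hx => by
    have h1 : ‖z - x‖ ≤ ∑ i, |z i - x i| := by
      rw [EuclideanSpace.norm_eq]
      refine Real.sqrt_le_iff.mpr ⟨by positivity, ?_⟩
      have := Finset.sum_sq_le_sq_sum_of_nonneg (s := Finset.univ) (f := fun i => |z i - x i|)
        fun i _ => abs_nonneg _
      simpa using this
    have h2 : ∑ i, |z i - x i| < ∑ _i : Fin d, r / d :=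
      Finset.sum_lt_sum_of_nonempty ⟨⟨0, hd⟩, Finset.mem_univ _⟩ fun i _ => hx i
    simp only [Finset.sum_const, Finset.card_univ, Fintype.card_fin, nsmul_eq_mul] at h2
    rw [mul_div_cancel₀ _ hd0.ne'] at h2
    exact h1.trans_lt h2
  constructor
  · calc ((D * E)⁻¹.toNNReal : ℝ≥0∞)
        ≤ ENNReal.ofReal (D * vol α r z)⁻¹ * ENNReal.ofReal (vol α (r / d) z) := by
          rw [← ENNReal.ofReal_mul (by positivity)]
          refine ENNReal.ofReal_le_ofReal ?_
          have h1 := hE' r hr z hz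
          rw [inv_mul_eq_div, inv_le_comm₀ (by positivity)
            (div_pos (vol_pos hα (by positivity) hz) (by positivity)), inv_div,
            div_le_iff₀ (vol_pos hα (by positivity) hz)]
          nlinarith
      _ = ∫⁻ x in cube (r / d) z, ENNReal.ofReal (D * vol α r z)⁻¹ ∂(wPlus α) := by
          rw [setLIntegral_const, wPlus_cube hα (by positivity) hz]
      _ ≤ ∫⁻ x in {x | ‖z - x‖ < r}, ENNReal.ofReal (D * vol α r z)⁻¹ ∂(wPlus α) :=
          lintegral_mono_set hsub2
      _ ≤ _ := by
          refine setLIntegral_mono_ae' hball ?_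
          filter_upwards [ae_mem_orthant α] with x hx hxr
          rw [ENNReal.ofReal_inv_of_pos (by positivity)]
          refine ENNReal.inv_le_inv.mpr (ENNReal.ofReal_le_ofReal (hD' r hr x hx z hz fun i => ?_))
          rw [abs_sub_comm]
          exact hsub1 hxr i
  · calc ∫⁻ x in {x | ‖z - x‖ < r}, (ENNReal.ofReal (vol α r x))⁻¹ ∂(wPlus α)
        ≤ ∫⁻ x in {x | ‖z - x‖ < r}, ENNReal.ofReal (D * (vol α r z)⁻¹) ∂(wPlus α) := by
          refine setLIntegral_mono_ae' hball ?_
          filter_upwards [ae_mem_orthant α] with x hx hxr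
          have hvx := vol_pos hα hr hx
          rw [← ENNReal.ofReal_inv_of_pos hvx]
          refine ENNReal.ofReal_le_ofReal ?_
          have h1 := hD' r hr z hz x hx (hsub1 hxr)
          rw [← div_eq_mul_inv, inv_le_comm₀ hvx (by positivity), inv_div, div_le_iff₀ hD]
          linarith
      _ ≤ ∫⁻ x in cube r z, ENNReal.ofReal (D * (vol α r z)⁻¹) ∂(wPlus α) :=
          lintegral_mono_set hsub1
      _ = D.toNNReal := by
          rw [setLIntegral_const, wPlus_cube hα hr hz, ← ENNReal.ofReal_mul (by positivity),
            inv_mul_cancel_right₀ hv.ne']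
          rfl

/-! ### Conical square functions. -/

lemma mem_coneAt {x : EuclideanSpace ℝ (Fin d)} {p : EuclideanSpace ℝ (Fin d) × ℝ} :
    p ∈ coneAt x ↔ 0 < p.2 ∧ ‖p.1 - x‖ < Real.sqrt p.2 := by
  constructor
  · rintro ⟨q, ⟨h1, h2⟩, rfl⟩
    simpa using ⟨h1, h2⟩
  · rintro ⟨h1, h2⟩
    exact ⟨(p.1 - x, p.2), ⟨h1, h2⟩, by simp⟩

/-- The squared conical square function of the family `u` with the weight `ρ(t) dt`. -/
noncomputable def areaSq (α : Fin d → ℝ) (ρ : ℝ → ℝ≥0∞)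
    (u : ℝ → EuclideanSpace ℝ (Fin d) → ℂ) (x : EuclideanSpace ℝ (Fin d)) : ℝ≥0∞ :=
  ∫⁻ p in coneAt x, ρ p.2 * ‖u p.2 p.1‖ₑ ^ 2 /
    ENNReal.ofReal (vol α (Real.sqrt p.2) x) ∂((wPlus α).prod volume)

/-- The integrand of the squared conical square function. -/
noncomputable def areaKernel (α : Fin d → ℝ) (x : EuclideanSpace ℝ (Fin d))
    (p : EuclideanSpace ℝ (Fin d) × ℝ) : ℝ≥0∞ :=
  (coneAt x).indicator (fun p => (ENNReal.ofReal (vol α (Real.sqrt p.2) x))⁻¹) p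

lemma measurableSet_coneAt (x : EuclideanSpace ℝ (Fin d)) : MeasurableSet (coneAt x) := by
  have : coneAt x = {p | 0 < p.2} ∩ {p | ‖p.1 - x‖ < Real.sqrt p.2} := by
    ext p; exact mem_coneAt
  rw [this]
  exact (measurableSet_lt (by fun_prop) (by fun_prop)).inter
    (measurableSet_lt (by fun_prop) (by fun_prop))

lemma measurable_areaKernel (α : Fin d → ℝ) :
    Measurable fun q : EuclideanSpace ℝ (Fin d) × (EuclideanSpace ℝ (Fin d) × ℝ) =>
      areaKernel α q.1 q.2 := by
  have h1 : MeasurableSet {q : EuclideanSpace ℝ (Fin d) × (EuclideanSpace ℝ (Fin d) × ℝ) |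
      0 < q.2.2} := measurableSet_lt (by fun_prop) (by fun_prop)
  have h2 : MeasurableSet {q : EuclideanSpace ℝ (Fin d) × (EuclideanSpace ℝ (Fin d) × ℝ) |
      ‖q.2.1 - q.1‖ < Real.sqrt q.2.2} := measurableSet_lt (by fun_prop) (by fun_prop)
  have hs : MeasurableSet {q : EuclideanSpace ℝ (Fin d) × (EuclideanSpace ℝ (Fin d) × ℝ) |
      q.2 ∈ coneAt q.1} := by
    convert h1.inter h2 using 1
    ext q
    exact mem_coneAt
  have hp : Measurable fun q : EuclideanSpace ℝ (Fin d) × (EuclideanSpace ℝ (Fin d) × ℝ) =>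
    (q.1, q.2.2) := by fun_prop
  have hv := ((measurable_vol α).comp hp).ennreal_ofReal.inv
  exact hv.indicator hs

/-- The cone integral becomes a jointly measurable kernel integrated against a measurable expansion,
which makes Tonelli and measurability in x available. -/
lemma HasExpansion.areaSq_eq {α : Fin d → ℝ} (ρ : ℝ → ℝ≥0∞)
    {b : (Fin d → ℕ) → ℂ} {τ : (Fin d → ℕ) → Fin d → ℕ}
    {u : ℝ → EuclideanSpace ℝ (Fin d) → ℂ} (hu : HasExpansion α b τ u)
    (x : EuclideanSpace ℝ (Fin d)) :
    areaSq α ρ u x = ∫⁻ p, areaKernel α x p * (ρ p.2 * ‖expansion α b τ p.2 p.1‖ₑ ^ 2)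
      ∂((wPlus α).prod (volume.restrict (Set.Ioi 0))) := by
  have hm : (wPlus α).prod (volume.restrict (Set.Ioi (0 : ℝ))) =
      ((wPlus α).prod volume).restrict (Set.univ ×ˢ Set.Ioi 0) := by
    rw [← Measure.prod_restrict, Measure.restrict_univ]
  have hae : ∀ᵐ p ∂((wPlus α).prod (volume : Measure ℝ)), p.1 ∈ orthant d :=
    Measure.quasiMeasurePreserving_fst.ae (ae_mem_orthant α)
  rw [hm, areaSq, ← lintegral_indicator (measurableSet_coneAt x),
    ← lintegral_indicator (MeasurableSet.univ.prod measurableSet_Ioi)]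
  refine lintegral_congr_ae (hae.mono fun p hp => ?_)
  by_cases hx : p ∈ coneAt x
  · have h0 := (mem_coneAt.mp hx).1
    have h1 : p ∈ Set.univ ×ˢ Set.Ioi (0 : ℝ) := ⟨trivial, h0⟩
    rw [Set.indicator_of_mem hx, Set.indicator_of_mem h1, areaKernel, Set.indicator_of_mem hx,
      hu _ h0 _ hp, ENNReal.div_eq_inv_mul]
  · have h1 : areaKernel α x p = 0 := Set.indicator_of_notMem hx _
    rw [Set.indicator_of_notMem hx, Set.indicator_apply, h1, zero_mul, ite_self]

lemma HasExpansion.measurable_areaSq {α : Fin d → ℝ} {ρ : ℝ → ℝ≥0∞} (hρ : Measurable ρ)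
    {b : (Fin d → ℕ) → ℂ} {τ : (Fin d → ℕ) → Fin d → ℕ}
    {u : ℝ → EuclideanSpace ℝ (Fin d) → ℂ} (hu : HasExpansion α b τ u) :
    Measurable (areaSq α ρ u) := by
  rw [funext (hu.areaSq_eq ρ)]
  have hm := measurable_expansion α b τ
  have h1 : Measurable fun p : EuclideanSpace ℝ (Fin d) × ℝ =>
    ρ p.2 * ‖expansion α b τ p.2 p.1‖ₑ ^ 2 := by fun_prop
  exact ((measurable_areaKernel α).mul (h1.comp measurable_snd)).lintegral_prod_right'

lemma energy_eq_lintegral_prod {α : Fin d → ℝ} {ρ : ℝ → ℝ≥0∞} (hρ : Measurable ρ)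
    {b : (Fin d → ℕ) → ℂ} {τ : (Fin d → ℕ) → Fin d → ℕ}
    {u : ℝ → EuclideanSpace ℝ (Fin d) → ℂ} (hu : HasExpansion α b τ u) :
    energy α ρ u = ∫⁻ p, ρ p.2 * ‖expansion α b τ p.2 p.1‖ₑ ^ 2
      ∂((wPlus α).prod (volume.restrict (Set.Ioi 0))) := by
  have hm := measurable_expansion α b τ
  have h1 : Measurable fun p : EuclideanSpace ℝ (Fin d) × ℝ =>
    ρ p.2 * ‖expansion α b τ p.2 p.1‖ₑ ^ 2 := by fun_prop
  rw [lintegral_prod _ h1.aemeasurable, ← hu.lintegral_timeSq hρ]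
  refine lintegral_congr_ae ((ae_mem_orthant α).mono fun x hx => ?_)
  refine setLIntegral_congr_fun measurableSet_Ioi fun t ht => ?_
  simp only [hu t ht x hx]

/-- The conical square functions are comparable in norm with the space-time energy. -/
lemma exists_areaSq_bounds {α : Fin d → ℝ} (hd : 1 ≤ d) (hα : ∀ i, -1 / 2 ≤ α i) :
    ∃ c C : ℝ≥0, 0 < c ∧ ∀ (ρ : ℝ → ℝ≥0∞), Measurable ρ →
      ∀ (b : (Fin d → ℕ) → ℂ) (τ : (Fin d → ℕ) → Fin d → ℕ)
        (u : ℝ → EuclideanSpace ℝ (Fin d) → ℂ), HasExpansion α b τ u →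
      c * energy α ρ u ≤ ∫⁻ x, areaSq α ρ u x ∂(wPlus α) ∧
      ∫⁻ x, areaSq α ρ u x ∂(wPlus α) ≤ C * energy α ρ u := by
  obtain ⟨c, C, hc, hcC⟩ := exists_average_bounds hd hα
  refine ⟨c, C, hc, fun ρ hρ b τ u hu => ?_⟩
  have hm := measurable_expansion α b τ
  have h1 : Measurable fun p : EuclideanSpace ℝ (Fin d) × ℝ =>
    ρ p.2 * ‖expansion α b τ p.2 p.1‖ₑ ^ 2 := by fun_prop
  -- Tonelli: only the kernel depends on x, so its integral over x factors out and is then bounded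
  -- above and below by the average bounds.
  have h2 : ∫⁻ x, areaSq α ρ u x ∂(wPlus α) = ∫⁻ p, (∫⁻ x, areaKernel α x p ∂(wPlus α)) *
      (ρ p.2 * ‖expansion α b τ p.2 p.1‖ₑ ^ 2)
      ∂((wPlus α).prod (volume.restrict (Set.Ioi 0))) := by
    rw [lintegral_congr (hu.areaSq_eq ρ), lintegral_lintegral_swap
      ((measurable_areaKernel α).mul (h1.comp measurable_snd)).aemeasurable]
    refine lintegral_congr fun p => ?_
    exact lintegral_mul_const _ ((measurable_areaKernel α).comp measurable_prodMk_right)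
  have h3 : ∀ᵐ p ∂((wPlus α).prod (volume.restrict (Set.Ioi (0 : ℝ)))),
      c ≤ ∫⁻ x, areaKernel α x p ∂(wPlus α) ∧ ∫⁻ x, areaKernel α x p ∂(wPlus α) ≤ C := by
    have h4 : ∀ᵐ p ∂((wPlus α).prod (volume.restrict (Set.Ioi (0 : ℝ)))), p.1 ∈ orthant d :=
      Measure.quasiMeasurePreserving_fst.ae (ae_mem_orthant α)
    have h5 : ∀ᵐ p ∂((wPlus α).prod (volume.restrict (Set.Ioi (0 : ℝ)))), p.2 ∈ Set.Ioi (0 : ℝ) :=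
      Measure.quasiMeasurePreserving_snd.ae (ae_restrict_mem measurableSet_Ioi)
    filter_upwards [h4, h5] with p hp1 hp2
    have h6 : ∫⁻ x, areaKernel α x p ∂(wPlus α) =
        ∫⁻ x in {x | ‖p.1 - x‖ < Real.sqrt p.2}, (ENNReal.ofReal (vol α (Real.sqrt p.2) x))⁻¹
          ∂(wPlus α) := by
      rw [← lintegral_indicator (measurableSet_lt (by fun_prop) measurable_const)]
      refine lintegral_congr fun x => ?_
      by_cases hx : ‖p.1 - x‖ < Real.sqrt p.2
      · exact (Set.indicator_of_mem (mem_coneAt.mpr ⟨hp2, hx⟩) _).trans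
          (Set.indicator_of_mem (s := {x | ‖p.1 - x‖ < Real.sqrt p.2}) hx
            fun x => (ENNReal.ofReal (vol α (Real.sqrt p.2) x))⁻¹).symm
      · exact (Set.indicator_of_notMem (fun h => hx (mem_coneAt.mp h).2) _).trans
          (Set.indicator_of_notMem (s := {x | ‖p.1 - x‖ < Real.sqrt p.2}) hx
            fun x => (ENNReal.ofReal (vol α (Real.sqrt p.2) x))⁻¹).symm
    rw [h6]
    exact hcC _ (Real.sqrt_pos.mpr hp2) _ hp1
  rw [h2, energy_eq_lintegral_prod hρ hu, ← lintegral_const_mul _ h1, ← lintegral_const_mul _ h1]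
  exact ⟨lintegral_mono_ae (h3.mono fun p hp => mul_le_mul_left hp.1 _),
    lintegral_mono_ae (h3.mono fun p hp => mul_le_mul_left hp.2 _)⟩

/-! ### Operators with values in Bochner spaces. -/

section VectorValued

/-- In a second countable space every open set is a countable union of balls, whose preimages are
sublevel sets of distance functions. -/
lemma measurable_of_measurable_edist {X F : Type*} [MeasurableSpace X] [PseudoEMetricSpace F]
    [SecondCountableTopology F] [MeasurableSpace F] [BorelSpace F] {Φ : X → F}
    (h : ∀ y, Measurable fun x => edist (Φ x) y) : Measurable Φ := by
  refine measurable_of_isOpen fun U hU => ?_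
  have h1 : ∀ y : U, ∃ r : ℝ≥0∞, 0 < r ∧ Metric.eball (y : F) r ⊆ U := fun y =>
    EMetric.isOpen_iff.mp hU y y.2
  choose r hr hrU using h1
  obtain ⟨T, hT, hTU⟩ := TopologicalSpace.isOpen_iUnion_countable
    (fun y : U => Metric.eball (y : F) (r y)) fun y => Metric.isOpen_eball
  have h2 : U = ⋃ y ∈ T, Metric.eball (y : F) (r y) := by
    rw [hTU]
    refine Set.Subset.antisymm (fun y hy => ?_) (Set.iUnion_subset hrU)
    exact Set.mem_iUnion.mpr ⟨⟨y, hy⟩, Metric.mem_eball_self (hr _)⟩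
  rw [h2, Set.preimage_iUnion₂]
  exact MeasurableSet.biUnion hT fun y _ => measurableSet_lt (h y) measurable_const

lemma enorm_Lp_two_sq {Y F : Type*} [MeasurableSpace Y] [NormedAddCommGroup F] {ν : Measure Y}
    (f : Lp F 2 ν) : ‖f‖ₑ ^ 2 = ∫⁻ y, ‖f y‖ₑ ^ 2 ∂ν := by
  rw [Lp.enorm_def, eLpNorm_two_sq]

lemma ennreal_le_of_sq_le_sq {a b : ℝ≥0∞} (h : a ^ 2 ≤ b ^ 2) : a ≤ b := by
  by_contra! hab
  exact absurd (ENNReal.pow_lt_pow_left two_ne_zero hab) (not_lt.mpr h)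

/-- A jointly measurable function with square integrable sections, as a measurable function with
values in `L²`. -/
lemma measurable_toLp_section {X Y : Type*} [MeasurableSpace X] [MeasurableSpace Y]
    [MeasurableSpace.CountablyGenerated Y] {ν : Measure Y} [SFinite ν] {G : X × Y → ℂ}
    (hG : Measurable G) (hm : ∀ x, MemLp (fun y => G (x, y)) 2 ν) :
    StronglyMeasurable fun x => (hm x).toLp := by
  have : Fact ((2 : ℝ≥0∞) ≠ ∞) := ⟨ENNReal.ofNat_ne_top⟩
  let _ : MeasurableSpace (Lp ℂ 2 ν) := borel _
  have : BorelSpace (Lp ℂ 2 ν) := ⟨rfl⟩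
  refine (measurable_of_measurable_edist fun g => ?_).stronglyMeasurable
  obtain ⟨g', hg', hgg'⟩ := (Lp.memLp g).aestronglyMeasurable
  have h1 : ∀ x, edist (hm x).toLp g = (∫⁻ y, ‖G (x, y) - g' y‖ₑ ^ 2 ∂ν) ^ (1 / 2 : ℝ) := by
    intro x
    have h2 : edist (hm x).toLp g ^ 2 = ∫⁻ y, ‖G (x, y) - g' y‖ₑ ^ 2 ∂ν := by
      rw [edist_eq_enorm_sub, enorm_Lp_two_sq]
      refine lintegral_congr_ae ?_
      filter_upwards [Lp.coeFn_sub (hm x).toLp g, (hm x).coeFn_toLp, hgg'] with y h1 h2 h3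
      rw [h1, Pi.sub_apply, h2, h3]
    rw [← h2, ← ENNReal.rpow_natCast, ← ENNReal.rpow_mul]
    norm_num
  simp only [h1]
  have h3 : Measurable fun p : X × Y => ‖G p - g' p.2‖ₑ ^ 2 :=
    ((hG.sub (hg'.measurable.comp measurable_snd)).enorm).pow_const 2
  exact h3.lintegral_prod_right'.pow_const _

/-- The sections that are not square integrable form a null set of x; replacing G by 0 there gives
an L²-valued map defined everywhere. -/
lemma exists_Lp_section {X Y : Type*} [MeasurableSpace X] [MeasurableSpace Y]
    [MeasurableSpace.CountablyGenerated Y] {μ : Measure X} {ν : Measure Y} [SFinite ν]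
    {G : X × Y → ℂ} (hG : Measurable G) (hfin : ∫⁻ x, ∫⁻ y, ‖G (x, y)‖ₑ ^ 2 ∂ν ∂μ ≠ ∞) :
    ∃ Φ : Lp (Lp ℂ 2 ν) 2 μ, ∀ᵐ x ∂μ, Φ x =ᵐ[ν] fun y => G (x, y) := by
  have hN : Measurable fun x => ∫⁻ y, ‖G (x, y)‖ₑ ^ 2 ∂ν :=
    (hG.enorm.pow_const 2).lintegral_prod_right'
  set S : Set X := {x | ∫⁻ y, ‖G (x, y)‖ₑ ^ 2 ∂ν < ∞} with hS
  have hSm : MeasurableSet S := measurableSet_lt hN measurable_const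
  set G' : X × Y → ℂ := (Prod.fst ⁻¹' S).indicator G with hG'
  have hG'm : Measurable G' := hG.indicator (measurable_fst hSm)
  have h0 : ∀ x ∈ S, ∀ y, G' (x, y) = G (x, y) := fun x hx y =>
    Set.indicator_of_mem (s := Prod.fst ⁻¹' S) (a := (x, y)) hx G
  have hle : ∀ x, ∫⁻ y, ‖G' (x, y)‖ₑ ^ 2 ∂ν < ∞ ∧
      ∫⁻ y, ‖G' (x, y)‖ₑ ^ 2 ∂ν ≤ ∫⁻ y, ‖G (x, y)‖ₑ ^ 2 ∂ν := by
    intro x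
    by_cases hx : x ∈ S
    · simp only [h0 x hx]
      exact ⟨hx, le_rfl⟩
    · have h1 : ∀ y, G' (x, y) = 0 := fun y =>
        Set.indicator_of_notMem (s := Prod.fst ⁻¹' S) (a := (x, y)) hx G
      simp [h1]
  have hm : ∀ x, MemLp (fun y => G' (x, y)) 2 ν := by
    intro x
    refine ⟨(hG'm.comp measurable_prodMk_left).aestronglyMeasurable, ?_⟩
    have h1 := (hle x).1
    rw [← eLpNorm_two_sq ν fun y => G' (x, y)] at h1
    exact (ENNReal.pow_lt_top_iff.mp h1).resolve_right two_ne_zero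
  have hΦ := measurable_toLp_section hG'm hm
  have hnorm : ∀ x, ‖(hm x).toLp‖ₑ ^ 2 = ∫⁻ y, ‖G' (x, y)‖ₑ ^ 2 ∂ν := fun x => by
    rw [enorm_Lp_two_sq]
    exact lintegral_congr_ae ((hm x).coeFn_toLp.mono fun y hy => by simp only [hy])
  have hΦm : MemLp (fun x => (hm x).toLp) 2 μ := by
    refine ⟨hΦ.aestronglyMeasurable, ?_⟩
    have h1 : eLpNorm (fun x => (hm x).toLp) 2 μ ^ 2 < ∞ := by
      rw [eLpNorm_two_sq]
      refine lt_of_le_of_lt (lintegral_mono fun x => ?_) hfin.lt_top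
      rw [hnorm]
      exact (hle x).2
    exact (ENNReal.pow_lt_top_iff.mp h1).resolve_right two_ne_zero
  refine ⟨hΦm.toLp, ?_⟩
  filter_upwards [hΦm.coeFn_toLp, ae_lt_top hN hfin] with x h1 h2
  rw [h1]
  exact (hm x).coeFn_toLp.trans (ae_of_all _ fun y => h0 x h2 y)

/-- Each value is chosen through its sections. As these are prescribed almost everywhere, the choice
is automatically additive and homogeneous, and its norm is the iterated integral in `hbound`. -/
theorem boundedVectorL2_of_bound {Y : Type} [MeasurableSpace Y]
    [MeasurableSpace.CountablyGenerated Y] {α : Fin d → ℝ} {ν : Measure Y} [SFinite ν]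
    {U : (EuclideanSpace ℝ (Fin d) → ℂ) → EuclideanSpace ℝ (Fin d) → Y → ℂ} (C : ℝ≥0)
    (hmeas : ∀ f, MemLp f 2 (wPlus α) → ∃ G : EuclideanSpace ℝ (Fin d) × Y → ℂ, Measurable G ∧
      ∀ᵐ x ∂(wPlus α), U f x =ᵐ[ν] fun y => G (x, y))
    (hbound : ∀ f, MemLp f 2 (wPlus α) → ∫⁻ x, ∫⁻ y, ‖U f x y‖ₑ ^ 2 ∂ν ∂(wPlus α) ≤
      (C * eLpNorm f 2 (wPlus α)) ^ 2)
    (hadd : ∀ f g : Lp ℂ 2 (wPlus α), ∀ᵐ x ∂(wPlus α),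
      U (f + g : Lp ℂ 2 (wPlus α)) x =ᵐ[ν] fun y => U f x y + U g x y)
    (hsmul : ∀ (c : ℂ) (f : Lp ℂ 2 (wPlus α)), ∀ᵐ x ∂(wPlus α),
      U (c • f : Lp ℂ 2 (wPlus α)) x =ᵐ[ν] fun y => c * U f x y) :
    BoundedVectorL2 α ν U := by
  have hex : ∀ f : Lp ℂ 2 (wPlus α), ∃ Φ : Lp (Lp ℂ 2 ν) 2 (wPlus α),
      ∀ᵐ x ∂(wPlus α), Φ x =ᵐ[ν] U f x := by
    intro f
    obtain ⟨G, hG, hGU⟩ := hmeas f (Lp.memLp f)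
    have h1 : ∫⁻ x, ∫⁻ y, ‖U f x y‖ₑ ^ 2 ∂ν ∂(wPlus α) =
        ∫⁻ x, ∫⁻ y, ‖G (x, y)‖ₑ ^ 2 ∂ν ∂(wPlus α) :=
      lintegral_congr_ae (hGU.mono fun x hx =>
        lintegral_congr_ae (hx.mono fun y hy => by simp only [hy]))
    have h2 : ∫⁻ x, ∫⁻ y, ‖G (x, y)‖ₑ ^ 2 ∂ν ∂(wPlus α) ≠ ∞ := by
      rw [← h1]
      refine ((hbound f (Lp.memLp f)).trans_lt ?_).ne
      exact ENNReal.pow_lt_top (ENNReal.mul_lt_top ENNReal.coe_lt_top (Lp.memLp f).2)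
    obtain ⟨Φ, hΦ⟩ := exists_Lp_section hG h2
    exact ⟨Φ, by filter_upwards [hΦ, hGU] with x hx hy using hx.trans hy.symm⟩
  choose T hT using hex
  have hTadd : ∀ f g, T (f + g) = T f + T g := by
    intro f g
    refine Lp.ext ?_
    filter_upwards [hT (f + g), hT f, hT g, hadd f g, Lp.coeFn_add (T f) (T g)] with x h1 h2 h3 h4 h5
    rw [h5, Pi.add_apply]
    refine Lp.ext ?_
    filter_upwards [h1, h2, h3, h4, Lp.coeFn_add (T f x) (T g x)] with y k1 k2 k3 k4 k5
    rw [k1, k4, k5, Pi.add_apply, k2, k3]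
  have hTsmul : ∀ (c : ℂ) f, T (c • f) = c • T f := by
    intro c f
    refine Lp.ext ?_
    filter_upwards [hT (c • f), hT f, hsmul c f, Lp.coeFn_smul c (T f)] with x h1 h2 h4 h5
    rw [h5, Pi.smul_apply]
    refine Lp.ext ?_
    filter_upwards [h1, h2, h4, Lp.coeFn_smul c (T f x)] with y k1 k2 k4 k5
    rw [k1, k4, k5, Pi.smul_apply, k2, smul_eq_mul]
  refine ⟨LinearMap.mkContinuous ⟨⟨T, hTadd⟩, hTsmul⟩ C fun f => ?_, hT⟩
  have h1 : ‖T f‖ₑ ≤ C * ‖f‖ₑ := by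
    refine ennreal_le_of_sq_le_sq ?_
    rw [enorm_Lp_two_sq]
    rw [Lp.enorm_def f]
    refine le_of_eq_of_le ?_ (hbound f (Lp.memLp f))
    refine lintegral_congr_ae ((hT f).mono fun x hx => ?_)
    simp only
    rw [enorm_Lp_two_sq]
    exact lintegral_congr_ae (hx.mono fun y hy => by simp only [hy])
  have h2 := ENNReal.toReal_mono (ENNReal.mul_ne_top ENNReal.coe_ne_top enorm_ne_top) h1
  simpa using h2

end VectorValued

/-! ### Families depending linearly on f through a multiplier. -/

/-- The families `u f` are obtained from the Hermite coefficients of `f` by a fixed multiplier and a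
fixed index map. -/
structure IsMultiplierFamily (α : Fin d → ℝ) (ε : Fin d → ZMod 2)
    (u : (EuclideanSpace ℝ (Fin d) → ℂ) → ℝ → EuclideanSpace ℝ (Fin d) → ℂ)
    (g : (Fin d → ℕ) → ℂ) (τ : (Fin d → ℕ) → Fin d → ℕ) (c : ℕ) : Prop where
  admissible : ∀ f, MemLp f 2 (wPlus α) → Admissible (fun m => g m * parityCoeff α ε f m) τ c
  hasExpansion : ∀ f, MemLp f 2 (wPlus α) →
    HasExpansion α (fun m => g m * parityCoeff α ε f m) τ (u f)

section Linear

variable {α : Fin d → ℝ} {ε : Fin d → ZMod 2}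

lemma parityCoeff_add (hα : ∀ i, -1 / 2 ≤ α i) (f g : Lp ℂ 2 (wPlus α)) (m : Fin d → ℕ) :
    parityCoeff α ε (f + g : Lp ℂ 2 (wPlus α)) m = parityCoeff α ε f m + parityCoeff α ε g m := by
  have h : coeff α (f + g : Lp ℂ 2 (wPlus α)) m = coeff α f m + coeff α g m := by
    rw [coeff_congr_ae α (Lp.coeFn_add f g), coeff, coeff, coeff,
      ← integral_add (integrable_coeff hα (Lp.memLp f) m) (integrable_coeff hα (Lp.memLp g) m)]
    simp only [Pi.add_apply, add_mul]
  by_cases hm : m ∈ parityClass ε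
  · rw [parityCoeff, parityCoeff, parityCoeff, Set.indicator_of_mem hm, Set.indicator_of_mem hm,
      Set.indicator_of_mem hm, h]
  · rw [parityCoeff, parityCoeff, parityCoeff, Set.indicator_of_notMem hm,
      Set.indicator_of_notMem hm, Set.indicator_of_notMem hm, add_zero]

lemma parityCoeff_smul (c : ℂ) (f : Lp ℂ 2 (wPlus α)) (m : Fin d → ℕ) :
    parityCoeff α ε (c • f : Lp ℂ 2 (wPlus α)) m = c * parityCoeff α ε f m := by
  have h : coeff α (c • f : Lp ℂ 2 (wPlus α)) m = c * coeff α f m := by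
    rw [coeff_congr_ae α (Lp.coeFn_smul c f), coeff, coeff, ← integral_const_mul]
    simp only [Pi.smul_apply, smul_eq_mul, mul_assoc]
  by_cases hm : m ∈ parityClass ε
  · rw [parityCoeff, parityCoeff, Set.indicator_of_mem hm, Set.indicator_of_mem hm, h]
  · rw [parityCoeff, parityCoeff, Set.indicator_of_notMem hm, Set.indicator_of_notMem hm, mul_zero]

variable {u : (EuclideanSpace ℝ (Fin d) → ℂ) → ℝ → EuclideanSpace ℝ (Fin d) → ℂ}
  {g : (Fin d → ℕ) → ℂ} {τ : (Fin d → ℕ) → Fin d → ℕ} {c : ℕ}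

lemma IsMultiplierFamily.add (hd : 1 ≤ d) (hα : ∀ i, -1 / 2 ≤ α i)
    (hu : IsMultiplierFamily α ε u g τ c) (f₁ f₂ : Lp ℂ 2 (wPlus α)) {t : ℝ} (ht : 0 < t)
    {x : EuclideanSpace ℝ (Fin d)} (hx : x ∈ orthant d) :
    u (f₁ + f₂ : Lp ℂ 2 (wPlus α)) t x = u f₁ t x + u f₂ t x := by
  have h1 := hu.admissible f₁ (Lp.memLp f₁)
  have h2 := hu.admissible f₂ (Lp.memLp f₂)
  rw [hu.hasExpansion _ (Lp.memLp _) t ht x hx, hu.hasExpansion _ (Lp.memLp f₁) t ht x hx,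
    hu.hasExpansion _ (Lp.memLp f₂) t ht x hx, expansion, expansion, expansion,
    ← (summable_expansionTerm hd hα h1.subExp h1.degree_le ht x).tsum_add
      (summable_expansionTerm hd hα h2.subExp h2.degree_le ht x)]
  refine tsum_congr fun m => ?_
  simp only [expansionTerm, parityCoeff_add hα]
  ring

lemma IsMultiplierFamily.smul (hu : IsMultiplierFamily α ε u g τ c) (k : ℂ)
    (f : Lp ℂ 2 (wPlus α)) {t : ℝ} (ht : 0 < t)
    {x : EuclideanSpace ℝ (Fin d)} (hx : x ∈ orthant d) :
    u (k • f : Lp ℂ 2 (wPlus α)) t x = k * u f t x := by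
  rw [hu.hasExpansion _ (Lp.memLp _) t ht x hx, hu.hasExpansion _ (Lp.memLp f) t ht x hx,
    expansion, expansion, ← tsum_mul_left]
  refine tsum_congr fun m => ?_
  simp only [expansionTerm, parityCoeff_smul]
  ring

/-- Bounded vector-valued operators into `L²((0,∞), ρ dt)`. -/
lemma IsMultiplierFamily.boundedVectorL2_time (hd : 1 ≤ d) (hα : ∀ i, -1 / 2 ≤ α i)
    (hu : IsMultiplierFamily α ε u g τ c) {ρ : ℝ → ℝ≥0∞} (hρ : Measurable ρ)
    {ν : Measure ℝ} [SFinite ν] (hν : ∀ᵐ t ∂ν, 0 < t)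
    (hνρ : ∀ F : ℝ → ℝ≥0∞, ∫⁻ t, F t ∂ν = ∫⁻ t in Set.Ioi 0, ρ t * F t) {C : ℝ≥0}
    (hC : ∀ f, MemLp f 2 (wPlus α) → energy α ρ (u f) ≤ (C * eLpNorm f 2 (wPlus α)) ^ 2) :
    BoundedVectorL2 α ν fun f x t => u f t x := by
  refine boundedVectorL2_of_bound C (fun f hf => ⟨_, measurable_expansion α (fun m => g m * parityCoeff α ε f m) τ, ?_⟩)
    (fun f hf => ?_) (fun f₁ f₂ => ?_) fun k f => ?_
  · filter_upwards [ae_mem_orthant α] with x hx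
    filter_upwards [hν] with t ht
    exact hu.hasExpansion f hf t ht x hx
  · refine le_of_eq_of_le ?_ (hC f hf)
    rw [← (hu.hasExpansion f hf).lintegral_timeSq hρ]
    exact lintegral_congr fun x => hνρ _
  · filter_upwards [ae_mem_orthant α] with x hx
    filter_upwards [hν] with t ht
    exact hu.add hd hα f₁ f₂ ht hx
  · filter_upwards [ae_mem_orthant α] with x hx
    filter_upwards [hν] with t ht
    exact hu.smul k f ht hx

end Linear

section Cone

lemma measurableSet_cone (d : ℕ) : MeasurableSet (cone d) := by
  have h1 : MeasurableSet {p : EuclideanSpace ℝ (Fin d) × ℝ | 0 < p.2} :=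
    measurableSet_lt measurable_const measurable_snd
  have h2 : MeasurableSet {p : EuclideanSpace ℝ (Fin d) × ℝ | ‖p.1‖ < Real.sqrt p.2} :=
    measurableSet_lt (by fun_prop) (by fun_prop)
  exact h1.inter h2

lemma measurable_phi (α : Fin d → ℝ) :
    Measurable fun q : EuclideanSpace ℝ (Fin d) × (EuclideanSpace ℝ (Fin d) × ℝ) =>
      phi α q.1 q.2.1 q.2.2 := by
  simp only [phi]
  refine Finset.measurable_prod _ fun j _ => ?_
  have h1 : Measurable fun q : EuclideanSpace ℝ (Fin d) × (EuclideanSpace ℝ (Fin d) × ℝ) =>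
      (q.1 j, q.2.2) := by fun_prop
  have h2 := (measurable_measureReal_Ioo (wPlusOne (α j))).comp h1
  rw [Function.comp_def] at h2
  have h3 : Measurable fun q : EuclideanSpace ℝ (Fin d) × (EuclideanSpace ℝ (Fin d) × ℝ) =>
      (q.1 j + q.2.1 j) ^ (2 * α j + 1) := by fun_prop
  exact h3.div h2

lemma measurable_onCone (α : Fin d → ℝ) {u : ℝ → EuclideanSpace ℝ (Fin d) → ℂ}
    (hu : Measurable fun p : EuclideanSpace ℝ (Fin d) × ℝ => u p.2 p.1) :
    Measurable fun q : EuclideanSpace ℝ (Fin d) × (EuclideanSpace ℝ (Fin d) × ℝ) =>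
      onCone α u q.1 q.2 := by
  have h1 : Measurable fun q : EuclideanSpace ℝ (Fin d) × (EuclideanSpace ℝ (Fin d) × ℝ) =>
      (q.1 + q.2.1, q.2.2) := by fun_prop
  have h2 : Measurable fun q : EuclideanSpace ℝ (Fin d) × (EuclideanSpace ℝ (Fin d) × ℝ) =>
      q.1 + q.2.1 := by fun_prop
  have h3 := hu.comp h1
  rw [Function.comp_def] at h3
  have h4 : Measurable fun q : EuclideanSpace ℝ (Fin d) × (EuclideanSpace ℝ (Fin d) × ℝ) =>
      u q.2.2 (q.1 + q.2.1) * (Real.sqrt (phi α q.1 q.2.1 q.2.2) : ℂ) :=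
    h3.mul (Complex.measurable_ofReal.comp (measurable_phi α).sqrt)
  exact h4.indicator (h2 (measurableSet_orthant d))

/-- The norm in `L²(A, ρ(t) dz dt)` of `(z,t) ↦ u_t(x+z) √φ(x,z,t) χ(x+z)` is the area integral. -/
lemma setLIntegral_onCone {α : Fin d → ℝ} (hα : ∀ i, -1 / 2 ≤ α i) (ρ : ℝ → ℝ≥0∞)
    (u : ℝ → EuclideanSpace ℝ (Fin d) → ℂ) {x : EuclideanSpace ℝ (Fin d)} (hx : x ∈ orthant d) :
    ∫⁻ p in cone d, ρ p.2 * ‖onCone α u x p‖ₑ ^ 2 = areaSq α ρ u x := by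
  set w : EuclideanSpace ℝ (Fin d) × ℝ → ℝ≥0∞ :=
    fun p => ENNReal.ofReal (∏ j, (p.1 j) ^ (2 * α j + 1)) with hw
  have hwm : Measurable w := by
    refine ENNReal.measurable_ofReal.comp (Finset.measurable_prod _ fun j _ => ?_)
    fun_prop
  have hmeas : (wPlus α).prod (volume : Measure ℝ) =
      ((volume : Measure (EuclideanSpace ℝ (Fin d) × ℝ)).restrict
        (orthant d ×ˢ Set.univ)).withDensity w := by
    rw [wPlus, prod_withDensity_left (by fun_prop), Measure.volume_eq_prod, ← Measure.prod_restrict,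
      Measure.restrict_univ]
  have hO : MeasurableSet (orthant d ×ˢ (Set.univ : Set ℝ)) :=
    (measurableSet_orthant d).prod MeasurableSet.univ
  -- Translation by (x, 0) carries the cone A onto A(x). Since u is arbitrary here, the change of
  -- variables goes through a measurable embedding and needs no measurability of the integrand.
  have hT : MeasurePreserving (fun q : EuclideanSpace ℝ (Fin d) × ℝ => (x, (0 : ℝ)) + q)
      volume volume := by
    rw [Measure.volume_eq_prod]
    exact measurePreserving_add_left
      ((volume : Measure (EuclideanSpace ℝ (Fin d))).prod (volume : Measure ℝ)) (x, (0 : ℝ))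
  rw [areaSq, ← lintegral_indicator (measurableSet_coneAt x), hmeas,
    lintegral_withDensity_eq_lintegral_mul_non_measurable _ hwm
      (ae_of_all _ fun p => ENNReal.ofReal_lt_top), ← lintegral_indicator hO,
    ← hT.lintegral_comp_emb (measurableEmbedding_addLeft _), ← lintegral_indicator (measurableSet_cone d)]
  refine lintegral_congr fun q => ?_
  have hmem : (x, (0 : ℝ)) + q ∈ coneAt x ↔ q ∈ cone d := by
    rw [mem_coneAt]
    simp [cone]
  by_cases hq : q ∈ cone d
  · by_cases hy : x + q.1 ∈ orthant d
    · have h1 : (x, (0 : ℝ)) + q ∈ orthant d ×ˢ (Set.univ : Set ℝ) := ⟨hy, trivial⟩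
      rw [Set.indicator_of_mem hq, Set.indicator_of_mem h1, Pi.mul_apply,
        Set.indicator_of_mem (hmem.mpr hq), onCone, Set.indicator_of_mem hy]
      have hv := vol_pos hα (Real.sqrt_pos.mpr hq.1) hx
      have hP : 0 ≤ ∏ j, (x + q.1) j ^ (2 * α j + 1) :=
        Finset.prod_nonneg fun j _ => Real.rpow_nonneg (hy j).le _
      have hphi : phi α x q.1 q.2 =
          (∏ j, (x + q.1) j ^ (2 * α j + 1)) / vol α (Real.sqrt q.2) x := by
        rw [phi, Finset.prod_div_distrib, vol]
        rfl
      have hn : ‖(Real.sqrt (phi α x q.1 q.2) : ℂ)‖ₑ ^ 2 = ENNReal.ofReal (phi α x q.1 q.2) := by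
        rw [← ofReal_norm, Complex.norm_real, Real.norm_of_nonneg (Real.sqrt_nonneg _),
          ← ENNReal.ofReal_pow (Real.sqrt_nonneg _), Real.sq_sqrt (by rw [hphi]; positivity)]
      rw [enorm_mul, mul_pow, hn, hphi, ENNReal.ofReal_div_of_pos hv]
      simp only [hw, Prod.fst_add, Prod.snd_add, zero_add, div_eq_mul_inv]
      ring
    · have h1 : (x, (0 : ℝ)) + q ∉ orthant d ×ˢ (Set.univ : Set ℝ) := fun h => hy h.1
      rw [Set.indicator_of_mem hq, Set.indicator_of_notMem h1, onCone, Set.indicator_of_notMem hy]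
      simp
  · rw [Set.indicator_of_notMem hq]
    refine (Set.indicator_apply_eq_zero.mpr fun _ => ?_).symm
    rw [Pi.mul_apply, Set.indicator_of_notMem (mt hmem.mp hq), mul_zero]

/-- Bounded vector-valued operators into `L²(A, ρ(t) dz dt)`. -/
lemma IsMultiplierFamily.boundedVectorL2_cone {α : Fin d → ℝ} {ε : Fin d → ZMod 2}
    {u : (EuclideanSpace ℝ (Fin d) → ℂ) → ℝ → EuclideanSpace ℝ (Fin d) → ℂ}
    {g : (Fin d → ℕ) → ℂ} {τ : (Fin d → ℕ) → Fin d → ℕ} {c : ℕ}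
    (hd : 1 ≤ d) (hα : ∀ i, -1 / 2 ≤ α i)
    (hu : IsMultiplierFamily α ε u g τ c) {ρ : ℝ → ℝ≥0∞}
    {ν : Measure (EuclideanSpace ℝ (Fin d) × ℝ)} [SFinite ν] (hν : ∀ᵐ p ∂ν, 0 < p.2)
    (hνρ : ∀ F : EuclideanSpace ℝ (Fin d) × ℝ → ℝ≥0∞, ∫⁻ p, F p ∂ν =
      ∫⁻ p in cone d, ρ p.2 * F p) {C : ℝ≥0}
    (hC : ∀ f, MemLp f 2 (wPlus α) →
      ∫⁻ x, areaSq α ρ (u f) x ∂(wPlus α) ≤ (C * eLpNorm f 2 (wPlus α)) ^ 2) :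
    BoundedVectorL2 α ν fun f => onCone α (u f) := by
  -- The indicator only sees the family on the orthant, where it is given by the expansion.
  have hcong : ∀ (v v' : ℝ → EuclideanSpace ℝ (Fin d) → ℂ) (x : EuclideanSpace ℝ (Fin d))
      (p : EuclideanSpace ℝ (Fin d) × ℝ), (∀ y ∈ orthant d, v p.2 y = v' p.2 y) →
      onCone α v x p = onCone α v' x p := by
    intro v v' x p h
    by_cases hy : x + p.1 ∈ orthant d
    · rw [onCone, onCone, Set.indicator_of_mem hy, Set.indicator_of_mem hy, h _ hy]
    · rw [onCone, onCone, Set.indicator_of_notMem hy, Set.indicator_of_notMem hy]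
  refine boundedVectorL2_of_bound C
    (fun f hf => ⟨_, measurable_onCone α
      (measurable_expansion α (fun m => g m * parityCoeff α ε f m) τ), ?_⟩)
    (fun f hf => ?_) (fun f₁ f₂ => ?_) fun k f => ?_
  · refine ae_of_all _ fun x => ?_
    filter_upwards [hν] with p hp
    exact hcong _ (expansion α _ τ) x p fun y hy => hu.hasExpansion f hf _ hp y hy
  · refine le_of_eq_of_le ?_ (hC f hf)
    refine lintegral_congr_ae ((ae_mem_orthant α).mono fun x hx => ?_)
    exact (hνρ _).trans (setLIntegral_onCone hα ρ (u f) hx)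
  · refine ae_of_all _ fun x => ?_
    filter_upwards [hν] with p hp
    rw [hcong _ (fun t y => u f₁ t y + u f₂ t y) x p fun y hy => hu.add hd hα f₁ f₂ hp hy]
    by_cases hy : x + p.1 ∈ orthant d
    · simp only [onCone, Set.indicator_of_mem hy, add_mul]
    · simp only [onCone, Set.indicator_of_notMem hy, add_zero]
  · refine ae_of_all _ fun x => ?_
    filter_upwards [hν] with p hp
    rw [hcong _ (fun t y => k * u f t y) x p fun y hy => hu.smul k f hp hy]
    by_cases hy : x + p.1 ∈ orthant d
    · simp only [onCone, Set.indicator_of_mem hy, mul_assoc]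
    · simp only [onCone, Set.indicator_of_notMem hy, mul_zero]

end Cone

/-! ### From energies to norms of square functions. -/

/-- The functional `Q` is, in `L¹(w_α^+)`, two-sidedly comparable with the energy. -/
def ComparableEnergy (α : Fin d → ℝ) (ρ : ℝ → ℝ≥0∞)
    (Q : (ℝ → EuclideanSpace ℝ (Fin d) → ℂ) → EuclideanSpace ℝ (Fin d) → ℝ≥0∞) : Prop :=
  ∃ c C : ℝ≥0, 0 < c ∧ ∀ (b : (Fin d → ℕ) → ℂ) (τ : (Fin d → ℕ) → Fin d → ℕ)
    (u : ℝ → EuclideanSpace ℝ (Fin d) → ℂ), HasExpansion α b τ u →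
      AEMeasurable (Q u) (wPlus α) ∧ c * energy α ρ u ≤ ∫⁻ x, Q u x ∂(wPlus α) ∧
        ∫⁻ x, Q u x ∂(wPlus α) ≤ C * energy α ρ u

lemma comparableEnergy_timeSq (α : Fin d → ℝ) {ρ : ℝ → ℝ≥0∞} (hρ : Measurable ρ) :
    ComparableEnergy α ρ (timeSq ρ) :=
  ⟨1, 1, one_pos, fun b τ u hu => ⟨hu.aemeasurable_timeSq hρ, by
    rw [hu.lintegral_timeSq hρ]; simp⟩⟩

lemma comparableEnergy_areaSq (hd : 1 ≤ d) {α : Fin d → ℝ} (hα : ∀ i, -1 / 2 ≤ α i)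
    {ρ : ℝ → ℝ≥0∞} (hρ : Measurable ρ) : ComparableEnergy α ρ (areaSq α ρ) := by
  obtain ⟨c, C, hc, h⟩ := exists_areaSq_bounds hd hα
  exact ⟨c, C, hc, fun b τ u hu => ⟨(hu.measurable_areaSq hρ).aemeasurable, h ρ hρ b τ u hu⟩⟩

lemma mul_mul_sq_eq (c K : ℝ≥0) (N : ℝ≥0∞) :
    (c : ℝ≥0∞) * (K * N) ^ 2 = (((NNReal.sqrt c * K : ℝ≥0) : ℝ≥0∞) * N) ^ 2 := by
  have h : ((NNReal.sqrt c : ℝ≥0) : ℝ≥0∞) ^ 2 = c := by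
    rw [← ENNReal.coe_pow, NNReal.sq_sqrt]
  rw [ENNReal.coe_mul, mul_assoc, mul_pow (NNReal.sqrt c : ℝ≥0∞), h]

section Families

variable {α : Fin d → ℝ} {ε : Fin d → ZMod 2} {ρ : ℝ → ℝ≥0∞}
  {Q : (ℝ → EuclideanSpace ℝ (Fin d) → ℂ) → EuclideanSpace ℝ (Fin d) → ℝ≥0∞}
  {ι : Type*} [Fintype ι]
  {u : ι → (EuclideanSpace ℝ (Fin d) → ℂ) → ℝ → EuclideanSpace ℝ (Fin d) → ℂ}
  {g : ι → (Fin d → ℕ) → ℂ} {τ : ι → (Fin d → ℕ) → Fin d → ℕ} {c : ℕ}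
  {S : (EuclideanSpace ℝ (Fin d) → ℂ) → EuclideanSpace ℝ (Fin d) → ℝ≥0∞}

/-- The index type `ι` is `Unit` for a single square function and `Fin d` for an ℓ² sum over
coordinates; `Q` is `timeSq` or `areaSq`. One argument thus serves all cases. -/
lemma eLpNorm_sq_eq_sum (hQ : ComparableEnergy α ρ Q)
    (hu : ∀ j, IsMultiplierFamily α ε (u j) (g j) (τ j) c)
    (hS : ∀ f x, S f x ^ 2 = ∑ j, Q (u j f) x) {f : EuclideanSpace ℝ (Fin d) → ℂ}
    (hf : MemLp f 2 (wPlus α)) :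
    eLpNorm (S f) 2 (wPlus α) ^ 2 = ∑ j, ∫⁻ x, Q (u j f) x ∂(wPlus α) := by
  obtain ⟨c, C, -, h⟩ := hQ
  rw [eLpNorm_two_sq, ← lintegral_finsetSum' _ fun j _ =>
    (h _ _ _ ((hu j).hasExpansion f hf)).1]
  exact lintegral_congr fun x => by rw [enorm_eq_self, hS]

lemma boundedL2_of_energy_le (hQ : ComparableEnergy α ρ Q)
    (hu : ∀ j, IsMultiplierFamily α ε (u j) (g j) (τ j) c)
    (hS : ∀ f x, S f x ^ 2 = ∑ j, Q (u j f) x)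
    (hE : ∃ K : ℝ≥0, ∀ f, MemLp f 2 (wPlus α) → ∀ j,
      energy α ρ (u j f) ≤ (K * eLpNorm f 2 (wPlus α)) ^ 2) :
    BoundedL2 α S := by
  obtain ⟨K, hK⟩ := hE
  have hS2 := fun f hf => eLpNorm_sq_eq_sum hQ hu hS (f := f) hf
  obtain ⟨k, C, -, h⟩ := hQ
  refine ⟨NNReal.sqrt (Fintype.card ι * C) * K, fun f hf => ⟨?_, ?_⟩⟩
  · have h1 : S f = fun x => (∑ j, Q (u j f) x) ^ (1 / 2 : ℝ) := by
      funext x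
      rw [← hS, ← ENNReal.rpow_natCast, ← ENNReal.rpow_mul]
      norm_num
    rw [h1]
    refine AEMeasurable.pow_const ?_ _
    exact Finset.aemeasurable_fun_sum _ fun j _ => (h _ _ _ ((hu j).hasExpansion f hf)).1
  · refine ennreal_le_of_sq_le_sq ?_
    rw [hS2 f hf, ← mul_mul_sq_eq, ENNReal.coe_mul, mul_assoc]
    calc ∑ j, ∫⁻ x, Q (u j f) x ∂(wPlus α)
        ≤ ∑ _j : ι, (C : ℝ≥0∞) * (K * eLpNorm f 2 (wPlus α)) ^ 2 :=
          Finset.sum_le_sum fun j _ => (h _ _ _ ((hu j).hasExpansion f hf)).2.2.trans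
            (mul_le_mul_right (hK f hf j) _)
      _ = _ := by simp

lemma comparableL2_of_le_energy (hQ : ComparableEnergy α ρ Q)
    (hu : ∀ j, IsMultiplierFamily α ε (u j) (g j) (τ j) c)
    (hS : ∀ f x, S f x ^ 2 = ∑ j, Q (u j f) x)
    (hE : ∃ K : ℝ≥0, ∀ f, MemLp f 2 (wPlus α) → ∀ j,
      energy α ρ (u j f) ≤ (K * eLpNorm f 2 (wPlus α)) ^ 2)
    {P : (EuclideanSpace ℝ (Fin d) → ℂ) → Prop}
    (hP : ∃ K : ℝ≥0, 0 < K ∧ ∀ f, MemLp f 2 (wPlus α) → P f →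
      (K * eLpNorm f 2 (wPlus α)) ^ 2 ≤ ∑ j, energy α ρ (u j f)) :
    ComparableL2 α P S := by
  obtain ⟨C', hC'⟩ := boundedL2_of_energy_le hQ hu hS hE
  obtain ⟨K, hK, hKP⟩ := hP
  have hS2 := fun f hf => eLpNorm_sq_eq_sum hQ hu hS (f := f) hf
  obtain ⟨k, C, hk, h⟩ := hQ
  refine ⟨NNReal.sqrt k * K, C', mul_pos (NNReal.sqrt_pos.mpr hk) hK,
    fun f hf hPf => ⟨?_, (hC' f hf).2⟩⟩
  refine ennreal_le_of_sq_le_sq ?_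
  rw [hS2 f hf, ← mul_mul_sq_eq]
  calc (k : ℝ≥0∞) * (K * eLpNorm f 2 (wPlus α)) ^ 2
      ≤ k * ∑ j, energy α ρ (u j f) := mul_le_mul_right (hKP f hf hPf) _
    _ = ∑ j, k * energy α ρ (u j f) := Finset.mul_sum _ _ _
    _ ≤ _ := Finset.sum_le_sum fun j _ => (h _ _ _ ((hu j).hasExpansion f hf)).2.1

end Families

/-! ### The vertical and horizontal families, and the theorem. -/

section Concrete

variable {α : Fin d → ℝ} {ε : Fin d → ZMod 2}

lemma isMultiplierFamily_vertical (hd : 1 ≤ d) (hα : ∀ i, -1 / 2 ≤ α i) :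
    IsMultiplierFamily α ε (vertical α ε) (fun m => -(eigen α (totalDegree m) : ℂ)) id 0 where
  admissible _ hf := admissible_vertical hα hf
  hasExpansion _ hf := hasExpansion_vertical hd hα hf

lemma isMultiplierFamily_horizontal (hd : 1 ≤ d) (hα : ∀ i, -1 / 2 ≤ α i) (j : Fin d) :
    IsMultiplierFamily α ε (horizontal α ε j) (fun m => (ladder (α j) (m j) : ℂ))
      (fun m => Function.update m j (m j - 1)) 1 where
  admissible _ hf := admissible_horizontal hα hf j
  hasExpansion _ hf := hasExpansion_horizontal hd hα hf j

lemma isMultiplierFamily_horizontalStar (hd : 1 ≤ d) (hα : ∀ i, -1 / 2 ≤ α i) (j : Fin d) :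
    IsMultiplierFamily α ε (horizontalStar α ε j) (fun m => (ladder (α j) (m j + 1) : ℂ))
      (fun m => Function.update m j (m j + 1)) 1 where
  admissible _ hf := admissible_horizontalStar hα hf j
  hasExpansion _ hf := hasExpansion_horizontalStar hd hα hf j

lemma ofReal_mul_sq_eq (d : ℕ) (k : ℝ) (N : ℝ≥0∞) :
    ENNReal.ofReal k * ((2⁻¹) ^ d * N) ^ 2 =
      (((NNReal.sqrt k.toNNReal * (2⁻¹) ^ d : ℝ≥0) : ℝ≥0∞) * N) ^ 2 := by
  rw [← mul_mul_sq_eq]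
  congr 4
  norm_num

lemma exists_energy_horizontal_le (hd : 1 ≤ d) (hα : ∀ i, -1 / 2 ≤ α i) :
    ∃ K : ℝ≥0, ∀ f, MemLp f 2 (wPlus α) → ∀ j,
      energy α 1 (horizontal α ε j f) ≤ (K * eLpNorm f 2 (wPlus α)) ^ 2 :=
  ⟨_, fun _ hf j => (energy_ladder_le hd hα hf (fun _ => ladder_nonneg _ _)
    (admissible_horizontal hα hf j) (hasExpansion_horizontal hd hα hf j)
    fun m => ladder_sq_le_eigen hα m j).trans_eq (ofReal_mul_sq_eq d _ _)⟩

lemma exists_energy_horizontalStar_le (hd : 1 ≤ d) (hα : ∀ i, -1 / 2 ≤ α i) :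
    ∃ K : ℝ≥0, ∀ f, MemLp f 2 (wPlus α) → ∀ j,
      energy α 1 (horizontalStar α ε j f) ≤ (K * eLpNorm f 2 (wPlus α)) ^ 2 := by
  obtain ⟨k, -, hk⟩ := exists_ladder_succ_sq_le_eigen hd hα
  exact ⟨_, fun f hf j => (energy_ladder_le hd hα hf (fun _ => ladder_nonneg _ _)
    (admissible_horizontalStar hα hf j) (hasExpansion_horizontalStar hd hα hf j)
    fun m => hk m j).trans_eq (ofReal_mul_sq_eq d _ _)⟩

lemma exists_le_energy_horizontalStar (hd : 1 ≤ d) (hα : ∀ i, -1 / 2 ≤ α i) :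
    ∃ K : ℝ≥0, 0 < K ∧ ∀ f, MemLp f 2 (wPlus α) → True →
      (K * eLpNorm f 2 (wPlus α)) ^ 2 ≤ ∑ j, energy α 1 (horizontalStar α ε j f) := by
  obtain ⟨k, hk0, hk, -⟩ := exists_eigen_le_sum hd hα
  refine ⟨NNReal.sqrt (k / 2).toNNReal * (2⁻¹) ^ d, by positivity, fun f hf _ => ?_⟩
  rw [← ofReal_mul_sq_eq]
  exact le_sum_energy_ladder hd hα hf (fun _ _ => ladder_nonneg _ _)
    (admissible_horizontalStar hα hf) (hasExpansion_horizontalStar hd hα hf) fun m _ => hk m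

/-- The summed lowering multiplier vanishes only at m = 0, so the coefficient there is the only
obstruction. It is zero either because 0 is not in the parity class (ε ≠ 0) or by assumption on f.
-/
lemma exists_le_energy_horizontal (hd : 1 ≤ d) (hα : ∀ i, -1 / 2 ≤ α i)
    {P : (EuclideanSpace ℝ (Fin d) → ℂ) → Prop} (hP : ∀ f, P f → parityCoeff α ε f 0 = 0) :
    ∃ K : ℝ≥0, 0 < K ∧ ∀ f, MemLp f 2 (wPlus α) → P f →
      (K * eLpNorm f 2 (wPlus α)) ^ 2 ≤ ∑ j, energy α 1 (horizontal α ε j f) := by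
  obtain ⟨k, hk0, -, hk⟩ := exists_eigen_le_sum hd hα
  refine ⟨NNReal.sqrt (k / 2).toNNReal * (2⁻¹) ^ d, by positivity, fun f hf hPf => ?_⟩
  rw [← ofReal_mul_sq_eq]
  exact le_sum_energy_ladder hd hα hf (fun _ _ => ladder_nonneg _ _)
    (admissible_horizontal hα hf) (hasExpansion_horizontal hd hα hf) fun m hm =>
      hk m fun h0 => hm (h0 ▸ hP f hPf)

lemma parityCoeff_zero_of_ne (hε : ε ≠ 0) (f : EuclideanSpace ℝ (Fin d) → ℂ) :
    parityCoeff α ε f 0 = 0 := by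
  refine Set.indicator_of_notMem (fun h => hε ?_) _
  funext i
  simpa using (h i).symm

lemma parityCoeff_zero_of_coeff {f : EuclideanSpace ℝ (Fin d) → ℂ} (hf : coeff α f 0 = 0) :
    parityCoeff α ε f 0 = 0 :=
  Set.indicator_apply_eq_zero.mpr fun _ => hf

lemma exists_energy_vertical_eq (hd : 1 ≤ d) (hα : ∀ i, -1 / 2 ≤ α i) :
    ∃ K : ℝ≥0, 0 < K ∧ ∀ f, MemLp f 2 (wPlus α) →
      energy α ENNReal.ofReal (vertical α ε f) = (K * eLpNorm f 2 (wPlus α)) ^ 2 := by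
  refine ⟨(2⁻¹) ^ (d + 1), by positivity, fun f hf => ?_⟩
  rw [energy_vertical hd hα hf]
  congr 2
  norm_num

lemma sqrt_sq_ennreal (a : ℝ≥0∞) : (a ^ (1 / 2 : ℝ)) ^ 2 = a := by
  rw [← ENNReal.rpow_natCast, ← ENNReal.rpow_mul]
  norm_num

lemma gV_sq (f : EuclideanSpace ℝ (Fin d) → ℂ) (x : EuclideanSpace ℝ (Fin d)) :
    gV α ε f x ^ 2 = timeSq ENNReal.ofReal (vertical α ε f) x :=
  eLpNorm_measTdt_sq _ _

lemma gH_sq (j : Fin d) (f : EuclideanSpace ℝ (Fin d) → ℂ) (x : EuclideanSpace ℝ (Fin d)) :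
    gH α ε j f x ^ 2 = timeSq 1 (horizontal α ε j f) x :=
  eLpNorm_measDt_sq _ _

lemma gHStar_sq (j : Fin d) (f : EuclideanSpace ℝ (Fin d) → ℂ) (x : EuclideanSpace ℝ (Fin d)) :
    gHStar α ε j f x ^ 2 = timeSq 1 (horizontalStar α ε j f) x :=
  eLpNorm_measDt_sq _ _

lemma SV_sq (f : EuclideanSpace ℝ (Fin d) → ℂ) (x : EuclideanSpace ℝ (Fin d)) :
    SV α ε f x ^ 2 = areaSq α ENNReal.ofReal (vertical α ε f) x :=
  sqrt_sq_ennreal _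

lemma SH_sq (j : Fin d) (f : EuclideanSpace ℝ (Fin d) → ℂ) (x : EuclideanSpace ℝ (Fin d)) :
    SH α ε j f x ^ 2 = areaSq α 1 (horizontal α ε j f) x := by
  rw [SH, sqrt_sq_ennreal, areaSq]
  simp only [Pi.one_apply, one_mul]

lemma SHStar_sq (j : Fin d) (f : EuclideanSpace ℝ (Fin d) → ℂ) (x : EuclideanSpace ℝ (Fin d)) :
    SHStar α ε j f x ^ 2 = areaSq α 1 (horizontalStar α ε j f) x := by
  rw [SHStar, sqrt_sq_ennreal, areaSq]
  simp only [Pi.one_apply, one_mul]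

lemma ell2_sq {S Q : Fin d → EuclideanSpace ℝ (Fin d) → ℝ≥0∞} (h : ∀ j x, S j x ^ 2 = Q j x)
    (x : EuclideanSpace ℝ (Fin d)) : ell2 S x ^ 2 = ∑ j, Q j x := by
  rw [ell2, sqrt_sq_ennreal]
  exact Finset.sum_congr rfl fun j _ => h j x

lemma lintegral_measDt (F : ℝ → ℝ≥0∞) :
    ∫⁻ t, F t ∂measDt = ∫⁻ t in Set.Ioi 0, (1 : ℝ → ℝ≥0∞) t * F t := by
  simp only [measDt, Pi.one_apply, one_mul]

lemma lintegral_measTdt (F : ℝ → ℝ≥0∞) :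
    ∫⁻ t, F t ∂measTdt = ∫⁻ t in Set.Ioi 0, ENNReal.ofReal t * F t := by
  rw [measTdt, lintegral_withDensity_eq_lintegral_mul_non_measurable _ (by fun_prop)
    (ae_of_all _ fun t => ENNReal.ofReal_lt_top)]
  rfl

lemma lintegral_measConeDt (F : EuclideanSpace ℝ (Fin d) × ℝ → ℝ≥0∞) :
    ∫⁻ p, F p ∂(measConeDt d) = ∫⁻ p in cone d, (1 : ℝ → ℝ≥0∞) p.2 * F p := by
  simp only [measConeDt, Pi.one_apply, one_mul]

lemma lintegral_measConeTdt (F : EuclideanSpace ℝ (Fin d) × ℝ → ℝ≥0∞) :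
    ∫⁻ p, F p ∂(measConeTdt d) = ∫⁻ p in cone d, ENNReal.ofReal p.2 * F p := by
  rw [measConeTdt, lintegral_withDensity_eq_lintegral_mul_non_measurable _ (by fun_prop)
    (ae_of_all _ fun t => ENNReal.ofReal_lt_top)]
  rfl

instance : SFinite measDt := by unfold measDt; infer_instance

instance : SFinite measTdt := by unfold measTdt; infer_instance

instance : SFinite (measConeDt d) := by unfold measConeDt; infer_instance

instance : SFinite (measConeTdt d) := by unfold measConeTdt; infer_instance

lemma ae_pos_measDt : ∀ᵐ t ∂measDt, 0 < t := ae_restrict_mem measurableSet_Ioi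

lemma ae_pos_measTdt : ∀ᵐ t ∂measTdt, 0 < t :=
  (withDensity_absolutelyContinuous _ _).ae_le (ae_restrict_mem measurableSet_Ioi)

lemma ae_pos_measConeDt : ∀ᵐ p ∂(measConeDt d), 0 < p.2 :=
  (ae_restrict_mem (measurableSet_cone d)).mono fun _ h => h.1

lemma ae_pos_measConeTdt : ∀ᵐ p ∂(measConeTdt d), 0 < p.2 :=
  (withDensity_absolutelyContinuous _ _).ae_le ae_pos_measConeDt

lemma exists_lintegral_areaSq_le (hd : 1 ≤ d) (hα : ∀ i, -1 / 2 ≤ α i) {ρ : ℝ → ℝ≥0∞}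
    (hρ : Measurable ρ) {u : (EuclideanSpace ℝ (Fin d) → ℂ) → ℝ → EuclideanSpace ℝ (Fin d) → ℂ}
    {g : (Fin d → ℕ) → ℂ} {τ : (Fin d → ℕ) → Fin d → ℕ} {c : ℕ}
    (hu : IsMultiplierFamily α ε u g τ c) {K : ℝ≥0}
    (hK : ∀ f, MemLp f 2 (wPlus α) → energy α ρ (u f) ≤ (K * eLpNorm f 2 (wPlus α)) ^ 2) :
    ∃ C : ℝ≥0, ∀ f, MemLp f 2 (wPlus α) →
      ∫⁻ x, areaSq α ρ (u f) x ∂(wPlus α) ≤ (C * eLpNorm f 2 (wPlus α)) ^ 2 := by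
  obtain ⟨k, C, -, h⟩ := exists_areaSq_bounds hd hα
  refine ⟨NNReal.sqrt C * K, fun f hf => ?_⟩
  rw [← mul_mul_sq_eq]
  exact (h ρ hρ _ _ _ (hu.hasExpansion f hf)).2.trans (mul_le_mul_right (hK f hf) _)

end Concrete

end LaguerreSquare

theorem mainTheorem5 (d : ℕ) (hd : 1 ≤ d) (α : Fin d → ℝ) (hα : ∀ i, -1 / 2 ≤ α i)
    (ε : Fin d → ZMod 2) :
    -- the series defining the semigroup converges and may be differentiated in `t` and in `x`
    (∀ f, MemLp f 2 (wPlus α) → ∀ t : ℝ, 0 < t →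
      (∀ x, Summable (semigroupTerm α ε f t x)) ∧
      ∀ x ∈ orthant d, DifferentiableAt ℝ (fun s => semigroup α ε f s x) t ∧
        DifferentiableAt ℝ (semigroup α ε f t) x) ∧
    -- boundedness of each of the square functions
    (BoundedL2 α (gV α ε) ∧ BoundedL2 α (SV α ε) ∧
      ∀ j, BoundedL2 α (gH α ε j) ∧ BoundedL2 α (gHStar α ε j) ∧
        BoundedL2 α (SH α ε j) ∧ BoundedL2 α (SHStar α ε j)) ∧
    -- boundedness of the corresponding vector-valued operators
    (BoundedVectorL2 α measTdt (fun f x t => vertical α ε f t x) ∧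
      BoundedVectorL2 α (measConeTdt d) (fun f => onCone α (vertical α ε f)) ∧
      ∀ j, BoundedVectorL2 α measDt (fun f x t => horizontal α ε j f t x) ∧
        BoundedVectorL2 α measDt (fun f x t => horizontalStar α ε j f t x) ∧
        BoundedVectorL2 α (measConeDt d) (fun f => onCone α (horizontal α ε j f)) ∧
        BoundedVectorL2 α (measConeDt d) (fun f => onCone α (horizontalStar α ε j f))) ∧
    -- the vertical square functions
    (∀ f, MemLp f 2 (wPlus α) →
      eLpNorm (gV α ε f) 2 (wPlus α) = (2⁻¹ : ℝ≥0∞) ^ (d + 1) * eLpNorm f 2 (wPlus α)) ∧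
    ComparableL2 α (fun _ => True) (SV α ε) ∧
    -- the horizontal square functions
    BoundedL2 α (fun f => ell2 (fun j => gH α ε j f)) ∧
    BoundedL2 α (fun f => ell2 (fun j => SH α ε j f)) ∧
    ComparableL2 α (fun _ => True) (fun f => ell2 (fun j => gHStar α ε j f)) ∧
    ComparableL2 α (fun _ => True) (fun f => ell2 (fun j => SHStar α ε j f)) ∧
    (ε ≠ 0 →
      ComparableL2 α (fun _ => True) (fun f => ell2 (fun j => gH α ε j f)) ∧
      ComparableL2 α (fun _ => True) (fun f => ell2 (fun j => SH α ε j f))) ∧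
    (ε = 0 →
      ComparableL2 α (fun f => coeff α f 0 = 0) (fun f => ell2 (fun j => gH α ε j f)) ∧
      ComparableL2 α (fun f => coeff α f 0 = 0) (fun f => ell2 (fun j => SH α ε j f))) := by
  have h1m : Measurable (1 : ℝ → ℝ≥0∞) := measurable_one
  have hVm : Measurable ENNReal.ofReal := ENNReal.measurable_ofReal
  have hV := isMultiplierFamily_vertical (ε := ε) hd hα
  have hH := isMultiplierFamily_horizontal (ε := ε) hd hα
  have hG := isMultiplierFamily_horizontalStar (ε := ε) hd hα
  obtain ⟨KV, hKV0, hKV⟩ := exists_energy_vertical_eq (ε := ε) hd hα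
  obtain ⟨KH, hKH⟩ := exists_energy_horizontal_le (ε := ε) hd hα
  obtain ⟨KG, hKG⟩ := exists_energy_horizontalStar_le (ε := ε) hd hα
  have hT1 := comparableEnergy_timeSq α h1m
  have hTt := comparableEnergy_timeSq α hVm
  have hA1 := comparableEnergy_areaSq hd hα h1m
  have hAt := comparableEnergy_areaSq hd hα hVm
  have hgH2 := fun f => ell2_sq fun j x => gH_sq (α := α) (ε := ε) j f x
  have hgG2 := fun f => ell2_sq fun j x => gHStar_sq (α := α) (ε := ε) j f x
  have hSH2 := fun f => ell2_sq fun j x => SH_sq (α := α) (ε := ε) j f x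
  have hSG2 := fun f => ell2_sq fun j x => SHStar_sq (α := α) (ε := ε) j f x
  have hlowG := exists_le_energy_horizontalStar (ε := ε) hd hα
  refine ⟨fun f hf t ht => ⟨fun x => (hasSum_semigroupTerm hd hα ε hf ht x).summable,
      fun x hx => ⟨(hasDerivAt_semigroup hd hα ε hf ht x).differentiableAt,
        differentiableAt_semigroup hd hα ε hf ht hx⟩⟩,
    ⟨?_, ?_, fun j => ⟨?_, ?_, ?_, ?_⟩⟩, ⟨?_, ?_, fun j => ⟨?_, ?_, ?_, ?_⟩⟩, ?_, ?_,
    boundedL2_of_energy_le hT1 hH hgH2 ⟨KH, hKH⟩, boundedL2_of_energy_le hA1 hH hSH2 ⟨KH, hKH⟩,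
    comparableL2_of_le_energy hT1 hG hgG2 ⟨KG, hKG⟩ hlowG,
    comparableL2_of_le_energy hA1 hG hSG2 ⟨KG, hKG⟩ hlowG, fun hε => ?_, fun _ => ?_⟩
  · exact boundedL2_of_energy_le (ι := Unit) hTt (fun _ => hV)
      (fun f x => by simpa using gV_sq f x) ⟨KV, fun f hf _ => (hKV f hf).le⟩
  · exact boundedL2_of_energy_le (ι := Unit) hAt (fun _ => hV)
      (fun f x => by simpa using SV_sq f x) ⟨KV, fun f hf _ => (hKV f hf).le⟩
  · exact boundedL2_of_energy_le (ι := Unit) hT1 (fun _ => hH j)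
      (fun f x => by simpa using gH_sq j f x) ⟨KH, fun f hf _ => hKH f hf j⟩
  · exact boundedL2_of_energy_le (ι := Unit) hT1 (fun _ => hG j)
      (fun f x => by simpa using gHStar_sq j f x) ⟨KG, fun f hf _ => hKG f hf j⟩
  · exact boundedL2_of_energy_le (ι := Unit) hA1 (fun _ => hH j)
      (fun f x => by simpa using SH_sq j f x) ⟨KH, fun f hf _ => hKH f hf j⟩
  · exact boundedL2_of_energy_le (ι := Unit) hA1 (fun _ => hG j)
      (fun f x => by simpa using SHStar_sq j f x) ⟨KG, fun f hf _ => hKG f hf j⟩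
  · exact hV.boundedVectorL2_time hd hα hVm ae_pos_measTdt lintegral_measTdt
      fun f hf => (hKV f hf).le
  · obtain ⟨C, hC⟩ := exists_lintegral_areaSq_le hd hα hVm hV fun f hf => (hKV f hf).le
    exact hV.boundedVectorL2_cone hd hα ae_pos_measConeTdt lintegral_measConeTdt hC
  · exact (hH j).boundedVectorL2_time hd hα h1m ae_pos_measDt lintegral_measDt
      fun f hf => hKH f hf j
  · exact (hG j).boundedVectorL2_time hd hα h1m ae_pos_measDt lintegral_measDt
      fun f hf => hKG f hf j
  · obtain ⟨C, hC⟩ := exists_lintegral_areaSq_le hd hα h1m (hH j) fun f hf => hKH f hf j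
    exact (hH j).boundedVectorL2_cone hd hα ae_pos_measConeDt lintegral_measConeDt hC
  · obtain ⟨C, hC⟩ := exists_lintegral_areaSq_le hd hα h1m (hG j) fun f hf => hKG f hf j
    exact (hG j).boundedVectorL2_cone hd hα ae_pos_measConeDt lintegral_measConeDt hC
  · intro f hf
    have h : eLpNorm (gV α ε f) 2 (wPlus α) ^ 2 =
        ((2⁻¹ : ℝ≥0∞) ^ (d + 1) * eLpNorm f 2 (wPlus α)) ^ 2 := by
      rw [eLpNorm_two_sq, ← energy_vertical (ε := ε) hd hα hf,
        ← (hV.hasExpansion f hf).lintegral_timeSq hVm]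
      exact lintegral_congr fun x => by rw [enorm_eq_self, gV_sq]
    exact le_antisymm (ennreal_le_of_sq_le_sq h.le) (ennreal_le_of_sq_le_sq h.ge)
  · exact comparableL2_of_le_energy (ι := Unit) hAt (fun _ => hV)
      (fun f x => by simpa using SV_sq f x) ⟨KV, fun f hf _ => (hKV f hf).le⟩
      ⟨KV, hKV0, fun f hf _ => by simpa using (hKV f hf).ge⟩
  · have hlow := exists_le_energy_horizontal (P := fun _ => True) hd hα fun f _ =>
      parityCoeff_zero_of_ne (α := α) hε f
    exact ⟨comparableL2_of_le_energy hT1 hH hgH2 ⟨KH, hKH⟩ hlow,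
      comparableL2_of_le_energy hA1 hH hSH2 ⟨KH, hKH⟩ hlow⟩
  · have hlow := exists_le_energy_horizontal (ε := ε) (P := fun f => coeff α f 0 = 0) hd hα
      fun f hf => parityCoeff_zero_of_coeff hf
    exact ⟨comparableL2_of_le_energy hT1 hH hgH2 ⟨KH, hKH⟩ hlow,
      comparableL2_of_le_energy hA1 hH hSH2 ⟨KH, hKH⟩ hlow⟩
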